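/- Let $n\ge 1$, and let $dv$ be the rotation-invariant measure on $\mathbb S^{n-1}$ normalized to total mass $1$. Let $0<c<1$, and let $\sigma$ be measurable with $\int_{\mathbb S^{n-1}}\sigma(v\cdot v')\,dv'=1$ for every $v$ and $\sigma(v\cdot v')\ge\sigma_0>0$ for all $v,v'$. Let $\Sigma_t\ge 0$ be a collision cross section on $(0,\infty)$, integrable on bounded intervals $(0,s)$, and let $$p(s)=\Sigma_t(s)\,e^{-\int_0^s\Sigma_t(\tau)\,d\tau}$$ be its path-length density. Assume $$\int_0^\infty p(s)\,ds=1,\qquad \int_0^\infty s\,p(s)\,ds<\infty,\qquad p(s)=\frac{d_0}{s^{\alpha+1}}\ \text{ for } s>1,$$ with $d_0>0$ (so that $\alpha>1$). Let $Q\in L^1\cap L^2(\mathbb R^n\times\mathbb S^{n-1})$ be real-valued, and choose $$\theta(\epsilon)=\epsilon^2\ \text{ if }\alpha>2,\qquad \theta(\epsilon)=\epsilon^\alpha\ \text{ if }1<\alpha<2,\qquad \theta(\epsilon)=-\epsilon^2\ln\epsilon\ \text{ if }\alpha=2 .$$ For all small $\epsilon>0$ let $\Psi_\epsilon\in L^\infty(0,\infty;L^2(\mathbb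 R^n\times\mathbb S^{n-1}))$ be the solution of the non-classical transport equation in its characteristic form: for almost every $(s,x,v)$, $$\Psi_\epsilon(s,x,v)=\int_0^\infty\!\!\int_{\mathbb S^{n-1}}\bigl(\sigma(v\cdot v')-\theta(\epsilon)(1-c)\bigr)p(\tau)\,\Psi_\epsilon(\tau,x-\epsilon sv,v')\,dv'\,d\tau+\theta(\epsilon)\,Q(x-\epsilon sv,v).$$ (The angular flux is $\psi_\epsilon=\Psi_\epsilon e^{-\int_0^s\Sigma_t}$.) Put $$\phi_\epsilon(x,v)=\int_0^\infty\!\!\int_{\mathbb S^{n-1}}\sigma(v\cdot v')p(s)\Psi_\epsilon(s,x,v')\,dv'\,ds,\qquad q_\epsilon(x,v)=\int_0^\infty\!\!\int_{\mathbb S^{n-1}}\sigma(v\cdot v')p(s)\,Q(x-\epsilon sv',v')\,dv'\,ds,$$ $$\eta_\epsilon(x)=\int_0^\infty\!\!\int_{\mathbb S^{n-1}}\Psi_\epsilon(s,x,v)\,e^{-\int_0^s\Sigma_t(\tau)\,d\tau}\,dv\,ds,\qquad \beta_0=\int_0^\infty e^{-\int_0^s\Sigma_t(\tau)\,d\tau}\,ds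 .$$ Then there is $\Psi_0=\Psi_0(x)\in L^2(\mathbb R^n)$ such that, as $\epsilon\to0^+$: (a) $\Psi_\epsilon\to\Psi_0$ weak-$*$ in $L^\infty(0,\infty;L^2(\mathbb R^n\times\mathbb S^{n-1}))$. (b) $\phi_\epsilon\to\Psi_0$ weakly in $L^2(\mathbb R^n\times\mathbb S^{n-1})$, and $q_\epsilon$ converges weakly in $L^2(\mathbb R^n\times\mathbb S^{n-1})$ to some $q$. Moreover $\Psi_0$ satisfies - (b1) if $\alpha>2$: $\;D_1(-\Delta)\Psi_0+(1-c)\Psi_0=\int_{\mathbb S^{n-1}}Q(x,v)\,dv$; - (b2) if $1<\alpha<2$: $\;D_2(-\Delta)^{\alpha/2}\Psi_0+(1-c)\Psi_0=\int_{\mathbb S^{n-1}}Q(x,v)\,dv$; - (b3) if $\alpha=2$: $\;D_3(-\Delta)\Psi_0+(1-c)\Psi_0=\int_{\mathbb S^{n-1}}Q(x,v)\,dv$. Here $-\Delta$ is taken in the sense of distributions, $(-\Delta)^{\alpha/2}$ is the Fourier multiplier $|\xi|^\alpha$ on $L^2(\mathbb R^n)$, and the coefficients, which are positive in their respective cases,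 are, for every unit vector $e$, $$D_1=\frac1n\,\frac{\bigl(\int_0^\infty s\,p(s)\,ds\bigr)^2\bar\mu_0}{1-\bar\mu_0}+\frac1{2n}\int_0^\infty s^2p(s)\,ds,\qquad \bar\mu_0=\int_{\mathbb S^{n-1}}\sigma(e\cdot v)\,(e\cdot v)\,dv,$$ $$D_2=2d_0\int_{\mathbb S^{n-1}}\int_0^\infty\frac{\sin^2\bigl(\tfrac{\tau(v\cdot e)}2\bigr)}{\tau^{\alpha+1}}\,d\tau\,dv,\qquad D_3=\frac{d_0}2\int_{\mathbb S^{n-1}}(v\cdot e)^2\,dv=\frac{d_0}{2n}.$$ (c) $\beta_0$ is positive and finite, and $\eta_\epsilon\to\eta_0:=\beta_0\Psi_0$ weakly in $L^2(\mathbb R^n)$. Hence $\eta_0$ satisfies the equations in (b1)–(b3) with the right-hand side replaced by $\beta_0\int_{\mathbb S^{n-1}}Q(x,v)\,dv$. -/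

import Mathlib

open MeasureTheory Set Filter Topology
open scoped NNReal ContDiff FourierTransform

noncomputable section

namespace NonclassicalTransport

/-- Position space `ℝⁿ`, with its Euclidean norm. -/
abbrev Pos (n : ℕ) := EuclideanSpace ℝ (Fin n)

/-- Directions: the unit sphere of `ℝⁿ`. -/
abbrev Dir (n : ℕ) := Metric.sphere (0 : Pos n) 1

/-- The cosine `v · v'` of the angle between two directions. -/
def cosine {n : ℕ} (v v' : Dir n) : ℝ := inner ℝ (v : Pos n) (v' : Pos n)

/-- The surface measure on the unit sphere, scaled to have total mass one. -/
def dirMeasure (n : ℕ) : Measure (Dir n) :=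
  ((volume : Measure (Pos n)).toSphere univ)⁻¹ • (volume : Measure (Pos n)).toSphere

/-- The measure `dx dv` on `ℝⁿ × Sⁿ⁻¹`. -/
def phaseMeasure (n : ℕ) : Measure (Pos n × Dir n) :=
  (volume : Measure (Pos n)).prod (dirMeasure n)

/-- Lebesgue measure `ds` on `(0, ∞)`. -/
def pathMeasure : Measure ℝ := volume.restrict (Ioi (0 : ℝ))

/-! ### Function spaces and convergence -/

/-- `u` belongs to `L^∞(0, ∞; L²(ℝⁿ × Sⁿ⁻¹))`. -/
def MemLinftyL2 {n : ℕ} (u : ℝ → Pos n × Dir n → ℝ) : Prop :=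
  AEStronglyMeasurable (fun y : ℝ × (Pos n × Dir n) => u y.1 y.2)
      (pathMeasure.prod (phaseMeasure n)) ∧
    ∃ M : ℝ≥0, ∀ᵐ s ∂pathMeasure, eLpNorm (u s) 2 (phaseMeasure n) ≤ M

/-- `h` belongs to the predual `L¹(0, ∞; L²(ℝⁿ × Sⁿ⁻¹))`. -/
def MemL1L2 {n : ℕ} (h : ℝ → Pos n × Dir n → ℝ) : Prop :=
  AEStronglyMeasurable (fun y : ℝ × (Pos n × Dir n) => h y.1 y.2)
      (pathMeasure.prod (phaseMeasure n)) ∧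
    ∫⁻ s, eLpNorm (h s) 2 (phaseMeasure n) ∂pathMeasure < ⊤

/-- Weak-* convergence `u ε → u₀` in `L^∞(0, ∞; L²(ℝⁿ × Sⁿ⁻¹))` as `ε → 0+`. -/
def TendstoWeakStar {n : ℕ} (u : ℝ → ℝ → Pos n × Dir n → ℝ)
    (u₀ : ℝ → Pos n × Dir n → ℝ) : Prop :=
  (∀ᶠ ε in 𝓝[>] (0 : ℝ), MemLinftyL2 (u ε)) ∧ MemLinftyL2 u₀ ∧
    ∀ h : ℝ → Pos n × Dir n → ℝ, MemL1L2 h →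
      Tendsto (fun ε => ∫ s, ∫ z, h s z * u ε s z ∂phaseMeasure n ∂pathMeasure)
        (𝓝[>] (0 : ℝ)) (𝓝 (∫ s, ∫ z, h s z * u₀ s z ∂phaseMeasure n ∂pathMeasure))

/-- Weak convergence `f ε → f₀` in `L²(μ)` as `ε → 0+`. -/
def TendstoWeakL2 {X : Type*} [MeasurableSpace X] (μ : Measure X)
    (f : ℝ → X → ℝ) (f₀ : X → ℝ) : Prop :=
  (∀ᶠ ε in 𝓝[>] (0 : ℝ), MemLp (f ε) 2 μ) ∧ MemLp f₀ 2 μ ∧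
    ∀ h : X → ℝ, MemLp h 2 μ →
      Tendsto (fun ε => ∫ z, h z * f ε z ∂μ) (𝓝[>] (0 : ℝ)) (𝓝 (∫ z, h z * f₀ z ∂μ))

/-! ### The transport equation -/

/-- `exp (-∫₀ˢ Σ_t)`: the probability that no collision occurs up to path length `s`. -/
def survival (Sigt : ℝ → ℝ) (s : ℝ) : ℝ := Real.exp (-∫ τ in (0 : ℝ)..s, Sigt τ)

/-- The path-length density `p(s) = Σ_t(s) exp (-∫₀ˢ Σ_t)`. -/
def pathDensity (Sigt : ℝ → ℝ) (s : ℝ) : ℝ := Sigt s * survival Sigt s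

/-- `u` is the solution in `L^∞(0, ∞; L²(ℝⁿ × Sⁿ⁻¹))`, in the sense of characteristics, of
`ε⁻¹ ∂ₛ u + v · ∇ₓ u = 0` with
`u(0,x,v) = ∫∫ (σ(v·v') - θ (1-c)) p(τ) u(τ,x,v') dv' dτ + θ Q(x,v)`.
In terms of the angular flux, `u = ψ exp (∫₀ˢ Σ_t)`. -/
def IsTransportSolution {n : ℕ} (σ : ℝ → ℝ) (c : ℝ) (p : ℝ → ℝ) (Q : Pos n × Dir n → ℝ)
    (ε θ : ℝ) (u : ℝ → Pos n × Dir n → ℝ) : Prop :=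
  MemLinftyL2 u ∧
    ∀ᵐ y : ℝ × (Pos n × Dir n) ∂pathMeasure.prod (phaseMeasure n),
      u y.1 y.2 =
        (∫ τ, ∫ v', (σ (cosine y.2.2 v') - θ * (1 - c)) * p τ *
            u τ (y.2.1 - (ε * y.1) • (y.2.2 : Pos n), v') ∂dirMeasure n ∂pathMeasure)
          + θ * Q (y.2.1 - (ε * y.1) • (y.2.2 : Pos n), y.2.2)

/-- The scaling `θ(ε)` of absorption and source. -/
def scaling (α ε : ℝ) : ℝ :=
  if α < 2 then ε ^ α else if α = 2 then -(ε ^ 2 * Real.log ε) else ε ^ 2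

/-- `φ(x,v) = ∫∫ σ(v·v') p(s) u(s,x,v') dv' ds`. -/
def scatteredAverage {n : ℕ} (σ p : ℝ → ℝ) (u : ℝ → Pos n × Dir n → ℝ)
    (z : Pos n × Dir n) : ℝ :=
  ∫ s, ∫ v', σ (cosine z.2 v') * p s * u s (z.1, v') ∂dirMeasure n ∂pathMeasure

/-- `q_ε(x,v) = ∫∫ σ(v·v') p(s) Q(x - ε s v', v') dv' ds`; in Fourier variables,
`∫∫ σ(v·v') p(s) Q̂(ξ,v') exp (-i ε s v'·ξ) dv' ds`. -/
def scatteredSource {n : ℕ} (σ p : ℝ → ℝ) (Q : Pos n × Dir n → ℝ) (ε : ℝ)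
    (z : Pos n × Dir n) : ℝ :=
  ∫ s, ∫ v', σ (cosine z.2 v') * p s * Q (z.1 - (ε * s) • (v' : Pos n), v')
    ∂dirMeasure n ∂pathMeasure

/-- `η(x) = ∫∫ ψ(s,x,v) dv ds`, where `ψ = u exp (-∫₀ˢ Σ_t)`. -/
def totalFlux {n : ℕ} (Sigt : ℝ → ℝ) (u : ℝ → Pos n × Dir n → ℝ) (x : Pos n) : ℝ :=
  ∫ s, ∫ v, u s (x, v) * survival Sigt s ∂dirMeasure n ∂pathMeasure

/-! ### The limit equations -/

/-- `w = -Δ u` in the sense of distributions, with `u, w ∈ L²(ℝⁿ)`. -/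
def IsNegLaplacian {n : ℕ} (u w : Pos n → ℝ) : Prop :=
  MemLp u 2 volume ∧ MemLp w 2 volume ∧
    ∀ g : Pos n → ℝ, ContDiff ℝ ∞ g → HasCompactSupport g →
      ∫ x, u x * (-(Laplacian.laplacian g x)) = ∫ x, w x * g x

/-- `w = (-Δ)^{α/2} u` in `L²(ℝⁿ)`: the Fourier multiplier with symbol `|ξ|^α` of the transform
`∫ u(x) exp (-i x·ξ) dx`, that is, symbol `(2π|ξ|)^α` for Mathlib's Plancherel transform `𝓕`, which
uses `exp (-2πi x·ξ)`. -/
def IsFracLaplacian {n : ℕ} (α : ℝ) (u w : Pos n → ℝ) : Prop :=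
  ∃ U W : Lp ℂ 2 (volume : Measure (Pos n)),
    (∀ᵐ x, U x = (u x : ℂ)) ∧ (∀ᵐ x, W x = (w x : ℂ)) ∧
      ∀ᵐ ξ, (𝓕 W : Lp ℂ 2 (volume : Measure (Pos n))) ξ =
        (((2 * Real.pi * ‖ξ‖) ^ α : ℝ) : ℂ) * (𝓕 U : Lp ℂ 2 (volume : Measure (Pos n))) ξ

/-- `u` solves `D (-Δ) u + κ u = f` in `L²(ℝⁿ)`. -/
def SolvesDiffusion {n : ℕ} (D κ : ℝ) (u f : Pos n → ℝ) : Prop :=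
  ∃ w : Pos n → ℝ, IsNegLaplacian u w ∧ ∀ᵐ x, D * w x + κ * u x = f x

/-- `u` solves `D (-Δ)^{α/2} u + κ u = f` in `L²(ℝⁿ)`. -/
def SolvesFracDiffusion {n : ℕ} (α D κ : ℝ) (u f : Pos n → ℝ) : Prop :=
  ∃ w : Pos n → ℝ, IsFracLaplacian α u w ∧ ∀ᵐ x, D * w x + κ * u x = f x

/-- The velocity average `∫ Q(x,v) dv`. -/
def sourceAverage {n : ℕ} (Q : Pos n × Dir n → ℝ) (x : Pos n) : ℝ :=
  ∫ v, Q (x, v) ∂dirMeasure n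

/-! ### The constants

They are written with an auxiliary unit vector `e`, on which they do not depend by rotation
invariance. -/

/-- The average scattering cosine `μ₀ = ∫ σ(e·v) (e·v) dv`. -/
def meanCosine {n : ℕ} (σ : ℝ → ℝ) (e : Dir n) : ℝ :=
  ∫ v, σ (cosine e v) * cosine e v ∂dirMeasure n

/-- `D₁ = (1/n) (∫ s p)² μ₀ / (1 - μ₀) + (1/2n) ∫ s² p`. -/
def coeffSmallTail {n : ℕ} (σ p : ℝ → ℝ) (e : Dir n) : ℝ :=
  1 / (n : ℝ) * ((∫ s, p s * s ∂pathMeasure) ^ 2 * meanCosine σ e / (1 - meanCosine σ e))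
    + 1 / (2 * (n : ℝ)) * ∫ s, p s * s ^ 2 ∂pathMeasure

/-- `D₂ = 2 d₀ ∫∫ sin² (τ (v·e) / 2) / τ^{α+1} dτ dv`. -/
def coeffFrac {n : ℕ} (α d₀ : ℝ) (e : Dir n) : ℝ :=
  2 * d₀ * ∫ v, ∫ τ, Real.sin (τ * cosine v e / 2) ^ 2 / τ ^ (α + 1)
    ∂pathMeasure ∂dirMeasure n

/-- `D₃ = (d₀ / 2) ∫ (v·e)² dv`. -/
def coeffBorderline {n : ℕ} (d₀ : ℝ) (e : Dir n) : ℝ :=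
  d₀ / 2 * ∫ v, cosine v e ^ 2 ∂dirMeasure n

/-- `β₀ = ∫₀^∞ exp (-∫₀ˢ Σ_t) ds`. -/
def betaZero (Sigt : ℝ → ℝ) : ℝ := ∫ s, survival Sigt s ∂pathMeasure

end NonclassicalTransport

end

/-! Along characteristics the solution is a transported boundary value, `Ψ_ε(s,x,v) = g(x - εsv,
v)`, so everything reduces to one equation `g = K A_ε g + θQ` in `L²` (`exists_reduced`). Here `A_ε`
averages free flight over the law `P` of the path length, and `K` is scattering with kernel `σ -
θ(1-c)`, symmetric, nonnegative and of mass `κ = 1 - θ(1-c)`.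

Two bounds follow from an energy argument (`IsReduced.estimates`). Since `A_ε` is a contraction and
`K` has norm at most `κ`, `‖g‖ ≤ ‖Q‖/(1-c)`. Since `σ ≥ σ₀`, `K` shrinks functions of zero velocity
mean by the factor `1 - σ₀`; hence `g` lies within `O(√θ)` of a function `ρ_ε(x)` of position alone.

The limit equation comes from testing against `φ + εa v·∇φ`. Linear functions of `v` are
eigenfunctions of scattering, so `K` maps this to `κφ + εaμ₀ v·∇φ`, and the transposed operator `1 -
A_ε* K` acts in Fourier variables as multiplication by `1 + iat - P̂(t)(κ + iaμ₀t)` with `t =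
ε·2πv·ξ`. Two properties of this symbol suffice (`SymbolLimit`). Its velocity average divided by `θ`
tends to `m(ξ) = D(2π|ξ|)^{α'} + 1 - c` with `α' = min(α,2)`. Before averaging it is `o(√θ)`; paired
with `g - ρ_ε = O(√θ)` it contributes `o(θ)`, which disappears after division by `θ`. For `α > 2`,
`√θ = ε`, and the second property requires the order `t` term to cancel, that is `a(1-μ₀) = ∫ s p`;
this corrector produces the `μ₀` term of `D₁`. For `α ≤ 2`, already `ε = o(√θ)`, so `a = 0` works
and the anisotropy of `σ` leaves no trace in the limit. The regimes differ through the size of `Re(1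
- P̂)` at small frequency (`TailScaling`): the odd imaginary part averages to zero over the sphere.

The outcome is that `⟨ρ_ε, m(D)φ⟩` tends to `⟨∫Q dv, φ⟩` for every real Schwartz `φ`. As `m ≥ 1-c >
0`, the functions `m(D)φ` are total in `L²`, so the bounded family `ρ_ε` converges weakly, with no
passage to subsequences, to `m(D)⁻¹∫Q dv` (`IsSymbol.exists_weak_limit`,
`SymbolLimit.exists_limit`). The other quantities arise from `g` or `Q` by shifts of vanishing
length and fixed bounded operators; shifts are moved onto the test function, where they converge
strongly. For the total flux, `survival / β₀` serves as a second path-length density. -/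

namespace NonclassicalTransport

variable {n : ℕ}

/-! ### Rotation invariance on the sphere, and the scattering kernel on linear functions. -/

section Sphere

instance nontrivial_pos [NeZero n] : Nontrivial (Pos n) := by
  have : Nonempty (Fin n) := ⟨0⟩
  infer_instance

instance isProbabilityMeasure_dirMeasure [NeZero n] : IsProbabilityMeasure (dirMeasure n) := by
  constructor
  have h0 : (volume : Measure (Pos n)).toSphere univ ≠ 0 := by
    rw [Ne, Measure.measure_univ_eq_zero]
    exact Measure.toSphere_ne_zero _
  simp only [dirMeasure, Measure.smul_apply, smul_eq_mul]
  exact ENNReal.inv_mul_cancel h0 (measure_ne_top _ _)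

/-- In dimension zero the sphere measure is zero and stays zero after normalization. Having
finiteness for every `n` frees many later lemmas from `NeZero n`. -/
instance isFiniteMeasure_dirMeasure : IsFiniteMeasure (dirMeasure n) := by
  rcases Nat.eq_zero_or_pos n with rfl | h
  · have : (volume : Measure (Pos 0)).toSphere = 0 := by
      rw [Measure.toSphere_eq_zero_iff]; infer_instance
    rw [dirMeasure, this]
    simpa using (inferInstance : IsFiniteMeasure (0 : Measure (Dir 0)))
  · have : NeZero n := ⟨h.ne'⟩
    infer_instance

instance sfinite_phaseMeasure : SigmaFinite (phaseMeasure n) := by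
  unfold phaseMeasure; infer_instance

instance sfinite_pathMeasure : SigmaFinite pathMeasure := by
  unfold pathMeasure; infer_instance

/-- The action of a linear isometry on directions. -/
noncomputable def dirMap (L : Pos n ≃ₗᵢ[ℝ] Pos n) (v : Dir n) : Dir n :=
  ⟨L v, by simp⟩

@[simp] lemma coe_dirMap (L : Pos n ≃ₗᵢ[ℝ] Pos n) (v : Dir n) : (dirMap L v : Pos n) = L v := rfl

lemma continuous_dirMap (L : Pos n ≃ₗᵢ[ℝ] Pos n) : Continuous (dirMap L) :=
  (L.continuous.comp continuous_subtype_val).subtype_mk _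

open scoped Pointwise in
-- The sphere measure of a set is, up to a constant, the volume of the cone `(0,1)·s` over it, and a
-- linear isometry carries cones to cones and preserves volume.
lemma measurePreserving_dirMap (L : Pos n ≃ₗᵢ[ℝ] Pos n) :
    MeasurePreserving (dirMap L) (dirMeasure n) (dirMeasure n) := by
  have hm : Measurable (dirMap L) := (continuous_dirMap L).measurable
  refine ⟨hm, ?_⟩
  rw [dirMeasure, Measure.map_smul]
  congr 1
  ext s hs
  rw [Measure.map_apply hm hs, Measure.toSphere_apply' _ hs, Measure.toSphere_apply' _ (hm hs)]
  congr 1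
  have : Ioo (0 : ℝ) 1 • ((↑) '' (dirMap L ⁻¹' s) : Set (Pos n))
      = L ⁻¹' (Ioo (0 : ℝ) 1 • ((↑) '' s : Set (Pos n))) := by
    ext x
    simp only [Set.mem_smul, mem_image, mem_preimage]
    constructor
    · rintro ⟨r, hr, _, ⟨v, hv, rfl⟩, rfl⟩
      exact ⟨r, hr, _, ⟨_, hv, rfl⟩, by simp⟩
    · rintro ⟨r, hr, _, ⟨v, hv, rfl⟩, h⟩
      refine ⟨r, hr, _, ⟨dirMap L.symm v, ?_, rfl⟩, ?_⟩
      · have : dirMap L (dirMap L.symm v) = v := by ext1; simp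
        rwa [this]
      · apply L.injective
        simp [h]
  rw [this]
  exact (L.measurePreserving).measure_preimage_equiv (f := L.toHomeomorph.toMeasurableEquiv) _

lemma integral_dirMap {E : Type*} [NormedAddCommGroup E] [NormedSpace ℝ E]
    (L : Pos n ≃ₗᵢ[ℝ] Pos n) (F : Dir n → E) :
    ∫ v, F (dirMap L v) ∂dirMeasure n = ∫ v, F v ∂dirMeasure n := by
  have hinj : Function.Injective (dirMap L) := fun v w h => by
    ext1; exact L.injective (congrArg Subtype.val h)
  exact (measurePreserving_dirMap L).integral_comp
    ((continuous_dirMap L).measurableEmbedding hinj) F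

lemma integral_dir_neg {E : Type*} [NormedAddCommGroup E] [NormedSpace ℝ E] (F : Dir n → E) :
    ∫ v, F (-v) ∂dirMeasure n = ∫ v, F v ∂dirMeasure n := by
  rw [← integral_dirMap (LinearIsometryEquiv.neg ℝ) F]
  congr with v

lemma continuous_cosine : Continuous (fun p : Dir n × Dir n => cosine p.1 p.2) := by
  unfold cosine; fun_prop

lemma measurable_cosine : Measurable (fun p : Dir n × Dir n => cosine p.1 p.2) :=
  continuous_cosine.measurable

lemma cosine_comm (v w : Dir n) : cosine v w = cosine w v := real_inner_comm _ _

lemma abs_cosine_le_one (v w : Dir n) : |cosine v w| ≤ 1 := by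
  have := abs_real_inner_le_norm (v : Pos n) (w : Pos n)
  simpa [cosine] using this

/-- The reflection in the hyperplane orthogonal to `e - e'` exchanges two vectors of equal norm. -/
lemma exists_isometry_dir (e e' : Dir n) : ∃ L : Pos n ≃ₗᵢ[ℝ] Pos n, L e = e' := by
  refine ⟨(ℝ ∙ ((e : Pos n) - e'))ᗮ.reflection, ?_⟩
  exact Submodule.reflection_sub (by simp)

/-- Zonal integrals do not depend on the axis. -/
lemma integral_cosine_congr {E : Type*} [NormedAddCommGroup E] [NormedSpace ℝ E]
    (F : ℝ → E) (e e' : Dir n) :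
    ∫ v, F (cosine e v) ∂dirMeasure n = ∫ v, F (cosine e' v) ∂dirMeasure n := by
  obtain ⟨L, hL⟩ := exists_isometry_dir e e'
  rw [← integral_dirMap L (fun v => F (cosine e' v))]
  congr with v
  simp only [cosine, coe_dirMap, ← hL, L.inner_map_map]

lemma integrable_inner_dir (ξ : Pos n) :
    Integrable (fun v : Dir n => inner ℝ (v : Pos n) ξ) (dirMeasure n) := by
  refine Integrable.of_bound (C := ‖ξ‖) (by fun_prop) (ae_of_all _ fun v => ?_)
  have := abs_real_inner_le_norm (v : Pos n) ξ
  simpa using this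

lemma integral_inner_dir (ξ : Pos n) : ∫ v : Dir n, inner ℝ (v : Pos n) ξ ∂dirMeasure n = 0 := by
  have h := integral_dir_neg (fun v : Dir n => inner ℝ (v : Pos n) ξ)
  have h2 : (fun v : Dir n => inner ℝ ((-v : Dir n) : Pos n) ξ)
      = fun v : Dir n => -inner ℝ (v : Pos n) ξ := by
    funext v; simp
  rw [h2, integral_neg] at h
  linarith

lemma exists_smul_dir [NeZero n] (ξ : Pos n) : ∃ e : Dir n, ξ = ‖ξ‖ • (e : Pos n) := by
  by_cases h : ξ = 0
  · obtain ⟨x, hx⟩ := exists_norm_eq (Pos n) zero_le_one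
    exact ⟨⟨x, by simp [hx]⟩, by simp [h]⟩
  · refine ⟨⟨‖ξ‖⁻¹ • ξ, by simp [norm_smul, h]⟩, ?_⟩
    rw [smul_inv_smul₀ (by simpa using h)]

lemma integrable_cosine_sq (e : Dir n) :
    Integrable (fun v => cosine v e ^ 2) (dirMeasure n) := by
  refine Integrable.of_bound (C := 1) ?_ (ae_of_all _ fun v => ?_)
  · exact ((continuous_cosine.comp (continuous_id.prodMk continuous_const)).pow 2).aestronglyMeasurable
  · rw [Real.norm_eq_abs, abs_pow]
    exact pow_le_one₀ (abs_nonneg _) (abs_cosine_le_one _ _)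

/-- The `n` coordinate axes give equal integrals by rotation invariance, and the squared coordinates
of a unit vector sum to one. -/
lemma integral_cosine_sq [NeZero n] (e : Dir n) :
    ∫ v, cosine v e ^ 2 ∂dirMeasure n = 1 / n := by
  let b : Fin n → Dir n := fun i => ⟨EuclideanSpace.single i 1, by simp⟩
  have h1 : ∀ i, ∫ v, cosine v (b i) ^ 2 ∂dirMeasure n = ∫ v, cosine v e ^ 2 ∂dirMeasure n := by
    intro i
    simp_rw [cosine_comm _ (b i), cosine_comm _ e]
    exact integral_cosine_congr (fun x => x ^ 2) _ _
  have h2 : ∑ i, ∫ v, cosine v (b i) ^ 2 ∂dirMeasure n = 1 := by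
    rw [← integral_finsetSum _ (fun i _ => integrable_cosine_sq _)]
    have : ∀ v : Dir n, ∑ i, cosine v (b i) ^ 2 = 1 := by
      intro v
      have h3 : ‖(v : Pos n)‖ ^ 2 = 1 := by simp
      rw [EuclideanSpace.norm_sq_eq] at h3
      rw [← h3]
      refine Finset.sum_congr rfl fun i _ => ?_
      simp [cosine, b, EuclideanSpace.inner_single_right]
    simp [this]
  simp_rw [h1] at h2
  have hn : (n : ℝ) ≠ 0 := by exact_mod_cast NeZero.ne n
  simp at h2
  field_simp
  linarith

lemma integral_abs_inner_rpow [NeZero n] (α : ℝ) (ξ : Pos n) (e : Dir n) :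
    ∫ v : Dir n, |inner ℝ (v : Pos n) ξ| ^ α ∂dirMeasure n
      = ‖ξ‖ ^ α * ∫ v, |cosine v e| ^ α ∂dirMeasure n := by
  obtain ⟨e', he'⟩ := exists_smul_dir ξ
  have : ∀ v : Dir n, |inner ℝ (v : Pos n) ξ| ^ α = ‖ξ‖ ^ α * |cosine e' v| ^ α := by
    intro v
    have h1 : inner ℝ (v : Pos n) ξ = ‖ξ‖ * cosine e' v := by
      conv_lhs => rw [he']
      rw [inner_smul_right, cosine_comm]; rfl
    rw [h1, abs_mul, abs_norm, Real.mul_rpow (norm_nonneg _) (abs_nonneg _)]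
  simp_rw [this, integral_const_mul, cosine_comm _ e]
  rw [integral_cosine_congr (fun x => |x| ^ α) e' e]

variable {σ : ℝ → ℝ}

/-- A non-integrable function has Bochner integral zero, so the normalization to one already forces
integrability. -/
lemma integrable_kernel (hσ_norm : ∀ v : Dir n, ∫ v', σ (cosine v v') ∂dirMeasure n = 1)
    (v : Dir n) : Integrable (fun v' => σ (cosine v v')) (dirMeasure n) := by
  by_contra h
  have := hσ_norm v
  rw [integral_undef h] at this
  exact zero_ne_one this

lemma integrable_kernel_mul_inner
    (hσ_norm : ∀ v : Dir n, ∫ v', σ (cosine v v') ∂dirMeasure n = 1)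
    (v : Dir n) (ξ : Pos n) :
    Integrable (fun v' : Dir n => σ (cosine v v') * inner ℝ (v' : Pos n) ξ) (dirMeasure n) := by
  refine (integrable_kernel hσ_norm v).mul_bdd (c := ‖ξ‖) (by fun_prop) (ae_of_all _ fun v' => ?_)
  have := abs_real_inner_le_norm (v' : Pos n) ξ
  simpa using this

/-- Linear functions are eigenfunctions of the scattering operator. -/
lemma integral_kernel_mul_inner
    (hσ_norm : ∀ v : Dir n, ∫ v', σ (cosine v v') ∂dirMeasure n = 1)
    (e v : Dir n) (ξ : Pos n) :
    ∫ v' : Dir n, σ (cosine v v') * inner ℝ (v' : Pos n) ξ ∂dirMeasure n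
      = meanCosine σ e * inner ℝ (v : Pos n) ξ := by
  -- The reflection fixing the axis `v` keeps `v·v'` and sends `v'` to `2(v·v')v - v'`. Comparing
  -- the integral with its reflected form leaves only the component of `v'` along `v`.
  have h1 := integral_dirMap ((ℝ ∙ (v : Pos n)).reflection)
    (fun v' : Dir n => σ (cosine v v') * inner ℝ (v' : Pos n) ξ)
  have hv : ∀ v' : Dir n, σ (cosine v (dirMap (ℝ ∙ (v : Pos n)).reflection v'))
      * inner ℝ ((dirMap (ℝ ∙ (v : Pos n)).reflection v' : Dir n) : Pos n) ξ
      = 2 * inner ℝ (v : Pos n) ξ * (σ (cosine v v') * cosine v v')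
        - σ (cosine v v') * inner ℝ (v' : Pos n) ξ := by
    intro v'
    have hr : (ℝ ∙ (v : Pos n)).reflection (v' : Pos n) = (2 * cosine v v') • (v : Pos n) - v' := by
      rw [Submodule.reflection_singleton_apply]
      simp [cosine, two_smul, add_smul, two_mul]
    have hc : cosine v (dirMap (ℝ ∙ (v : Pos n)).reflection v') = cosine v v' := by
      change inner ℝ (v : Pos n) ((ℝ ∙ (v : Pos n)).reflection (v' : Pos n)) = _
      rw [hr, inner_sub_right, inner_smul_right, real_inner_self_eq_norm_sq]
      simp only [cosine, norm_eq_of_mem_sphere]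
      ring
    rw [hc, coe_dirMap, hr, inner_sub_left, inner_smul_left]
    simp
    ring
  have hi := integrable_kernel_mul_inner hσ_norm v ξ
  have hi2 : Integrable (fun v' : Dir n => σ (cosine v v') * cosine v v') (dirMeasure n) := by
    have := integrable_kernel_mul_inner hσ_norm v (v : Pos n)
    refine this.congr (ae_of_all _ fun v' => ?_)
    simp only [cosine, real_inner_comm]
  simp_rw [hv] at h1
  rw [integral_sub (hi2.const_mul _) hi, integral_const_mul] at h1
  have h2 : meanCosine σ e = ∫ v', σ (cosine v v') * cosine v v' ∂dirMeasure n :=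
    integral_cosine_congr (fun x => σ x * x) e v
  rw [h2]
  linarith

lemma meanCosine_congr (e e' : Dir n) : meanCosine σ e = meanCosine σ e' :=
  integral_cosine_congr (fun x => σ x * x) e e'

/-- Integrating `σ₀(1 - t cos) ≤ σ(1 - t cos)` with `t = ±1` gives `|μ₀| ≤ 1 - σ₀`, since the cosine
has mean zero. -/
lemma abs_meanCosine_lt_one [NeZero n] {σ₀ : ℝ} (hσ₀ : 0 < σ₀)
    (hσ_lower : ∀ v v' : Dir n, σ₀ ≤ σ (cosine v v'))
    (hσ_norm : ∀ v : Dir n, ∫ v', σ (cosine v v') ∂dirMeasure n = 1) (e : Dir n) :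
    |meanCosine σ e| < 1 := by
  have hi2 : Integrable (fun v' : Dir n => σ (cosine e v') * cosine e v') (dirMeasure n) := by
    have := integrable_kernel_mul_inner hσ_norm e (e : Pos n)
    refine this.congr (ae_of_all _ fun v' => ?_)
    simp only [cosine, real_inner_comm]
  have hic : Integrable (fun v' : Dir n => cosine e v') (dirMeasure n) := by
    refine (integrable_inner_dir (e : Pos n)).congr (ae_of_all _ fun v' => ?_)
    simp only [cosine, real_inner_comm]
  have hc0 : ∫ v', cosine e v' ∂dirMeasure n = 0 := by
    rw [← integral_inner_dir (e : Pos n)]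
    simp only [cosine, real_inner_comm]
  have key : ∀ t : ℝ, |t| = 1 → t * meanCosine σ e ≤ 1 - σ₀ := by
    intro t ht
    have h : ∫ v', σ₀ * (1 - t * cosine e v') ∂dirMeasure n
        ≤ ∫ v', (σ (cosine e v') - t * (σ (cosine e v') * cosine e v')) ∂dirMeasure n := by
      refine integral_mono (((integrable_const _).sub (hic.const_mul t)).const_mul _)
        ((integrable_kernel hσ_norm e).sub (hi2.const_mul t)) fun v' => ?_
      have h1 : t * cosine e v' ≤ 1 := by
        refine (le_abs_self _).trans ?_
        rw [abs_mul, ht, one_mul]; exact abs_cosine_le_one _ _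
      have := mul_le_mul_of_nonneg_right (hσ_lower e v') (sub_nonneg.2 h1)
      simp only
      nlinarith
    rw [integral_const_mul, integral_sub (integrable_const _) (hic.const_mul t),
      integral_sub (integrable_kernel hσ_norm e) (hi2.const_mul t), integral_const_mul,
      integral_const_mul, hc0, hσ_norm] at h
    simp at h
    change σ₀ ≤ 1 - t * meanCosine σ e at h
    linarith
  have h1 := key 1 (by simp)
  have h2 := key (-1) (by simp)
  rw [abs_lt]; constructor <;> linarith

lemma lower_le_one [NeZero n] {σ₀ : ℝ}
    (hσ_lower : ∀ v v' : Dir n, σ₀ ≤ σ (cosine v v'))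
    (hσ_norm : ∀ v : Dir n, ∫ v', σ (cosine v v') ∂dirMeasure n = 1) : σ₀ ≤ 1 := by
  obtain ⟨e, -⟩ := exists_smul_dir (0 : Pos n)
  have := integral_mono (integrable_const σ₀) (integrable_kernel hσ_norm e) (hσ_lower e)
  simpa [hσ_norm] using this

end Sphere

end NonclassicalTransport

namespace NonclassicalTransport

/-! ### The path-length density, its survival function and its law. -/

section PathLaw

/-- The cross section is only integrable, so the survival function is only absolutely continuous;
this makes the fundamental theorem of calculus available for it. The exponential is Lipschitz on the
bounded range of `f`. -/
lemma absolutelyContinuousOnInterval_exp_comp {f : ℝ → ℝ} {a b : ℝ}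
    (hf : AbsolutelyContinuousOnInterval f a b) :
    AbsolutelyContinuousOnInterval (fun x => Real.exp (f x)) a b := by
  obtain ⟨C, hC⟩ := hf.exists_bound
  have hlip : ∀ x ∈ Icc (-C) C, ∀ y ∈ Icc (-C) C,
      dist (Real.exp x) (Real.exp y) ≤ Real.exp C * dist x y := by
    intro x hx y hy
    have := (convex_Icc (-C) C).norm_image_sub_le_of_norm_deriv_le (f := Real.exp)
      (C := Real.exp C) (fun z _ => Real.differentiableAt_exp) (fun z hz => by
        simpa using hz.2) hx hy
    rw [dist_comm, dist_comm x y, dist_eq_norm, dist_eq_norm]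
    exact this
  have h0 : Tendsto (fun E : ℕ × (ℕ → ℝ × ℝ) => Real.exp C *
      ∑ i ∈ Finset.range E.1, dist (f (E.2 i).1) (f (E.2 i).2))
      (AbsolutelyContinuousOnInterval.totalLengthFilter ⊓
        𝓟 (AbsolutelyContinuousOnInterval.disjWithin a b)) (𝓝 0) := by
    simpa using Tendsto.const_mul (Real.exp C) hf
  refine squeeze_zero' (Eventually.of_forall fun E => Finset.sum_nonneg fun _ _ => dist_nonneg)
    ?_ h0
  have hmem : ∀ᶠ E in (AbsolutelyContinuousOnInterval.totalLengthFilter ⊓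
        𝓟 (AbsolutelyContinuousOnInterval.disjWithin a b)),
      E ∈ AbsolutelyContinuousOnInterval.disjWithin a b :=
    mem_inf_of_right (mem_principal_self _)
  filter_upwards [hmem] with E hE
  rw [Finset.mul_sum]
  refine Finset.sum_le_sum fun i hi => ?_
  have h1 := hE.1 i hi
  exact hlip _ (abs_le.1 (hC _ h1.1)) _ (abs_le.1 (hC _ h1.2))

variable {Sigt : ℝ → ℝ}

/-- Almost everywhere the derivative of the survival function is `-p`, and absolute continuity
allows integrating this back from the value one at zero. -/
lemma survival_eq_one_sub (hSigt_int : ∀ s : ℝ, 0 < s → IntervalIntegrable Sigt volume 0 s)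
    {s : ℝ} (hs : 0 < s) :
    survival Sigt s = 1 - ∫ τ in (0 : ℝ)..s, pathDensity Sigt τ := by
  have hI := hSigt_int s hs
  have hE := hI.absolutelyContinuousOnInterval_intervalIntegral (c := 0) (by simp)
  have hS : AbsolutelyContinuousOnInterval (survival Sigt) 0 s :=
    absolutelyContinuousOnInterval_exp_comp hE.neg
  have h1 := hS.integral_deriv_eq_sub
  have h2 : ∫ x in (0 : ℝ)..s, deriv (survival Sigt) x
      = ∫ x in (0 : ℝ)..s, -pathDensity Sigt x := by
    refine intervalIntegral.integral_congr_ae ?_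
    filter_upwards [hI.ae_hasDerivAt_integral] with x hx hxs
    have hd := hx (uIoc_subset_uIcc hxs) 0 (by simp)
    have : HasDerivAt (survival Sigt) (survival Sigt x * (-Sigt x)) x := hd.neg.exp
    rw [this.deriv, pathDensity]; ring
  have h0 : survival Sigt 0 = 1 := by simp [survival]
  rw [h2, intervalIntegral.integral_neg, h0] at h1
  linarith

lemma survival_pos (s : ℝ) : 0 < survival Sigt s := Real.exp_pos _

lemma continuousOn_survival (hSigt_int : ∀ s : ℝ, 0 < s → IntervalIntegrable Sigt volume 0 s) :
    ContinuousOn (survival Sigt) (Ioi 0) := by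
  intro s hs
  have hs : 0 < s := hs
  have h1 : ContinuousOn (fun x => ∫ τ in (0 : ℝ)..x, Sigt τ) (uIcc 0 (s + 1)) :=
    intervalIntegral.continuousOn_primitive_interval
      ((hSigt_int (s + 1) (by linarith)).def'.congr_set_ae
        (by rw [uIoc_of_le (by linarith), uIcc_of_le (by linarith)]; exact Ioc_ae_eq_Icc.symm))
  rw [uIcc_of_le (by linarith)] at h1
  have h2 : ContinuousAt (fun x => ∫ τ in (0 : ℝ)..x, Sigt τ) s :=
    h1.continuousAt (Icc_mem_nhds hs (by linarith))
  exact (Real.continuous_exp.continuousAt.comp h2.neg).continuousWithinAt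

lemma aestronglyMeasurable_survival
    (hSigt_int : ∀ s : ℝ, 0 < s → IntervalIntegrable Sigt volume 0 s) :
    AEStronglyMeasurable (survival Sigt) pathMeasure :=
  (continuousOn_survival hSigt_int).aestronglyMeasurable measurableSet_Ioi

lemma survival_le_one (hSigt_nonneg : ∀ s : ℝ, 0 < s → 0 ≤ Sigt s) {s : ℝ} (hs : 0 < s) :
    survival Sigt s ≤ 1 := by
  rw [survival, Real.exp_le_one_iff, Left.neg_nonpos_iff]
  refine intervalIntegral.integral_nonneg_of_ae_restrict hs.le ?_
  have h0 : ∀ᵐ u ∂(volume.restrict (Icc (0:ℝ) s)), u ∈ Ioc (0:ℝ) s := by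
    rw [← restrict_Ioc_eq_restrict_Icc]
    exact ae_restrict_mem measurableSet_Ioc
  filter_upwards [h0] with u hu
  exact hSigt_nonneg u hu.1

lemma pathDensity_nonneg (hSigt_nonneg : ∀ s : ℝ, 0 < s → 0 ≤ Sigt s) {s : ℝ} (hs : 0 < s) :
    0 ≤ pathDensity Sigt s := mul_nonneg (hSigt_nonneg s hs) (survival_pos s).le

lemma integrable_pathDensity (hp_one : ∫ s, pathDensity Sigt s ∂pathMeasure = 1) :
    Integrable (pathDensity Sigt) pathMeasure := by
  by_contra h
  rw [integral_undef h] at hp_one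
  exact zero_ne_one hp_one

/-- The law of the path length, with density `p` on `(0, ∞)`. -/
noncomputable def pathLaw (p : ℝ → ℝ) : Measure ℝ :=
  pathMeasure.withDensity (fun s => ENNReal.ofReal (p s))

lemma pathLaw_absolutelyContinuous (p : ℝ → ℝ) : pathLaw p ≪ pathMeasure :=
  withDensity_absolutelyContinuous _ _

variable {p : ℝ → ℝ}

lemma ae_pos_pathMeasure : ∀ᵐ s ∂pathMeasure, 0 < s := ae_restrict_mem measurableSet_Ioi

lemma ae_pos_pathLaw : ∀ᵐ s ∂pathLaw p, 0 < s :=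
  (pathLaw_absolutelyContinuous p).ae_le ae_pos_pathMeasure

lemma isProbabilityMeasure_pathLaw (hp0 : ∀ s, 0 < s → 0 ≤ p s)
    (hp_one : ∫ s, p s ∂pathMeasure = 1) : IsProbabilityMeasure (pathLaw p) := by
  have hi : Integrable p pathMeasure := by
    by_contra h
    rw [integral_undef h] at hp_one
    exact zero_ne_one hp_one
  constructor
  rw [pathLaw, withDensity_apply _ MeasurableSet.univ, Measure.restrict_univ,
    ← ofReal_integral_eq_lintegral_ofReal hi (ae_pos_pathMeasure.mono hp0), hp_one]
  simp

lemma integral_pathLaw {E : Type*} [NormedAddCommGroup E] [NormedSpace ℝ E]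
    (hp0 : ∀ s, 0 < s → 0 ≤ p s) (hpm : AEMeasurable p pathMeasure) (F : ℝ → E) :
    ∫ s, F s ∂pathLaw p = ∫ s, p s • F s ∂pathMeasure := by
  rw [pathLaw, integral_withDensity_eq_integral_toReal_smul₀ hpm.ennreal_ofReal
    (ae_of_all _ fun _ => ENNReal.ofReal_lt_top)]
  refine integral_congr_ae ?_
  filter_upwards [ae_pos_pathMeasure] with s hs
  rw [ENNReal.toReal_ofReal (hp0 s hs)]

lemma integrable_pathLaw_iff {E : Type*} [NormedAddCommGroup E] [NormedSpace ℝ E]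
    (hp0 : ∀ s, 0 < s → 0 ≤ p s) (hpm : AEMeasurable p pathMeasure) (F : ℝ → E) :
    Integrable F (pathLaw p) ↔ Integrable (fun s => p s • F s) pathMeasure := by
  rw [pathLaw, integrable_withDensity_iff_integrable_smul₀' hpm.ennreal_ofReal
    (ae_of_all _ fun _ => ENNReal.ofReal_lt_top)]
  refine integrable_congr ?_
  filter_upwards [ae_pos_pathMeasure] with s hs
  rw [ENNReal.toReal_ofReal (hp0 s hs)]

variable {α d₀ : ℝ}

/-- For `s > 1` the integrand of the mean is `d₀ s^{-α}`, which is integrable at infinity only if `α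
> 1`. -/
lemma one_lt_of_mean (hd₀ : 0 < d₀) (hp_tail : ∀ s : ℝ, 1 < s → p s = d₀ / s ^ (α + 1))
    (hp_mean : Integrable (fun s => s * p s) pathMeasure) : 1 < α := by
  have h1 : IntegrableOn (fun s => s * p s) (Ioi 1) :=
    IntegrableOn.mono_set hp_mean (Ioi_subset_Ioi zero_le_one)
  have h2 : IntegrableOn (fun s : ℝ => s ^ (-α)) (Ioi 1) := by
    refine IntegrableOn.congr_fun (Integrable.const_mul h1 d₀⁻¹) (fun s hs => ?_) measurableSet_Ioi
    have hs : (1:ℝ) < s := hs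
    have hs0 : 0 < s := by linarith
    simp only [hp_tail s hs, Real.rpow_neg hs0.le, Real.rpow_add_one hs0.ne']
    have := (Real.rpow_pos_of_pos hs0 α).ne'
    field_simp
  rw [integrableOn_Ioi_rpow_iff one_pos] at h2
  linarith

lemma integrable_sq_mul (hα : 2 < α) (hp_tail : ∀ s : ℝ, 1 < s → p s = d₀ / s ^ (α + 1))
    (hp : Integrable p pathMeasure) : Integrable (fun s => p s * s ^ 2) pathMeasure := by
  have h1 : IntegrableOn (fun s => p s * s ^ 2) (Ioc 0 1) := by
    have : IntegrableOn p (Ioc 0 1) := IntegrableOn.mono_set hp Ioc_subset_Ioi_self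
    refine this.mul_bdd (c := 1) (by fun_prop) ?_
    filter_upwards [ae_restrict_mem measurableSet_Ioc] with s hs
    rw [Real.norm_eq_abs, abs_of_nonneg (sq_nonneg s)]
    exact pow_le_one₀ hs.1.le hs.2
  have h2 : IntegrableOn (fun s => p s * s ^ 2) (Ioi 1) := by
    have : IntegrableOn (fun s : ℝ => s ^ (1 - α)) (Ioi 1) := by
      rw [integrableOn_Ioi_rpow_iff one_pos]; linarith
    refine IntegrableOn.congr_fun (Integrable.const_mul this d₀) (fun s hs => ?_) measurableSet_Ioi
    have hs : (1:ℝ) < s := hs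
    have hs0 : 0 < s := by linarith
    simp only [hp_tail s hs, Real.rpow_sub hs0, Real.rpow_add_one hs0.ne', Real.rpow_one]
    have := (Real.rpow_pos_of_pos hs0 α).ne'
    field_simp
  have := h1.union h2
  rwa [Ioc_union_Ioi_eq_Ioi zero_le_one] at this

/-- As `p` has total mass one, survival is the tail mass `∫_s^∞ p`, equal to `(d₀/α) s^{-α}` for `s
> 1`; on `(0,1]` it is at most one. -/
lemma integrable_survival (hSigt_nonneg : ∀ s : ℝ, 0 < s → 0 ≤ Sigt s)
    (hSigt_int : ∀ s : ℝ, 0 < s → IntervalIntegrable Sigt volume 0 s)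
    (hp_one : ∫ s, pathDensity Sigt s ∂pathMeasure = 1) (hα : 1 < α)
    (hp_tail : ∀ s : ℝ, 1 < s → pathDensity Sigt s = d₀ / s ^ (α + 1)) :
    Integrable (survival Sigt) pathMeasure := by
  have hp := integrable_pathDensity hp_one
  have h1 : IntegrableOn (survival Sigt) (Ioc 0 1) := by
    have hm : AEStronglyMeasurable (survival Sigt) (volume.restrict (Ioc 0 1)) :=
      (aestronglyMeasurable_survival hSigt_int).mono_measure
        (Measure.restrict_mono Ioc_subset_Ioi_self le_rfl)
    refine Integrable.of_bound (C := 1) hm ?_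
    filter_upwards [ae_restrict_mem measurableSet_Ioc] with s hs
    rw [Real.norm_eq_abs, abs_of_pos (survival_pos s)]
    exact survival_le_one hSigt_nonneg hs.1
  have h2 : IntegrableOn (survival Sigt) (Ioi 1) := by
    have : IntegrableOn (fun s : ℝ => s ^ (-α)) (Ioi 1) := by
      rw [integrableOn_Ioi_rpow_iff one_pos]; linarith
    refine IntegrableOn.congr_fun (Integrable.const_mul this (d₀ / α)) (fun s hs => ?_) measurableSet_Ioi
    have hs : (1:ℝ) < s := hs
    have hs0 : 0 < s := by linarith
    have h3 : (∫ τ in (0 : ℝ)..s, pathDensity Sigt τ) + ∫ τ in Ioi s, pathDensity Sigt τ = 1 := by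
      rw [← hp_one, intervalIntegral.integral_of_le hs0.le, pathMeasure,
        ← Ioc_union_Ioi_eq_Ioi hs0.le, setIntegral_union (Ioc_disjoint_Ioi le_rfl)
          measurableSet_Ioi (IntegrableOn.mono_set hp Ioc_subset_Ioi_self)
          (IntegrableOn.mono_set hp (Ioi_subset_Ioi hs0.le))]
    have h4 : ∫ τ in Ioi s, pathDensity Sigt τ = ∫ τ in Ioi s, d₀ * τ ^ (-α - 1) := by
      refine setIntegral_congr_fun measurableSet_Ioi fun τ hτ => ?_
      have hτ1 : 1 < τ := hs.trans hτ
      rw [hp_tail τ hτ1, ← neg_add', Real.rpow_neg (by linarith)]; rfl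
    rw [integral_const_mul, integral_Ioi_rpow_of_lt (by linarith) hs0] at h4
    have h5 := survival_eq_one_sub hSigt_int hs0
    have h6 : survival Sigt s = ∫ τ in Ioi s, pathDensity Sigt τ := by linarith
    have h7 : -α - 1 + 1 = -α := by ring
    simp only [h6, h4, h7]
    rw [neg_div_neg_eq]; ring
  have := h1.union h2
  rwa [Ioc_union_Ioi_eq_Ioi zero_le_one] at this

lemma betaZero_pos (hs : Integrable (survival Sigt) pathMeasure) : 0 < betaZero Sigt := by
  rw [betaZero, integral_pos_iff_support_of_nonneg (fun s => (survival_pos s).le) hs]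
  have : Function.support (survival Sigt) = univ := by
    ext s; simp [(survival_pos (Sigt := Sigt) s).ne']
  rw [this]
  simp [pathMeasure]

end PathLaw

end NonclassicalTransport

namespace NonclassicalTransport

/-! ### Small-frequency behaviour of `∫ (1 - cos)` against the path law, in the three tail regimes.
-/

section TailScaling

lemma one_sub_cos_nonneg (x : ℝ) : 0 ≤ 1 - Real.cos x := sub_nonneg.2 (Real.cos_le_one x)

lemma one_sub_cos_le (x : ℝ) : 1 - Real.cos x ≤ x ^ 2 / 2 := by
  linarith [Real.one_sub_sq_div_two_le_cos (x := x)]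

/-- A Taylor bound valid on the whole line: beyond `|x| = 1` the difference lies between `-x²/2` and
`0`, and `x² ≤ x⁴`. -/
lemma abs_one_sub_cos_sub_le (x : ℝ) : |1 - Real.cos x - x ^ 2 / 2| ≤ x ^ 4 / 2 := by
  rcases le_total |x| 1 with h | h
  · have h1 := Real.cos_bound h
    have h2 : |1 - Real.cos x - x ^ 2 / 2| = |Real.cos x - (1 - x ^ 2 / 2)| := by
      rw [← abs_neg]; congr 1; ring
    have h3 : |x| ^ 4 = x ^ 4 := by rw [← abs_pow, abs_of_nonneg (by positivity)]
    rw [h2, ← h3]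
    have : 0 ≤ |x| ^ 4 := by positivity
    linarith
  · have h1 : 1 ≤ x ^ 2 := by rw [← sq_abs]; nlinarith
    rw [abs_le]
    constructor <;> nlinarith [one_sub_cos_nonneg x, one_sub_cos_le x]

/-- `∫ (1 - cos (τ w)) P(dτ)`, the real part of `1 - charFun P w`. -/
noncomputable def defect (P : Measure ℝ) (w : ℝ) : ℝ := ∫ τ, (1 - Real.cos (τ * w)) ∂P

lemma integrable_one_sub_cos (P : Measure ℝ) [IsFiniteMeasure P] (w : ℝ) :
    Integrable (fun τ => 1 - Real.cos (τ * w)) P := by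
  refine Integrable.of_bound (C := 2) (by fun_prop) (ae_of_all _ fun τ => ?_)
  rw [Real.norm_eq_abs, abs_of_nonneg (one_sub_cos_nonneg _)]
  linarith [Real.neg_one_le_cos (τ * w)]

lemma defect_nonneg (P : Measure ℝ) (w : ℝ) : 0 ≤ defect P w :=
  integral_nonneg fun _ => one_sub_cos_nonneg _

/-- The defect at frequency `ε w` is of size `θ(ε)`, with limit profile `ℓ |w|^a`. -/
structure TailScaling (P : Measure ℝ) (a ℓ : ℝ) (θ : ℝ → ℝ) : Prop where
  tendsto : ∀ w : ℝ, Tendsto (fun ε => defect P (ε * w) / θ ε) (𝓝[>] 0) (𝓝 (ℓ * |w| ^ a))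
  bound : ∃ C : ℝ, ∀ᶠ ε in 𝓝[>] (0 : ℝ), ∀ w : ℝ, defect P (ε * w) ≤ C * θ ε * (1 + w ^ 2)

lemma eventually_pos_small {r : ℝ} (hr : 0 < r) : ∀ᶠ ε in 𝓝[>] (0 : ℝ), 0 < ε ∧ ε < r :=
  Ioo_mem_nhdsGT hr

/-- With a finite second moment, `(1 - cos(ετw))/ε²` is dominated by `τ²w²/2`, which is also its
pointwise limit. -/
lemma tailScaling_of_sq (P : Measure ℝ) [IsProbabilityMeasure P]
    (h2 : Integrable (fun τ => τ ^ 2) P) :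
    TailScaling P 2 ((∫ τ, τ ^ 2 ∂P) / 2) (fun ε => ε ^ 2) := by
  constructor
  · intro w
    have h3 : (∫ τ, τ ^ 2 ∂P) / 2 * |w| ^ (2 : ℝ) = ∫ τ, (τ * w) ^ 2 / 2 ∂P := by
      rw [Real.rpow_two, sq_abs]
      simp_rw [mul_pow, mul_div_assoc]
      rw [integral_mul_const]; ring
    rw [h3]
    have h4 : (fun ε => defect P (ε * w) / ε ^ 2)
        = fun ε => ∫ τ, (1 - Real.cos (τ * (ε * w))) / ε ^ 2 ∂P := by
      funext ε; rw [defect, integral_div]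
    rw [h4]
    refine tendsto_integral_filter_of_dominated_convergence (fun τ => τ ^ 2 * (w ^ 2 / 2))
      (Eventually.of_forall fun ε => by fun_prop) ?_ (h2.mul_const _) (ae_of_all _ fun τ => ?_)
    · filter_upwards [self_mem_nhdsWithin] with ε hε
      have hε : 0 < ε := hε
      refine ae_of_all _ fun τ => ?_
      rw [Real.norm_eq_abs, abs_of_nonneg (div_nonneg (one_sub_cos_nonneg _) (sq_nonneg _)),
        div_le_iff₀ (by positivity)]
      refine (one_sub_cos_le _).trans (le_of_eq (by ring))
    · have h5 : Tendsto (fun ε : ℝ => ε ^ 2 * (τ * w) ^ 4 / 2) (𝓝[>] 0) (𝓝 0) := by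
        have : Tendsto (fun ε : ℝ => ε ^ 2 * (τ * w) ^ 4 / 2) (𝓝 0)
            (𝓝 (0 ^ 2 * (τ * w) ^ 4 / 2)) := by
          apply Continuous.tendsto; fun_prop
        simpa using this.mono_left nhdsWithin_le_nhds
      rw [tendsto_iff_norm_sub_tendsto_zero]
      refine squeeze_zero' (Eventually.of_forall fun _ => norm_nonneg _) ?_ h5
      filter_upwards [self_mem_nhdsWithin] with ε hε
      have hε : 0 < ε := hε
      have h6 := abs_one_sub_cos_sub_le (τ * (ε * w))
      have h7 : (1 - Real.cos (τ * (ε * w))) / ε ^ 2 - (τ * w) ^ 2 / 2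
          = (1 - Real.cos (τ * (ε * w)) - (τ * (ε * w)) ^ 2 / 2) / ε ^ 2 := by
        field_simp
      rw [h7, norm_div, Real.norm_eq_abs, Real.norm_eq_abs, abs_of_pos (by positivity : 0 < ε ^ 2),
        div_le_iff₀ (by positivity)]
      exact h6.trans (le_of_eq (by ring))
  · refine ⟨(∫ τ, τ ^ 2 ∂P) / 2, Eventually.of_forall fun ε w => ?_⟩
    have h3 : defect P (ε * w) ≤ ∫ τ, τ ^ 2 * ((ε * w) ^ 2 / 2) ∂P := by
      refine integral_mono (integrable_one_sub_cos P _) (h2.mul_const _) fun τ => ?_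
      exact (one_sub_cos_le _).trans (le_of_eq (by ring))
    rw [integral_mul_const] at h3
    have h4 : 0 ≤ (∫ τ, τ ^ 2 ∂P) := integral_nonneg fun _ => sq_nonneg _
    have h5 : 0 ≤ (∫ τ, τ ^ 2 ∂P) * ε ^ 2 := by positivity
    nlinarith

/-- The profile `s^{-α-1} (1 - cos (s w))`. -/
noncomputable def tailProfile (α w s : ℝ) : ℝ := s ^ (-α - 1) * (1 - Real.cos (s * w))

lemma tailProfile_nonneg (α w : ℝ) {s : ℝ} (hs : 0 < s) : 0 ≤ tailProfile α w s :=
  mul_nonneg (Real.rpow_nonneg hs.le _) (one_sub_cos_nonneg _)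

lemma continuousOn_tailProfile (α w : ℝ) : ContinuousOn (tailProfile α w) (Ioi 0) := by
  refine ContinuousOn.mul (fun s hs => ?_) (by fun_prop)
  exact (Real.continuousAt_rpow_const _ _ (Or.inl (ne_of_gt hs))).continuousWithinAt

lemma integrableOn_tailProfile_one {α : ℝ} (hα : 1 < α) (w : ℝ) :
    IntegrableOn (tailProfile α w) (Ioi 1) := by
  have h : IntegrableOn (fun s : ℝ => s ^ (-α - 1)) (Ioi 1) := by
    rw [integrableOn_Ioi_rpow_iff one_pos]; linarith
  refine h.mul_bdd (c := 2) (by fun_prop) (ae_of_all _ fun s => ?_)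
  rw [Real.norm_eq_abs, abs_of_nonneg (one_sub_cos_nonneg _)]
  linarith [Real.neg_one_le_cos (s * w)]

lemma tailProfile_le {α : ℝ} (w : ℝ) {s : ℝ} (hs : 0 < s) :
    tailProfile α w s ≤ s ^ (1 - α) * (w ^ 2 / 2) := by
  have h1 : s ^ (1 - α) = s ^ (-α - 1) * s ^ 2 := by
    rw [← Real.rpow_two, ← Real.rpow_add hs]; congr 1; ring
  rw [tailProfile, h1, mul_assoc]
  refine mul_le_mul_of_nonneg_left ?_ (Real.rpow_nonneg hs.le _)
  exact (one_sub_cos_le _).trans (le_of_eq (by ring))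

lemma integrableOn_tailProfile {α : ℝ} (hα : 1 < α) (hα2 : α < 2) (w : ℝ) :
    IntegrableOn (tailProfile α w) (Ioi 0) := by
  rw [← Ioc_union_Ioi_eq_Ioi zero_le_one]
  refine IntegrableOn.union ?_ (integrableOn_tailProfile_one hα w)
  have h : IntegrableOn (fun s : ℝ => s ^ (1 - α) * (w ^ 2 / 2)) (Ioc 0 1) := by
    have := (intervalIntegral.intervalIntegrable_rpow' (a := 0) (b := 1) (r := 1 - α)
      (by linarith)).mul_const (w ^ 2 / 2)
    rwa [intervalIntegrable_iff, uIoc_of_le zero_le_one] at this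
  refine Integrable.mono' h (((continuousOn_tailProfile α w).mono
    Ioc_subset_Ioi_self).aestronglyMeasurable measurableSet_Ioc) ?_
  filter_upwards [ae_restrict_mem measurableSet_Ioc] with s hs
  rw [Real.norm_eq_abs, abs_of_nonneg (tailProfile_nonneg α w hs.1)]
  exact tailProfile_le w hs.1

/-- The substitution `s ↦ |w|s`: the self-similarity of the power tail is what creates the symbol
`|ξ|^α`. -/
lemma integral_tailProfile_scale (α w : ℝ) (hα : α ≠ 0) :
    ∫ s in Ioi 0, tailProfile α w s = |w| ^ α * ∫ s in Ioi 0, tailProfile α 1 s := by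
  rcases eq_or_ne w 0 with rfl | h
  · simp [tailProfile, Real.zero_rpow hα]
  have hw : 0 < |w| := abs_pos.2 h
  have h1 := integral_comp_mul_left_Ioi (tailProfile α 1) 0 hw
  rw [mul_zero] at h1
  have h2 : ∫ s in Ioi 0, tailProfile α 1 (|w| * s)
      = |w| ^ (-α - 1) * ∫ s in Ioi 0, tailProfile α w s := by
    rw [← integral_const_mul]
    refine setIntegral_congr_fun measurableSet_Ioi fun s hs => ?_
    have hs : 0 < s := hs
    simp only [tailProfile]
    rw [Real.mul_rpow hw.le hs.le, mul_one]
    have : Real.cos (|w| * s) = Real.cos (s * w) := by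
      rw [← Real.cos_abs (s * w), abs_mul, abs_of_pos hs, mul_comm]
    rw [this]; ring
  rw [h2, smul_eq_mul, Real.rpow_sub_one hw.ne', Real.rpow_neg hw.le] at h1
  have h3 := Real.rpow_pos_of_pos hw α
  field_simp at h1
  linarith

variable {p : ℝ → ℝ} {α d₀ : ℝ}

/-- On `τ > 1` the density is an exact power, so `s = ετ` turns the tail contribution into `d₀ε^α`
times the profile truncated at `s > ε`. The regime for `α ≤ 2` is then decided by the profile near
`s = 0`. -/
lemma defect_pathLaw (hp0 : ∀ s, 0 < s → 0 ≤ p s) (hp : Integrable p pathMeasure)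
    (hp_tail : ∀ s : ℝ, 1 < s → p s = d₀ / s ^ (α + 1)) {ε : ℝ} (hε : 0 < ε) (w : ℝ) :
    defect (pathLaw p) (ε * w) = (∫ τ in Ioc 0 1, p τ * (1 - Real.cos (τ * (ε * w))))
      + d₀ * ε ^ α * ∫ s in Ioi ε, tailProfile α w s := by
  have hI : Integrable (fun τ => p τ * (1 - Real.cos (τ * (ε * w)))) pathMeasure := by
    refine hp.mul_bdd (c := 2) (by fun_prop) (ae_of_all _ fun s => ?_)
    rw [Real.norm_eq_abs, abs_of_nonneg (one_sub_cos_nonneg _)]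
    linarith [Real.neg_one_le_cos (s * (ε * w))]
  rw [defect, integral_pathLaw hp0 hp.aemeasurable]
  simp only [smul_eq_mul]
  rw [pathMeasure, ← Ioc_union_Ioi_eq_Ioi zero_le_one, setIntegral_union (Ioc_disjoint_Ioi le_rfl)
    measurableSet_Ioi (IntegrableOn.mono_set hI Ioc_subset_Ioi_self)
    (IntegrableOn.mono_set hI (Ioi_subset_Ioi zero_le_one))]
  congr 1
  have h1 := integral_comp_mul_left_Ioi (tailProfile α w) 1 hε
  rw [mul_one] at h1
  have h2 : ∫ τ in Ioi 1, p τ * (1 - Real.cos (τ * (ε * w)))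
      = d₀ * ε ^ (α + 1) * ∫ τ in Ioi 1, tailProfile α w (ε * τ) := by
    rw [← integral_const_mul]
    refine setIntegral_congr_fun measurableSet_Ioi fun s hs => ?_
    have hs : 1 < s := hs
    have hs0 : 0 < s := by linarith
    simp only [tailProfile]
    rw [hp_tail s hs, ← neg_add', Real.rpow_neg (by positivity), Real.mul_rpow hε.le hs0.le]
    have h3 := Real.rpow_pos_of_pos hε (α + 1)
    have h4 := Real.rpow_pos_of_pos hs0 (α + 1)
    have h5 : s * (ε * w) = ε * s * w := by ring
    rw [h5]
    field_simp
  rw [h2, h1, smul_eq_mul, Real.rpow_add_one hε.ne']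
  field_simp

/-- Path lengths below one contribute `O(ε²)`, which is negligible against `θ(ε)` when `α ≤ 2`. -/
lemma integral_head_le (hp0 : ∀ s, 0 < s → 0 ≤ p s) (hp_one : ∫ s, p s ∂pathMeasure = 1)
    (hp : Integrable p pathMeasure) (ε w : ℝ) :
    0 ≤ ∫ τ in Ioc 0 1, p τ * (1 - Real.cos (τ * (ε * w))) ∧
    ∫ τ in Ioc 0 1, p τ * (1 - Real.cos (τ * (ε * w))) ≤ ε ^ 2 * w ^ 2 := by
  have hpI : IntegrableOn p (Ioc 0 1) := IntegrableOn.mono_set hp Ioc_subset_Ioi_self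
  have hle : ∫ τ in Ioc 0 1, p τ ≤ 1 := by
    rw [← hp_one]
    exact setIntegral_mono_set hp (ae_pos_pathMeasure.mono hp0)
      (Eventually.of_forall Ioc_subset_Ioi_self)
  constructor
  · exact setIntegral_nonneg measurableSet_Ioc fun s hs =>
      mul_nonneg (hp0 s hs.1) (one_sub_cos_nonneg _)
  · calc ∫ τ in Ioc 0 1, p τ * (1 - Real.cos (τ * (ε * w)))
        ≤ ∫ τ in Ioc 0 1, p τ * (ε ^ 2 * w ^ 2) := by
          refine setIntegral_mono_on ?_ (hpI.mul_const _) measurableSet_Ioc fun s hs => ?_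
          · refine hpI.mul_bdd (c := 2) (by fun_prop) (ae_of_all _ fun s => ?_)
            rw [Real.norm_eq_abs, abs_of_nonneg (one_sub_cos_nonneg _)]
            linarith [Real.neg_one_le_cos (s * (ε * w))]
          · refine mul_le_mul_of_nonneg_left ?_ (hp0 s hs.1)
            refine (one_sub_cos_le _).trans ?_
            have h1 : s ^ 2 ≤ 1 := pow_le_one₀ hs.1.le hs.2
            have h2 : 0 ≤ (ε * w) ^ 2 := sq_nonneg _
            nlinarith
      _ = (∫ τ in Ioc 0 1, p τ) * (ε ^ 2 * w ^ 2) := integral_mul_const _ _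
      _ ≤ 1 * (ε ^ 2 * w ^ 2) := by gcongr
      _ = _ := one_mul _

/-- For `α < 2` the profile behaves like `s^{1-α}` at zero and is integrable, so the truncation at
`ε` can simply be removed in the limit. -/
lemma tailScaling_of_lt_two (hp0 : ∀ s, 0 < s → 0 ≤ p s) (hp_one : ∫ s, p s ∂pathMeasure = 1)
    (hp : Integrable p pathMeasure) (hα : 1 < α) (hα2 : α < 2) (hd₀ : 0 < d₀)
    (hp_tail : ∀ s : ℝ, 1 < s → p s = d₀ / s ^ (α + 1)) :
    TailScaling (pathLaw p) α (d₀ * ∫ s in Ioi 0, tailProfile α 1 s) (fun ε => ε ^ α) := by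
  constructor
  · intro w
    have h1 : Tendsto (fun ε : ℝ => ∫ s in Ioi ε, tailProfile α w s) (𝓝[>] 0)
        (𝓝 (∫ s in Ioi 0, tailProfile α w s)) := by
      have hc : AECover (volume.restrict (Ioi (0:ℝ))) (𝓝[>] (0:ℝ)) (fun ε => Ioi ε) :=
        aecover_Ioi_of_Ioi (a := fun ε : ℝ => ε) (A := 0) nhdsWithin_le_nhds
      refine (hc.integral_tendsto_of_countably_generated
        (integrableOn_tailProfile hα hα2 w)).congr' ?_
      filter_upwards [self_mem_nhdsWithin] with ε hε
      rw [Measure.restrict_restrict measurableSet_Ioi, inter_eq_left.2 (Ioi_subset_Ioi (le_of_lt hε))]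
    rw [integral_tailProfile_scale α w (by linarith)] at h1
    have h2 : Tendsto (fun ε : ℝ => (∫ τ in Ioc 0 1, p τ * (1 - Real.cos (τ * (ε * w)))) / ε ^ α)
        (𝓝[>] 0) (𝓝 0) := by
      have h3 : Tendsto (fun ε : ℝ => ε ^ (2 - α) * w ^ 2) (𝓝[>] 0) (𝓝 0) := by
        have : Tendsto (fun ε : ℝ => ε ^ (2 - α) * w ^ 2) (𝓝 0) (𝓝 (0 ^ (2 - α) * w ^ 2)) :=
          ((Real.continuousAt_rpow_const 0 (2 - α) (Or.inr (by linarith))).mul_const _).tendsto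
        rw [Real.zero_rpow (by linarith), zero_mul] at this
        exact this.mono_left nhdsWithin_le_nhds
      refine squeeze_zero' ?_ ?_ h3
      · filter_upwards [self_mem_nhdsWithin] with ε hε
        exact div_nonneg (integral_head_le hp0 hp_one hp ε w).1 (Real.rpow_nonneg (le_of_lt hε) _)
      · filter_upwards [self_mem_nhdsWithin] with ε hε
        have hε : 0 < ε := hε
        rw [div_le_iff₀ (Real.rpow_pos_of_pos hε _)]
        refine (integral_head_le hp0 hp_one hp ε w).2.trans (le_of_eq ?_)
        rw [mul_right_comm, ← Real.rpow_add hε, sub_add_cancel, Real.rpow_two]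
    have h4 := h2.add (h1.const_mul d₀)
    rw [zero_add] at h4
    have h5 : d₀ * (∫ s in Ioi 0, tailProfile α 1 s) * |w| ^ α
        = d₀ * (|w| ^ α * ∫ s in Ioi 0, tailProfile α 1 s) := by ring
    rw [h5]
    refine h4.congr' ?_
    filter_upwards [self_mem_nhdsWithin] with ε hε
    have hε : 0 < ε := hε
    have h6 := Real.rpow_pos_of_pos hε α
    rw [defect_pathLaw hp0 hp hp_tail hε]
    have h7 : ∀ A B : ℝ, A / ε ^ α + d₀ * B = (A + d₀ * ε ^ α * B) / ε ^ α := by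
      intros; field_simp
    exact h7 _ _
  · refine ⟨1 + d₀ * ∫ s in Ioi 0, tailProfile α 1 s, ?_⟩
    filter_upwards [eventually_pos_small one_pos] with ε hε w
    obtain ⟨hε, hε1⟩ := hε
    rw [defect_pathLaw hp0 hp hp_tail hε]
    have h1 : ∫ s in Ioi ε, tailProfile α w s ≤ |w| ^ α * ∫ s in Ioi 0, tailProfile α 1 s := by
      rw [← integral_tailProfile_scale α w (by linarith)]
      refine setIntegral_mono_set (integrableOn_tailProfile hα hα2 w) ?_
        (Eventually.of_forall (Ioi_subset_Ioi hε.le))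
      filter_upwards [ae_restrict_mem measurableSet_Ioi] with s hs
      exact tailProfile_nonneg α w hs
    have hJ : 0 ≤ ∫ s in Ioi 0, tailProfile α 1 s :=
      setIntegral_nonneg measurableSet_Ioi fun s hs => tailProfile_nonneg α 1 hs
    have h2 : |w| ^ α ≤ 1 + w ^ 2 := by
      rcases le_total |w| 1 with h | h
      · have := Real.rpow_le_one (abs_nonneg w) h (by linarith : 0 ≤ α)
        nlinarith [sq_nonneg w]
      · have := Real.rpow_le_rpow_of_exponent_le h hα2.le
        rw [Real.rpow_two, sq_abs] at this
        linarith
    have h3 : ε ^ 2 ≤ ε ^ α := by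
      rw [← Real.rpow_two]
      exact Real.rpow_le_rpow_of_exponent_ge hε hε1.le hα2.le
    have h4 := (integral_head_le hp0 hp_one hp ε w).2
    have h5 : 0 < ε ^ α := Real.rpow_pos_of_pos hε α
    have h6 : d₀ * ε ^ α * ∫ s in Ioi ε, tailProfile α w s
        ≤ d₀ * ε ^ α * ((1 + w ^ 2) * ∫ s in Ioi 0, tailProfile α 1 s) := by
      refine mul_le_mul_of_nonneg_left (h1.trans ?_) (by positivity)
      exact mul_le_mul_of_nonneg_right h2 hJ
    have h7 : ε ^ 2 * w ^ 2 ≤ ε ^ α * (1 + w ^ 2) := by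
      refine mul_le_mul h3 (by linarith) (sq_nonneg _) h5.le
    nlinarith

/-- At `α = 2` the profile is `w²/(2s)` near zero, which gives the logarithm; the quartic Taylor
error on `(ε,1]` and the part beyond `1` stay bounded. The two-sided estimate serves the pointwise
limit. The one-sided one grows only quadratically in `w`, as the uniform bound requires. -/
lemma integral_tailProfile_two (w : ℝ) {ε : ℝ} (hε : 0 < ε) (hε1 : ε < 1) :
    |(∫ s in Ioi ε, tailProfile 2 w s) - w ^ 2 / 2 * (-Real.log ε)| ≤ w ^ 4 / 2 + 1 ∧
    ∫ s in Ioi ε, tailProfile 2 w s ≤ w ^ 2 / 2 * (-Real.log ε) + 1 := by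
  have hI1 := integrableOn_tailProfile_one one_lt_two w
  have hc : ContinuousOn (tailProfile 2 w) (Icc ε 1) :=
    (continuousOn_tailProfile 2 w).mono fun s hs => lt_of_lt_of_le hε hs.1
  have hI2 : IntegrableOn (tailProfile 2 w) (Ioc ε 1) :=
    (hc.integrableOn_compact isCompact_Icc).mono_set Ioc_subset_Icc_self
  have hsplit : ∫ s in Ioi ε, tailProfile 2 w s
      = (∫ s in Ioc ε 1, tailProfile 2 w s) + ∫ s in Ioi 1, tailProfile 2 w s := by
    rw [← Ioc_union_Ioi_eq_Ioi hε1.le, setIntegral_union (Ioc_disjoint_Ioi le_rfl)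
      measurableSet_Ioi hI2 hI1]
  have hlog : ∫ s in Ioc ε 1, w ^ 2 / 2 * s⁻¹ = w ^ 2 / 2 * (-Real.log ε) := by
    rw [integral_const_mul, ← intervalIntegral.integral_of_le hε1.le,
      integral_inv_of_pos hε one_pos, one_div, Real.log_inv]
  have hIinv : IntegrableOn (fun s : ℝ => w ^ 2 / 2 * s⁻¹) (Ioc ε 1) := by
    have : ContinuousOn (fun s : ℝ => w ^ 2 / 2 * s⁻¹) (Icc ε 1) :=
      continuousOn_const.mul (continuousOn_inv₀.mono fun s hs => (lt_of_lt_of_le hε hs.1).ne')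
    exact (this.integrableOn_compact isCompact_Icc).mono_set Ioc_subset_Icc_self
  have htail : 0 ≤ ∫ s in Ioi 1, tailProfile 2 w s ∧ ∫ s in Ioi 1, tailProfile 2 w s ≤ 1 := by
    constructor
    · exact setIntegral_nonneg measurableSet_Ioi fun s hs =>
        tailProfile_nonneg _ _ (lt_trans one_pos hs)
    · have h3 : ∫ s in Ioi (1:ℝ), s ^ (-2 - 1 : ℝ) * 2 = 1 := by
        rw [integral_mul_const, integral_Ioi_rpow_of_lt (by norm_num) one_pos]
        norm_num
      refine le_trans ?_ h3.le
      refine setIntegral_mono_on hI1 (Integrable.mul_const ?_ _) measurableSet_Ioi fun s hs => ?_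
      · exact (integrableOn_Ioi_rpow_iff one_pos).2 (by norm_num)
      · refine mul_le_mul_of_nonneg_left ?_ (Real.rpow_nonneg (lt_trans one_pos hs).le _)
        linarith [Real.neg_one_le_cos (s * w)]
  have hpow : ∀ s : ℝ, 0 < s → s ^ (-2 - 1 : ℝ) = (s ^ 3)⁻¹ := by
    intro s hs
    rw [← neg_add', Real.rpow_neg hs.le, show (2 + 1 : ℝ) = ((3 : ℕ) : ℝ) by norm_num,
      Real.rpow_natCast]
  have hhead : |(∫ s in Ioc ε 1, tailProfile 2 w s) - w ^ 2 / 2 * (-Real.log ε)| ≤ w ^ 4 / 2 := by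
    rw [← hlog, ← integral_sub hI2 hIinv, ← Real.norm_eq_abs]
    have := norm_setIntegral_le_of_norm_le_const (μ := volume) (s := Ioc ε 1) (C := w ^ 4 / 2)
      (f := fun s => tailProfile 2 w s - w ^ 2 / 2 * s⁻¹) (by simp) (fun s hs => ?_)
    · refine this.trans ?_
      rw [Real.volume_real_Ioc_of_le hε1.le]
      have : 0 ≤ w ^ 4 := by positivity
      nlinarith
    · have hs0 : 0 < s := hε.trans hs.1
      have h4 : tailProfile 2 w s - w ^ 2 / 2 * s⁻¹
          = (s ^ 3)⁻¹ * (1 - Real.cos (s * w) - (s * w) ^ 2 / 2) := by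
        rw [tailProfile, hpow s hs0]; field_simp
      rw [h4, norm_mul, Real.norm_eq_abs, Real.norm_eq_abs, abs_of_pos (by positivity)]
      have h5 := abs_one_sub_cos_sub_le (s * w)
      rw [inv_mul_le_iff₀ (by positivity)]
      refine h5.trans ?_
      rw [mul_pow, mul_div_assoc]
      refine mul_le_mul_of_nonneg_right ?_ (by positivity)
      exact pow_le_pow_of_le_one hs0.le hs.2 (by norm_num)
  have hhead2 : ∫ s in Ioc ε 1, tailProfile 2 w s ≤ w ^ 2 / 2 * (-Real.log ε) := by
    rw [← hlog]
    refine setIntegral_mono_on hI2 hIinv measurableSet_Ioc fun s hs => ?_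
    have hs0 : 0 < s := hε.trans hs.1
    refine (tailProfile_le w hs0).trans (le_of_eq ?_)
    rw [show (1 - 2 : ℝ) = -1 by norm_num, Real.rpow_neg_one, mul_comm]
  rw [hsplit]
  constructor
  · rw [abs_le] at hhead ⊢
    constructor <;> linarith [htail.1, htail.2]
  · linarith [htail.2]

lemma tailScaling_two (hp0 : ∀ s, 0 < s → 0 ≤ p s) (hp_one : ∫ s, p s ∂pathMeasure = 1)
    (hp : Integrable p pathMeasure) (hd₀ : 0 < d₀)
    (hp_tail : ∀ s : ℝ, 1 < s → p s = d₀ / s ^ ((2 : ℝ) + 1)) :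
    TailScaling (pathLaw p) 2 (d₀ / 2) (fun ε => -(ε ^ 2 * Real.log ε)) := by
  -- Below `e⁻¹` the factor `-log ε` exceeds one, so terms without the logarithm are absorbed by it.
  have hsmall : ∀ᶠ ε in 𝓝[>] (0 : ℝ), 0 < ε ∧ ε < 1 ∧ 1 < -Real.log ε := by
    filter_upwards [eventually_pos_small (Real.exp_pos (-1)), eventually_pos_small one_pos]
      with ε h1 h2
    refine ⟨h1.1, h2.2, ?_⟩
    have := (Real.log_lt_iff_lt_exp h1.1).2 h1.2
    linarith
  constructor
  · intro w
    have hL : Tendsto (fun ε : ℝ => ((w ^ 2 + d₀ * (w ^ 4 / 2 + 1))) * (-Real.log ε)⁻¹)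
        (𝓝[>] 0) (𝓝 0) := by
      have h1 : Tendsto (fun ε : ℝ => -Real.log ε) (𝓝[>] 0) atTop :=
        tendsto_neg_atBot_atTop.comp Real.tendsto_log_nhdsGT_zero
      simpa using h1.inv_tendsto_atTop.const_mul (w ^ 2 + d₀ * (w ^ 4 / 2 + 1))
    rw [tendsto_iff_norm_sub_tendsto_zero]
    refine squeeze_zero' (Eventually.of_forall fun _ => norm_nonneg _) ?_ hL
    filter_upwards [hsmall] with ε hε
    obtain ⟨hε, hε1, hl⟩ := hε
    rw [defect_pathLaw hp0 hp hp_tail hε, Real.rpow_two, Real.rpow_two, sq_abs]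
    obtain ⟨h1, -⟩ := integral_tailProfile_two w hε hε1
    obtain ⟨h2, h3⟩ := integral_head_le hp0 hp_one hp ε w
    set A := ∫ τ in Ioc 0 1, p τ * (1 - Real.cos (τ * (ε * w)))
    set B := ∫ s in Ioi ε, tailProfile 2 w s
    set l := -Real.log ε with hldef
    have hl0 : 0 < l := by linarith
    have h4 : -(ε ^ 2 * Real.log ε) = ε ^ 2 * l := by rw [hldef]; ring
    have h5 : (A + d₀ * ε ^ 2 * B) / (ε ^ 2 * l) - d₀ / 2 * w ^ 2
        = (A / ε ^ 2 + d₀ * (B - w ^ 2 / 2 * l)) * l⁻¹ := by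
      field_simp
      ring
    rw [h4, h5, norm_mul, Real.norm_eq_abs, Real.norm_eq_abs, abs_of_pos (inv_pos.2 hl0)]
    refine mul_le_mul_of_nonneg_right ((abs_add_le _ _).trans (add_le_add ?_ ?_))
      (inv_pos.2 hl0).le
    · rw [abs_of_nonneg (by positivity), div_le_iff₀ (by positivity)]
      linarith
    · rw [abs_mul, abs_of_pos hd₀]
      exact mul_le_mul_of_nonneg_left h1 hd₀.le
  · refine ⟨1 + d₀, ?_⟩
    filter_upwards [hsmall] with ε hε w
    obtain ⟨hε, hε1, hl⟩ := hε
    rw [defect_pathLaw hp0 hp hp_tail hε, Real.rpow_two]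
    obtain ⟨-, h1⟩ := integral_tailProfile_two w hε hε1
    obtain ⟨-, h3⟩ := integral_head_le hp0 hp_one hp ε w
    set A := ∫ τ in Ioc 0 1, p τ * (1 - Real.cos (τ * (ε * w)))
    set B := ∫ s in Ioi ε, tailProfile 2 w s
    set l := -Real.log ε with hldef
    have h4 : -(ε ^ 2 * Real.log ε) = ε ^ 2 * l := by rw [hldef]; ring
    rw [h4]
    have h6 : d₀ * ε ^ 2 * B ≤ d₀ * ε ^ 2 * (l * (1 + w ^ 2)) := by
      refine mul_le_mul_of_nonneg_left (h1.trans ?_) (by positivity)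
      nlinarith [sq_nonneg w]
    have h7 : ε ^ 2 * w ^ 2 ≤ ε ^ 2 * (l * (1 + w ^ 2)) := by
      refine mul_le_mul_of_nonneg_left ?_ (by positivity)
      nlinarith [sq_nonneg w]
    nlinarith

end TailScaling

end NonclassicalTransport

namespace NonclassicalTransport

variable {n : ℕ}

/-! ### Fourier symbols of the transposed transport operator and their limits. -/

section Symbol

open Complex (I)

lemma norm_exp_mul_I_sub_one_le (x : ℝ) : ‖Complex.exp (x * I) - 1‖ ≤ |x| := by
  rw [mul_comm]; exact Real.norm_exp_I_mul_ofReal_sub_one_le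

lemma norm_exp_mul_I_sub_one_sub_le (x : ℝ) : ‖Complex.exp (x * I) - 1 - x * I‖ ≤ 3 * x ^ 2 := by
  rcases le_total |x| 1 with h | h
  · have h1 : ‖(x * I : ℂ)‖ = |x| := by simp
    have h2 := Complex.norm_exp_sub_one_sub_id_le (x := x * I) (by rw [h1]; exact h)
    rw [h1, sq_abs] at h2
    nlinarith [sq_nonneg x]
  · have h1 : ‖(x * I : ℂ)‖ = |x| := by simp
    have h2 := (norm_sub_le (Complex.exp (x * I) - 1) (x * I)).trans
      (add_le_add (norm_exp_mul_I_sub_one_le x) h1.le)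
    have : |x| ≤ x ^ 2 := by rw [← sq_abs]; nlinarith
    nlinarith [sq_nonneg x]

variable (P : Measure ℝ) [IsProbabilityMeasure P]

lemma integrable_exp_mul_I (t : ℝ) : Integrable (fun x : ℝ => Complex.exp ((t * x : ℝ) * I)) P := by
  refine Integrable.of_bound (C := 1) (by fun_prop) (ae_of_all _ fun τ => ?_)
  rw [Complex.norm_exp_ofReal_mul_I]

omit [IsProbabilityMeasure P] in
lemma charFun_eq_integral (t : ℝ) :
    charFun P t = ∫ x : ℝ, Complex.exp ((t * x : ℝ) * I) ∂P := by
  rw [charFun_apply_real]; push_cast; rfl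

lemma norm_charFun_sub_one_le (h1 : Integrable (fun τ : ℝ => τ) P) (t : ℝ) :
    ‖charFun P t - 1‖ ≤ (∫ τ, |τ| ∂P) * |t| := by
  have h2 : charFun P t - 1 = ∫ x : ℝ, (Complex.exp ((t * x : ℝ) * I) - 1) ∂P := by
    rw [charFun_eq_integral, integral_sub (integrable_exp_mul_I P t) (integrable_const _)]
    simp
  rw [h2, ← integral_mul_const]
  refine norm_integral_le_of_norm_le (h1.abs.mul_const _) (ae_of_all _ fun x => ?_)
  refine (norm_exp_mul_I_sub_one_le _).trans (le_of_eq ?_)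
  rw [abs_mul, mul_comm]

lemma norm_charFun_sub_one_sub_le (h1 : Integrable (fun τ : ℝ => τ) P)
    (h2 : Integrable (fun τ : ℝ => τ ^ 2) P) (t : ℝ) :
    ‖charFun P t - 1 - ((∫ τ, τ ∂P : ℝ) : ℂ) * t * I‖ ≤ 3 * (∫ τ, τ ^ 2 ∂P) * t ^ 2 := by
  have h4 : Integrable (fun x : ℝ => ((t * x : ℝ) : ℂ) * I) P :=
    ((h1.const_mul t).ofReal).mul_const _
  have h3 : charFun P t - 1 - ((∫ τ, τ ∂P : ℝ) : ℂ) * t * I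
      = ∫ x : ℝ, (Complex.exp ((t * x : ℝ) * I) - 1 - ((t * x : ℝ) : ℂ) * I) ∂P := by
    have h5 : Integrable (fun x : ℝ => Complex.exp ((t * x : ℝ) * I) - 1) P :=
      (integrable_exp_mul_I P t).sub (integrable_const _)
    rw [integral_sub h5 h4, integral_sub (integrable_exp_mul_I P t) (integrable_const _), charFun_eq_integral,
      integral_mul_const, integral_complex_ofReal, integral_const_mul]
    simp
    ring
  rw [h3, mul_assoc, ← integral_mul_const, ← integral_const_mul]
  refine norm_integral_le_of_norm_le ((h2.mul_const _).const_mul _) (ae_of_all _ fun x => ?_)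
  exact (norm_exp_mul_I_sub_one_sub_le _).trans (le_of_eq (by ring))

lemma re_charFun (t : ℝ) : (charFun P t).re = 1 - defect P t := by
  rw [charFun_eq_integral, defect, integral_sub (integrable_const _)]
  · have := (integral_re (integrable_exp_mul_I P t)).symm
    simp only [RCLike.re_to_complex] at this
    rw [this]
    simp only [Complex.exp_ofReal_mul_I_re]
    simp [mul_comm]
  · refine Integrable.of_bound (C := 1) (by fun_prop) (ae_of_all _ fun τ => ?_)
    exact Real.abs_cos_le_one _

/-- The dual frequency seen along direction `v`. -/
noncomputable def freq (ε : ℝ) (v : Dir n) (ξ : Pos n) : ℝ :=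
  ε * (2 * Real.pi * inner ℝ (v : Pos n) ξ)

lemma continuous_freq (ε : ℝ) : Continuous (fun y : Dir n × Pos n => freq ε y.1 y.2) := by
  unfold freq; fun_prop

lemma continuous_freq_left (ε : ℝ) (ξ : Pos n) : Continuous (fun v : Dir n => freq ε v ξ) := by
  unfold freq; fun_prop

lemma abs_freq_le (ε : ℝ) (v : Dir n) (ξ : Pos n) : |freq ε v ξ| ≤ |ε| * (2 * Real.pi * ‖ξ‖) := by
  have h := abs_real_inner_le_norm (v : Pos n) ξ
  rw [norm_eq_of_mem_sphere, one_mul] at h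
  rw [freq, abs_mul, abs_mul, abs_of_pos Real.two_pi_pos]
  gcongr

lemma freq_neg (ε : ℝ) (v : Dir n) (ξ : Pos n) : freq ε (-v) ξ = -freq ε v ξ := by
  simp [freq]

/-- The symbol of the adjoint transport operator on corrected test functions. -/
noncomputable def symb (a μ₀ κ t : ℝ) : ℂ :=
  1 + a * t * I - charFun P t * (κ + a * μ₀ * t * I)

lemma continuous_symb (a μ₀ κ : ℝ) : Continuous (symb P a μ₀ κ) := by
  have := continuous_charFun (μ := P)
  unfold symb; fun_prop

lemma integrable_dir_of_continuous {F : Dir n → ℂ} (hF : Continuous F) :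
    Integrable F (dirMeasure n) := by
  exact hF.integrable_of_hasCompactSupport (HasCompactSupport.of_compactSpace F)

/-- The change `v ↦ -v` conjugates the characteristic function, so its imaginary part averages to
zero and only the defect survives. -/
lemma integral_charFun_freq (ε : ℝ) (ξ : Pos n) :
    ∫ v : Dir n, (1 - charFun P (freq ε v ξ)) ∂dirMeasure n
      = ((∫ v : Dir n, defect P (freq ε v ξ) ∂dirMeasure n : ℝ) : ℂ) := by
  have hc : Continuous (fun v : Dir n => 1 - charFun P (freq ε v ξ)) :=
    continuous_const.sub ((continuous_charFun (μ := P)).comp (continuous_freq_left ε ξ))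
  have hI := integrable_dir_of_continuous hc
  apply Complex.ext
  · have := integral_re hI
    simp only [RCLike.re_to_complex] at this
    rw [← this, Complex.ofReal_re]
    congr with v
    simp [re_charFun]
  · have h := integral_im hI
    simp only [RCLike.im_to_complex] at h
    rw [← h, Complex.ofReal_im]
    have h2 := integral_dir_neg (fun v : Dir n => (1 - charFun P (freq ε v ξ)).im)
    have h3 : ∀ v : Dir n, (1 - charFun P (freq ε (-v) ξ)).im = -(1 - charFun P (freq ε v ξ)).im := by
      intro v
      rw [freq_neg, charFun_neg]
      simp
    simp_rw [h3, integral_neg] at h2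
    linarith

/-- The terms linear in the frequency average to zero. What remains separates the contribution of
the tail, the cross term between corrector and first moment, and absorption. -/
lemma integral_symb (a μ₀ κ ε : ℝ) (ξ : Pos n) :
    ∫ v : Dir n, symb P a μ₀ κ (freq ε v ξ) ∂dirMeasure n
      = ((∫ v : Dir n, defect P (freq ε v ξ) ∂dirMeasure n : ℝ) : ℂ)
        - a * μ₀ * I * (∫ v : Dir n, freq ε v ξ * (charFun P (freq ε v ξ) - 1) ∂dirMeasure n)
        + (1 - κ) * ∫ v : Dir n, charFun P (freq ε v ξ) ∂dirMeasure n := by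
  have hf := continuous_freq_left (n := n) ε ξ
  have hc : Continuous (fun v : Dir n => charFun P (freq ε v ξ)) :=
    (continuous_charFun (μ := P)).comp hf
  have hf' : Continuous (fun v : Dir n => (freq ε v ξ : ℂ)) := Complex.continuous_ofReal.comp hf
  have h0 : ∫ v : Dir n, (freq ε v ξ : ℂ) ∂dirMeasure n = 0 := by
    rw [integral_complex_ofReal]
    simp [freq, integral_const_mul, integral_inner_dir]
  have h1 : ∀ v : Dir n, symb P a μ₀ κ (freq ε v ξ) = (1 - charFun P (freq ε v ξ))
      + (a * I - a * μ₀ * I) * (freq ε v ξ : ℂ)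
      - a * μ₀ * I * (freq ε v ξ * (charFun P (freq ε v ξ) - 1))
      + (1 - κ) * charFun P (freq ε v ξ) := by
    intro v; rw [symb]; ring
  have i1 : Integrable (fun v : Dir n => 1 - charFun P (freq ε v ξ)) (dirMeasure n) :=
    integrable_dir_of_continuous (continuous_const.sub hc)
  have i2 : Integrable (fun v : Dir n => (a * I - a * μ₀ * I) * (freq ε v ξ : ℂ)) (dirMeasure n) :=
    integrable_dir_of_continuous (continuous_const.mul hf')
  have i3 : Integrable (fun v : Dir n => a * μ₀ * I * (freq ε v ξ * (charFun P (freq ε v ξ) - 1)))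
      (dirMeasure n) :=
    integrable_dir_of_continuous (continuous_const.mul (hf'.mul (hc.sub continuous_const)))
  have i4 : Integrable (fun v : Dir n => (1 - κ) * charFun P (freq ε v ξ)) (dirMeasure n) :=
    integrable_dir_of_continuous (continuous_const.mul hc)
  have i5 := i1.fun_add i2
  have i6 : Integrable (fun v : Dir n => 1 - charFun P (freq ε v ξ)
      + (a * I - a * μ₀ * I) * (freq ε v ξ : ℂ)
      - a * μ₀ * I * (freq ε v ξ * (charFun P (freq ε v ξ) - 1))) (dirMeasure n) := i5.sub i3
  simp_rw [h1]
  rw [integral_add i6 i4, integral_sub i5 i3, integral_add i1 i2,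
    integral_const_mul, integral_const_mul, integral_const_mul, h0, integral_charFun_freq]
  ring

/-- The rescaled averaged symbol converges to `m`, with the bounds needed for passing to the
limit against rapidly decreasing functions. -/
structure SymbolLimit (P : Measure ℝ) (a μ₀ c : ℝ) (θ : ℝ → ℝ) (m : Pos n → ℝ) : Prop where
  tendsto : ∀ ξ : Pos n, Tendsto (fun ε => (∫ v : Dir n,
      symb P a μ₀ (1 - θ ε * (1 - c)) (freq ε v ξ) ∂dirMeasure n) / (θ ε : ℂ))
    (𝓝[>] 0) (𝓝 (m ξ : ℂ))
  bound : ∃ C : ℝ, ∀ᶠ ε in 𝓝[>] (0 : ℝ), ∀ ξ : Pos n, ‖∫ v : Dir n,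
      symb P a μ₀ (1 - θ ε * (1 - c)) (freq ε v ξ) ∂dirMeasure n‖ ≤ C * θ ε * (1 + ‖ξ‖ ^ 2)
  small : ∃ β : ℝ → ℝ, Tendsto (fun ε => β ε / √(θ ε)) (𝓝[>] 0) (𝓝 0) ∧
    ∀ᶠ ε in 𝓝[>] (0 : ℝ), ∀ (ξ : Pos n) (v : Dir n),
      ‖symb P a μ₀ (1 - θ ε * (1 - c)) (freq ε v ξ)‖ ≤ β ε * (1 + ‖ξ‖ ^ 2)

lemma continuous_defect : Continuous (defect P) := by
  have : defect P = fun t => 1 - (charFun P t).re := by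
    funext t; rw [re_charFun]; ring
  rw [this]
  exact continuous_const.sub (Complex.continuous_re.comp continuous_charFun)

variable {P}

lemma TailScaling.tendsto_average {α ℓ : ℝ} {θ : ℝ → ℝ} (h : TailScaling P α ℓ θ)
    (hθ : ∀ᶠ ε in 𝓝[>] (0 : ℝ), 0 < θ ε) (ξ : Pos n) :
    Tendsto (fun ε => (∫ v : Dir n, defect P (freq ε v ξ) ∂dirMeasure n) / θ ε) (𝓝[>] 0)
      (𝓝 (ℓ * ∫ v : Dir n, |2 * Real.pi * inner ℝ (v : Pos n) ξ| ^ α ∂dirMeasure n)) := by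
  obtain ⟨C, hC⟩ := h.bound
  simp_rw [← integral_div]
  rw [← integral_const_mul]
  refine tendsto_integral_filter_of_dominated_convergence
    (fun v : Dir n => C * (1 + (2 * Real.pi * inner ℝ (v : Pos n) ξ) ^ 2)) ?_ ?_ ?_ ?_
  · refine Eventually.of_forall fun ε => Continuous.aestronglyMeasurable ?_
    exact ((continuous_defect P).comp (continuous_freq_left ε ξ)).div_const _
  · filter_upwards [hC, hθ] with ε h1 h2
    refine ae_of_all _ fun v => ?_
    rw [Real.norm_eq_abs, abs_of_nonneg (div_nonneg (defect_nonneg _ _) h2.le), div_le_iff₀ h2]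
    exact (h1 _).trans (le_of_eq (by ring))
  · refine Continuous.integrable_of_hasCompactSupport ?_ (HasCompactSupport.of_compactSpace _)
    fun_prop
  · exact ae_of_all _ fun v => h.tendsto _

omit [IsProbabilityMeasure P] in
lemma TailScaling.average_le [NeZero n] {α ℓ : ℝ} {θ : ℝ → ℝ} (h : TailScaling P α ℓ θ)
    (hθ : ∀ᶠ ε in 𝓝[>] (0 : ℝ), 0 < θ ε) :
    ∃ C : ℝ, ∀ᶠ ε in 𝓝[>] (0 : ℝ), ∀ ξ : Pos n,
      ‖((∫ v : Dir n, defect P (freq ε v ξ) ∂dirMeasure n : ℝ) : ℂ)‖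
        ≤ C * θ ε * (1 + ‖ξ‖ ^ 2) := by
  obtain ⟨C, hC⟩ := h.bound
  refine ⟨|C| * (1 + (2 * Real.pi) ^ 2), ?_⟩
  filter_upwards [hC, hθ] with ε h1 h2 ξ
  rw [Complex.norm_real]
  have := norm_integral_le_of_norm_le_const (μ := dirMeasure n)
    (f := fun v : Dir n => defect P (freq ε v ξ))
    (C := |C| * (1 + (2 * Real.pi) ^ 2) * θ ε * (1 + ‖ξ‖ ^ 2)) (ae_of_all _ fun v => ?_)
  · simpa using this
  rw [Real.norm_eq_abs, abs_of_nonneg (defect_nonneg _ _)]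
  refine (h1 _).trans ?_
  have h3 : (2 * Real.pi * inner ℝ (v : Pos n) ξ) ^ 2 ≤ (2 * Real.pi) ^ 2 * ‖ξ‖ ^ 2 := by
    have h := abs_real_inner_le_norm (v : Pos n) ξ
    rw [norm_eq_of_mem_sphere, one_mul] at h
    rw [mul_pow, ← sq_abs (inner ℝ (v : Pos n) ξ)]
    gcongr
  have h4 : C * θ ε ≤ |C| * θ ε := mul_le_mul_of_nonneg_right (le_abs_self C) h2.le
  have h5 : 0 ≤ |C| * θ ε := by positivity
  calc C * θ ε * (1 + (2 * Real.pi * inner ℝ (v : Pos n) ξ) ^ 2)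
      ≤ |C| * θ ε * (1 + (2 * Real.pi) ^ 2 * ‖ξ‖ ^ 2) := by gcongr
    _ ≤ |C| * θ ε * ((1 + (2 * Real.pi) ^ 2) * (1 + ‖ξ‖ ^ 2)) := by
        gcongr
        nlinarith [sq_nonneg ‖ξ‖, sq_nonneg (2 * Real.pi)]
    _ = _ := by ring

variable (P) in
lemma tendsto_integral_charFun_freq [NeZero n] (ξ : Pos n) :
    Tendsto (fun ε => ∫ v : Dir n, charFun P (freq ε v ξ) ∂dirMeasure n) (𝓝[>] 0) (𝓝 1) := by
  have h1 : (1 : ℂ) = ∫ _ : Dir n, (1 : ℂ) ∂dirMeasure n := by simp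
  rw [h1]
  refine tendsto_integral_filter_of_dominated_convergence (fun _ => 1)
    (Eventually.of_forall fun ε =>
      (continuous_charFun.comp (continuous_freq_left ε ξ)).aestronglyMeasurable)
    (Eventually.of_forall fun ε => ae_of_all _ fun v => norm_charFun_le_one _)
    (integrable_const _) (ae_of_all _ fun v => ?_)
  have : Continuous (fun ε => charFun P (freq ε v ξ)) :=
    continuous_charFun.comp (by unfold freq; fun_prop)
  have h2 := (this.tendsto 0).mono_left (nhdsWithin_le_nhds (s := Ioi 0))
  simpa [freq] using h2

variable (P) in
lemma norm_integral_charFun_freq_le [NeZero n] (ε : ℝ) (ξ : Pos n) :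
    ‖∫ v : Dir n, charFun P (freq ε v ξ) ∂dirMeasure n‖ ≤ 1 := by
  have := norm_integral_le_of_norm_le_const (μ := dirMeasure n)
    (f := fun v : Dir n => charFun P (freq ε v ξ)) (C := 1)
    (ae_of_all _ fun v => norm_charFun_le_one _)
  simpa using this

lemma two_mul_norm_le (ξ : Pos n) : 2 * ‖ξ‖ ≤ 1 + ‖ξ‖ ^ 2 := by nlinarith [sq_nonneg (‖ξ‖ - 1)]

/-- With `a = 0` the symbol is `(1 - P̂) + θ(1-c)P̂`. A finite mean makes the first part `O(ε|ξ|)`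
before averaging, which is `o(√θ)` by the hypothesis on `ε/√θ`; no corrector is needed. -/
lemma symbolLimit_of_uncorrected [NeZero n] {α ℓ c : ℝ} {θ : ℝ → ℝ} (h : TailScaling P α ℓ θ)
    (hc0 : 0 < c) (hc1 : c < 1)
    (hθ : ∀ᶠ ε in 𝓝[>] (0 : ℝ), 0 < θ ε) (hθ0 : Tendsto θ (𝓝[>] 0) (𝓝 0))
    (hθε : Tendsto (fun ε => ε / √(θ ε)) (𝓝[>] 0) (𝓝 0))
    (h1 : Integrable (fun τ : ℝ => τ) P) (μ₀ : ℝ) :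
    SymbolLimit (n := n) P 0 μ₀ c θ (fun ξ =>
      ℓ * (∫ v : Dir n, |2 * Real.pi * inner ℝ (v : Pos n) ξ| ^ α ∂dirMeasure n) + (1 - c)) := by
  have hI : ∀ ε (ξ : Pos n), ∫ v : Dir n, symb P 0 μ₀ (1 - θ ε * (1 - c)) (freq ε v ξ) ∂dirMeasure n
      = ((∫ v : Dir n, defect P (freq ε v ξ) ∂dirMeasure n : ℝ) : ℂ)
        + (θ ε * (1 - c)) * ∫ v : Dir n, charFun P (freq ε v ξ) ∂dirMeasure n := by
    intro ε ξ
    rw [integral_symb]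
    simp
  refine ⟨fun ξ => ?_, ?_, ?_⟩
  · have h2 := ((h.tendsto_average hθ ξ).ofReal).add
      ((tendsto_integral_charFun_freq P ξ).const_mul (1 - c : ℂ))
    have h3 : ((ℓ * (∫ v : Dir n, |2 * Real.pi * inner ℝ (v : Pos n) ξ| ^ α ∂dirMeasure n)
        + (1 - c) : ℝ) : ℂ) = ((ℓ * ∫ v : Dir n,
          |2 * Real.pi * inner ℝ (v : Pos n) ξ| ^ α ∂dirMeasure n : ℝ) : ℂ) + (1 - c) * 1 := by
      push_cast; ring
    rw [h3]
    refine h2.congr' ?_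
    filter_upwards [hθ] with ε hε
    rw [hI]
    have : (θ ε : ℂ) ≠ 0 := by exact_mod_cast hε.ne'
    push_cast
    field_simp
  · obtain ⟨C, hC⟩ := h.average_le (n := n) hθ
    refine ⟨C + 1, ?_⟩
    filter_upwards [hC, hθ] with ε h2 h3 ξ
    rw [hI]
    refine (norm_add_le _ _).trans ?_
    have h4 : ‖(θ ε * (1 - c) : ℂ) * ∫ v : Dir n, charFun P (freq ε v ξ) ∂dirMeasure n‖ ≤ θ ε := by
      have : (θ ε * (1 - c) : ℂ) = ((θ ε * (1 - c) : ℝ) : ℂ) := by push_cast; rfl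
      rw [norm_mul, this, Complex.norm_real, Real.norm_eq_abs,
        abs_of_nonneg (mul_nonneg h3.le (by linarith))]
      have := norm_integral_charFun_freq_le P ε ξ
      nlinarith [mul_nonneg h3.le (by linarith : 0 ≤ 1 - c)]
    have := h2 ξ
    have h5 : 0 ≤ θ ε * ‖ξ‖ ^ 2 := by positivity
    nlinarith
  · have hM0 : 0 ≤ ∫ τ, |τ| ∂P := integral_nonneg fun _ => abs_nonneg _
    set M := ∫ τ, |τ| ∂P
    refine ⟨fun ε => M * Real.pi * ε + θ ε, ?_, ?_⟩
    · have h2 : Tendsto (fun ε => √(θ ε)) (𝓝[>] 0) (𝓝 0) := by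
        simpa using hθ0.sqrt
      have h3 := (hθε.const_mul (M * Real.pi)).add h2
      simp only [mul_zero, add_zero] at h3
      refine h3.congr' ?_
      filter_upwards [hθ] with ε hε
      have h4 := Real.sqrt_pos.2 hε
      have h5 := Real.mul_self_sqrt hε.le
      rw [add_div, mul_div_assoc, Real.div_sqrt]
    · filter_upwards [hθ, self_mem_nhdsWithin] with ε h2 hε ξ v
      have hε : 0 < ε := hε
      have h3 : symb P 0 μ₀ (1 - θ ε * (1 - c)) (freq ε v ξ)
          = -(charFun P (freq ε v ξ) - 1) + (θ ε * (1 - c) : ℝ) * charFun P (freq ε v ξ) := by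
        rw [symb]; push_cast; ring
      rw [h3]
      refine (norm_add_le _ _).trans ?_
      rw [norm_neg, norm_mul, Complex.norm_real, Real.norm_eq_abs,
        abs_of_nonneg (mul_nonneg h2.le (by linarith))]
      have h4 := norm_charFun_sub_one_le P h1 (freq ε v ξ)
      have h5 := abs_freq_le ε v ξ
      rw [abs_of_pos hε] at h5
      have h6 : M * |freq ε v ξ| ≤ M * (ε * (Real.pi * (1 + ‖ξ‖ ^ 2))) := by
        refine mul_le_mul_of_nonneg_left (h5.trans ?_) hM0
        refine mul_le_mul_of_nonneg_left ?_ hε.le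
        have := mul_le_mul_of_nonneg_left (two_mul_norm_le ξ) Real.pi_pos.le
        linarith
      have h7 : θ ε * (1 - c) * ‖charFun P (freq ε v ξ)‖ ≤ θ ε * (1 + ‖ξ‖ ^ 2) := by
        have h8 := norm_charFun_le_one (μ := P) (freq ε v ξ)
        have : (1 - c) * ‖charFun P (freq ε v ξ)‖ ≤ 1 * 1 := by
          refine mul_le_mul (by linarith) h8 (norm_nonneg _) zero_le_one
        rw [mul_assoc]
        refine mul_le_mul_of_nonneg_left ?_ h2.le
        nlinarith [sq_nonneg ‖ξ‖]
      linarith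

/-- Here `√θ = ε`, so an uncancelled term of order `t` in the symbol would be too large. The choice
`a(1-μ₀) = ∫ τ` cancels it and leaves `O(ε²)`. In the average, the cross term contributes `-iaμ₀ ·
i(∫τ)w² = aμ₀(∫τ)w²`. -/
lemma symbolLimit_of_sq [NeZero n] {c a μ₀ : ℝ} (hc0 : 0 < c) (hc1 : c < 1)
    (h1 : Integrable (fun τ : ℝ => τ) P) (h2 : Integrable (fun τ : ℝ => τ ^ 2) P)
    (ha : a * (1 - μ₀) = ∫ τ, τ ∂P) :
    SymbolLimit (n := n) P a μ₀ c (fun ε => ε ^ 2) (fun ξ =>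
      ((∫ τ, τ ^ 2 ∂P) / 2 + a * μ₀ * ∫ τ, τ ∂P) *
        (∫ v : Dir n, |2 * Real.pi * inner ℝ (v : Pos n) ξ| ^ (2 : ℝ) ∂dirMeasure n)
        + (1 - c)) := by
  have h := tailScaling_of_sq P h2
  have hθ : ∀ᶠ ε in 𝓝[>] (0 : ℝ), 0 < ε ^ 2 := by
    filter_upwards [self_mem_nhdsWithin] with ε hε
    exact pow_pos hε 2
  set m₁ := ∫ τ, τ ∂P with hm₁
  have hM0 : 0 ≤ ∫ τ, |τ| ∂P := integral_nonneg fun _ => abs_nonneg _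
  have hM2 : 0 ≤ ∫ τ, τ ^ 2 ∂P := integral_nonneg fun _ => sq_nonneg _
  set M₁ := ∫ τ, |τ| ∂P
  set M₂ := ∫ τ, τ ^ 2 ∂P
  have hfsq : ∀ ε (v : Dir n) (ξ : Pos n), freq ε v ξ ^ 2 ≤ (2 * Real.pi) ^ 2 * ε ^ 2 * ‖ξ‖ ^ 2 := by
    intro ε v ξ
    have := pow_le_pow_left₀ (abs_nonneg _) (abs_freq_le ε v ξ) 2
    rw [sq_abs, mul_pow, sq_abs] at this
    linarith
  have hcross : ∀ t : ℝ, ‖(t : ℂ) * (charFun P t - 1)‖ ≤ M₁ * t ^ 2 := by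
    intro t
    rw [norm_mul, Complex.norm_real, Real.norm_eq_abs, ← sq_abs]
    have := mul_le_mul_of_nonneg_left (norm_charFun_sub_one_le P h1 t) (abs_nonneg t)
    linarith
  refine ⟨fun ξ => ?_, ?_, ?_⟩
  -- To first order `P̂(t) - 1 = i m₁ t`, hence `t(P̂(t) - 1)/ε²` tends to `i m₁ w²` when `t = εw`.
  · have hX : Tendsto (fun ε => (∫ v : Dir n, (freq ε v ξ : ℂ) * (charFun P (freq ε v ξ) - 1)
        ∂dirMeasure n) / (ε ^ 2 : ℂ)) (𝓝[>] 0) (𝓝 (∫ v : Dir n,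
          m₁ * I * ((|2 * Real.pi * inner ℝ (v : Pos n) ξ| ^ (2 : ℝ) : ℝ) : ℂ) ∂dirMeasure n)) := by
      simp_rw [← integral_div]
      refine tendsto_integral_filter_of_dominated_convergence
        (fun _ => M₁ * ((2 * Real.pi) ^ 2 * ‖ξ‖ ^ 2)) ?_ ?_ (integrable_const _)
        (ae_of_all _ fun v => ?_)
      · refine Eventually.of_forall fun ε => Continuous.aestronglyMeasurable ?_
        have hf := continuous_freq_left (n := n) ε ξ
        have := (continuous_charFun (μ := P)).comp hf
        exact ((Complex.continuous_ofReal.comp hf).mul (this.sub continuous_const)).div_const _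
      · filter_upwards [hθ] with ε hε
        refine ae_of_all _ fun v => ?_
        have h5 : ‖(ε ^ 2 : ℂ)‖ = ε ^ 2 := by
          rw [← Complex.ofReal_pow, Complex.norm_real, Real.norm_eq_abs, abs_of_pos hε]
        rw [norm_div, h5, div_le_iff₀ hε]
        refine (hcross _).trans ?_
        have := mul_le_mul_of_nonneg_left (hfsq ε v ξ) hM0
        linarith
      · set w := 2 * Real.pi * inner ℝ (v : Pos n) ξ
        have h5 : Tendsto (fun ε : ℝ => 3 * M₂ * |w| ^ 3 * ε) (𝓝[>] 0) (𝓝 0) := by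
          have : Continuous (fun ε : ℝ => 3 * M₂ * |w| ^ 3 * ε) := by fun_prop
          simpa using (this.tendsto 0).mono_left (nhdsWithin_le_nhds (s := Ioi 0))
        rw [tendsto_iff_norm_sub_tendsto_zero]
        refine squeeze_zero' (Eventually.of_forall fun _ => norm_nonneg _) ?_ h5
        filter_upwards [self_mem_nhdsWithin] with ε hε
        have hε : 0 < ε := hε
        have hεc : (ε : ℂ) ≠ 0 := by exact_mod_cast hε.ne'
        have hfr : freq ε v ξ = ε * w := rfl
        have h6 := norm_charFun_sub_one_sub_le P h1 h2 (ε * w)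
        rw [hfr, Real.rpow_two, sq_abs]
        have h7 : ((ε * w : ℝ) : ℂ) * (charFun P (ε * w) - 1) / (ε : ℂ) ^ 2
            - m₁ * I * ((w ^ 2 : ℝ) : ℂ)
            = (w / ε : ℝ) * (charFun P (ε * w) - 1 - (m₁ : ℂ) * (ε * w : ℝ) * I) := by
          push_cast
          field_simp
        rw [h7, norm_mul, Complex.norm_real, Real.norm_eq_abs, abs_div, abs_of_pos hε]
        refine (mul_le_mul_of_nonneg_left h6 (by positivity)).trans (le_of_eq ?_)
        change |w| / ε * (3 * M₂ * (ε * w) ^ 2) = 3 * M₂ * |w| ^ 3 * ε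
        rw [mul_pow, ← sq_abs w]
        field_simp
    have h3 := (((h.tendsto_average hθ ξ).ofReal).sub (hX.const_mul (a * μ₀ * I))).add
      ((tendsto_integral_charFun_freq P ξ).const_mul (1 - c : ℂ))
    have h4 : (((M₂ / 2 + a * μ₀ * m₁) *
        (∫ v : Dir n, |2 * Real.pi * inner ℝ (v : Pos n) ξ| ^ (2 : ℝ) ∂dirMeasure n)
        + (1 - c) : ℝ) : ℂ) = ((M₂ / 2 * ∫ v : Dir n,
          |2 * Real.pi * inner ℝ (v : Pos n) ξ| ^ (2 : ℝ) ∂dirMeasure n : ℝ) : ℂ)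
        - a * μ₀ * I * (∫ v : Dir n,
          m₁ * I * ((|2 * Real.pi * inner ℝ (v : Pos n) ξ| ^ (2 : ℝ) : ℝ) : ℂ) ∂dirMeasure n)
        + (1 - c) * 1 := by
      rw [integral_const_mul, integral_complex_ofReal]
      push_cast
      linear_combination (a * μ₀ * m₁ * (∫ v : Dir n,
        |2 * Real.pi * inner ℝ (v : Pos n) ξ| ^ (2 : ℝ) ∂dirMeasure n : ℝ) : ℂ) * Complex.I_sq
    rw [h4]
    refine h3.congr' ?_
    filter_upwards [hθ] with ε hε
    rw [integral_symb]
    have hε2 : (ε : ℂ) ^ 2 ≠ 0 := by exact_mod_cast hε.ne'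
    have hε3 : (ε : ℂ) ≠ 0 := fun h => hε2 (by rw [h]; ring)
    push_cast
    field_simp
    ring
  · obtain ⟨C, hC⟩ := h.average_le (n := n) hθ
    refine ⟨C + |a * μ₀| * (M₁ * (2 * Real.pi) ^ 2) + 1, ?_⟩
    filter_upwards [hC, hθ] with ε h3 hε ξ
    rw [integral_symb]
    have h4 : ‖∫ v : Dir n, (freq ε v ξ : ℂ) * (charFun P (freq ε v ξ) - 1) ∂dirMeasure n‖
        ≤ M₁ * ((2 * Real.pi) ^ 2 * ε ^ 2 * ‖ξ‖ ^ 2) := by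
      have := norm_integral_le_of_norm_le_const (μ := dirMeasure n)
        (f := fun v : Dir n => (freq ε v ξ : ℂ) * (charFun P (freq ε v ξ) - 1))
        (C := M₁ * ((2 * Real.pi) ^ 2 * ε ^ 2 * ‖ξ‖ ^ 2)) (ae_of_all _ fun v => ?_)
      · simpa using this
      · exact (hcross _).trans (mul_le_mul_of_nonneg_left (hfsq ε v ξ) hM0)
    have h5 : ‖(a * μ₀ * I : ℂ) * ∫ v : Dir n, (freq ε v ξ : ℂ) * (charFun P (freq ε v ξ) - 1)
        ∂dirMeasure n‖ ≤ |a * μ₀| * (M₁ * ((2 * Real.pi) ^ 2 * ε ^ 2 * ‖ξ‖ ^ 2)) := by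
      have h6 : ‖(a * μ₀ * I : ℂ)‖ = |a * μ₀| := by simp
      rw [norm_mul, h6]
      exact mul_le_mul_of_nonneg_left h4 (abs_nonneg _)
    have h7 : ‖(1 - ((1 - ε ^ 2 * (1 - c) : ℝ) : ℂ)) *
        ∫ v : Dir n, charFun P (freq ε v ξ) ∂dirMeasure n‖ ≤ ε ^ 2 := by
      have : (1 - ((1 - ε ^ 2 * (1 - c) : ℝ) : ℂ)) = ((ε ^ 2 * (1 - c) : ℝ) : ℂ) := by
        push_cast; ring
      rw [norm_mul, this, Complex.norm_real, Real.norm_eq_abs,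
        abs_of_nonneg (mul_nonneg hε.le (by linarith))]
      have := norm_integral_charFun_freq_le P ε ξ
      nlinarith [mul_nonneg hε.le (by linarith : 0 ≤ 1 - c)]
    have h8 := (norm_add_le _ _).trans (add_le_add ((norm_sub_le _ _).trans
      (add_le_add (h3 ξ) h5)) h7)
    refine h8.trans ?_
    have h9 : 0 ≤ |a * μ₀| * (M₁ * (2 * Real.pi) ^ 2) * ε ^ 2 := by positivity
    have h10 : 0 ≤ ε ^ 2 * ‖ξ‖ ^ 2 := by positivity
    nlinarith
  · set K := (3 * M₂ + |a * μ₀| * M₁) * (2 * Real.pi) ^ 2 + 1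
    refine ⟨fun ε => K * ε ^ 2, ?_, ?_⟩
    · have h3 : Tendsto (fun ε : ℝ => K * ε) (𝓝[>] 0) (𝓝 0) := by
        have : Continuous (fun ε : ℝ => K * ε) := by fun_prop
        simpa using (this.tendsto 0).mono_left (nhdsWithin_le_nhds (s := Ioi 0))
      refine h3.congr' ?_
      filter_upwards [self_mem_nhdsWithin] with ε hε
      have hε : 0 < ε := hε
      rw [Real.sqrt_sq hε.le]
      field_simp
    · filter_upwards [hθ] with ε hε ξ v
      set t := freq ε v ξ with ht
      -- By `ha`, `a - aμ₀ = m₁`: the linear terms of the symbol combine into the second-order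
      -- Taylor remainder of `P̂`.
      have h3 : symb P a μ₀ (1 - ε ^ 2 * (1 - c)) t
          = -(charFun P t - 1 - (m₁ : ℂ) * t * I) - (a * μ₀ * I) * (t * (charFun P t - 1))
            + (ε ^ 2 * (1 - c) : ℝ) * charFun P t := by
        have ha' : (a : ℂ) * (1 - μ₀) = m₁ := by exact_mod_cast ha
        rw [symb, ← ha']; push_cast; ring
      have h6 : ‖(a * μ₀ * I : ℂ)‖ = |a * μ₀| := by simp
      have h4 : ‖((ε ^ 2 * (1 - c) : ℝ) : ℂ) * charFun P t‖ ≤ ε ^ 2 := by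
        rw [norm_mul, Complex.norm_real, Real.norm_eq_abs,
          abs_of_nonneg (mul_nonneg hε.le (by linarith))]
        nlinarith [norm_charFun_le_one (μ := P) t, mul_nonneg hε.le (by linarith : 0 ≤ 1 - c)]
      have h5 : ‖(a * μ₀ * I : ℂ) * (t * (charFun P t - 1))‖ ≤ |a * μ₀| * (M₁ * t ^ 2) := by
        rw [norm_mul, h6]
        exact mul_le_mul_of_nonneg_left (hcross t) (abs_nonneg _)
      rw [h3]
      have h7 := (norm_add_le _ _).trans (add_le_add ((norm_sub_le _ _).trans (add_le_add
        ((norm_neg _).le.trans (norm_charFun_sub_one_sub_le P h1 h2 t)) h5)) h4)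
      refine h7.trans ?_
      have h8 := mul_le_mul_of_nonneg_left (hfsq ε v ξ)
        (by positivity : 0 ≤ 3 * M₂ + |a * μ₀| * M₁)
      have h9 : 0 ≤ (3 * M₂ + |a * μ₀| * M₁) * (2 * Real.pi) ^ 2 * ε ^ 2 := by positivity
      have h10 : 0 ≤ ε ^ 2 * ‖ξ‖ ^ 2 := by positivity
      simp only [K]
      nlinarith

end Symbol

end NonclassicalTransport

namespace NonclassicalTransport

/-! ### Weighted Cauchy–Schwarz and square-integrability on products. -/

section SquareIntegrable

variable {X Y : Type*} [MeasurableSpace X] [MeasurableSpace Y]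

/-- Cauchy–Schwarz for an average with a nonnegative weight. -/
lemma integrable_weight_mul {ν : Measure Y} {k f : Y → ℝ} (hk : Integrable k ν)
    (hk0 : ∀ y, 0 ≤ k y) (hf : AEStronglyMeasurable f ν)
    (hkf : Integrable (fun y => k y * f y ^ 2) ν) : Integrable (fun y => k y * f y) ν := by
  refine (hk.add hkf).mono' (hk.aestronglyMeasurable.mul hf) (ae_of_all _ fun y => ?_)
  rw [Real.norm_eq_abs, abs_mul, abs_of_nonneg (hk0 y)]
  have h : |f y| ≤ 1 + f y ^ 2 := by
    rw [← sq_abs]; nlinarith [sq_nonneg (|f y| - 1), abs_nonneg (f y)]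
  have := mul_le_mul_of_nonneg_left h (hk0 y)
  simp only [Pi.add_apply]
  linarith

/-- With `m = ∫ k` and `B = ∫ k f`, expand `∫ k (m f - B)² ≥ 0` and divide by `m`. If `m = 0` the
weight vanishes almost everywhere. -/
lemma sq_integral_weight_mul_le {ν : Measure Y} {k f : Y → ℝ} (hk : Integrable k ν)
    (hk0 : ∀ y, 0 ≤ k y) (hf : AEStronglyMeasurable f ν)
    (hkf : Integrable (fun y => k y * f y ^ 2) ν) :
    (∫ y, k y * f y ∂ν) ^ 2 ≤ (∫ y, k y ∂ν) * ∫ y, k y * f y ^ 2 ∂ν := by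
  have hi := integrable_weight_mul hk hk0 hf hkf
  have hm : 0 ≤ ∫ y, k y ∂ν := integral_nonneg hk0
  set m := ∫ y, k y ∂ν with hmdef
  set B := ∫ y, k y * f y ∂ν with hB
  set A := ∫ y, k y * f y ^ 2 ∂ν with hA
  rcases hm.eq_or_lt with h0 | h0
  · have h1 : k =ᵐ[ν] 0 := (integral_eq_zero_iff_of_nonneg hk0 hk).1 h0.symm
    have h2 : B = 0 := by
      rw [hB]
      refine integral_eq_zero_of_ae ?_
      filter_upwards [h1] with y hy
      simp [hy]
    rw [h2, ← h0]; simp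
  · have h1 : 0 ≤ ∫ y, (m ^ 2 * (k y * f y ^ 2) - 2 * m * B * (k y * f y) + B ^ 2 * k y) ∂ν := by
      refine integral_nonneg fun y => ?_
      have : m ^ 2 * (k y * f y ^ 2) - 2 * m * B * (k y * f y) + B ^ 2 * k y
          = k y * (m * f y - B) ^ 2 := by ring
      simp only [Pi.zero_apply]
      rw [this]
      exact mul_nonneg (hk0 y) (sq_nonneg _)
    have i1 : Integrable (fun y => m ^ 2 * (k y * f y ^ 2) - 2 * m * B * (k y * f y)) ν :=
      (hkf.const_mul _).sub (hi.const_mul _)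
    rw [integral_add i1 (hk.const_mul _), integral_sub (hkf.const_mul _) (hi.const_mul _),
      integral_const_mul, integral_const_mul, integral_const_mul] at h1
    have h2 : 0 ≤ m * (m * A - B ^ 2) := by nlinarith
    have := nonneg_of_mul_nonneg_right h2 h0
    linarith

lemma memLp_two_real_iff {μ : Measure X} {f : X → ℝ} :
    MemLp f 2 μ ↔ AEStronglyMeasurable f μ ∧ Integrable (fun x => f x ^ 2) μ :=
  ⟨fun h => ⟨h.1, h.integrable_sq⟩, fun h => (memLp_two_iff_integrable_sq h.1).2 h.2⟩

lemma memLp_integral_prod {μ : Measure X} {ν : Measure Y} [SFinite μ] [IsFiniteMeasure ν]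
    {F : X × Y → ℝ} (hF : MemLp F 2 (μ.prod ν)) :
    MemLp (fun x => ∫ y, F (x, y) ∂ν) 2 μ ∧
      ∫ x, (∫ y, F (x, y) ∂ν) ^ 2 ∂μ ≤ ν.real univ * ∫ y, F y ^ 2 ∂μ.prod ν := by
  obtain ⟨hm, hsq⟩ := memLp_two_real_iff.1 hF
  have hm1 : AEStronglyMeasurable (fun x => ∫ y, F (x, y) ∂ν) μ := hm.integral_prod_right'
  have hint : Integrable (fun x => ∫ y, F (x, y) ^ 2 ∂ν) μ := hsq.integral_prod_left
  have hle : ∀ᵐ x ∂μ, (∫ y, F (x, y) ∂ν) ^ 2 ≤ ν.real univ * ∫ y, F (x, y) ^ 2 ∂ν := by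
    filter_upwards [hsq.prod_right_ae, hm.prodMk_left] with x hx hx2
    have := sq_integral_weight_mul_le (k := fun _ => 1) (f := fun y => F (x, y))
      (integrable_const 1) (fun _ => zero_le_one) hx2 (by simpa using hx)
    simpa using this
  have hi2 : Integrable (fun x => (∫ y, F (x, y) ∂ν) ^ 2) μ := by
    refine (hint.const_mul (ν.real univ)).mono' (hm1.pow 2) ?_
    filter_upwards [hle] with x hx
    rwa [Real.norm_eq_abs, abs_of_nonneg (sq_nonneg _)]
  refine ⟨memLp_two_real_iff.2 ⟨hm1, hi2⟩, ?_⟩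
  rw [integral_prod _ hsq, ← integral_const_mul]
  exact integral_mono_ae hi2 (hint.const_mul _) hle

/-- Exchange of the last two factors of a triple product. -/
def swapRight (X Y : Type*) [MeasurableSpace X] [MeasurableSpace Y] :
    ((X × Y) × Y) ≃ᵐ ((X × Y) × Y) :=
  MeasurableEquiv.prodAssoc.trans
    (((MeasurableEquiv.refl X).prodCongr MeasurableEquiv.prodComm).trans
      MeasurableEquiv.prodAssoc.symm)

lemma measurePreserving_swapRight (μ : Measure X) (ν : Measure Y) [SFinite μ] [SFinite ν] :
    MeasurePreserving (swapRight X Y) ((μ.prod ν).prod ν) ((μ.prod ν).prod ν) := by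
  have h1 := measurePreserving_prodAssoc μ ν ν
  have h2 : MeasurePreserving ((MeasurableEquiv.refl X).prodCongr
      (MeasurableEquiv.prodComm : Y × Y ≃ᵐ Y × Y)) (μ.prod (ν.prod ν)) (μ.prod (ν.prod ν)) :=
    (MeasurePreserving.id μ).prod Measure.measurePreserving_swap
  have h3 := (measurePreserving_prodAssoc μ ν ν).symm
  exact h3.comp (h2.comp h1)

end SquareIntegrable

end NonclassicalTransport

namespace NonclassicalTransport

variable {n : ℕ}

/-! ### Symmetric scattering kernels as bounded self-adjoint operators on `L²`. -/

section Kernel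

/-- A symmetric nonnegative scattering kernel of constant mass `m`. -/
structure IsKernel (k : Dir n → Dir n → ℝ) (m : ℝ) : Prop where
  measurable : Measurable (fun y : Dir n × Dir n => k y.1 y.2)
  nonneg : ∀ v v', 0 ≤ k v v'
  symm : ∀ v v', k v v' = k v' v
  integrable : ∀ v, Integrable (k v) (dirMeasure n)
  mass : ∀ v, ∫ v', k v v' ∂dirMeasure n = m

/-- The integral operator in the velocity variable with kernel `k`. -/
noncomputable def kernelOp (k : Dir n → Dir n → ℝ) (f : Pos n × Dir n → ℝ) (z : Pos n × Dir n) : ℝ :=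
  ∫ v', k z.2 v' * f (z.1, v') ∂dirMeasure n

/-- The velocity average. -/
noncomputable def velAvg (f : Pos n × Dir n → ℝ) (x : Pos n) : ℝ := ∫ v, f (x, v) ∂dirMeasure n

variable {k : Dir n → Dir n → ℝ} {m : ℝ} [NeZero n]

lemma memLp_fst {ρ : Pos n → ℝ} (h : MemLp ρ 2 volume) :
    MemLp (fun z : Pos n × Dir n => ρ z.1) 2 (phaseMeasure n) :=
  h.comp_measurePreserving measurePreserving_fst

/-- Lifts functions of `(x,v')` to triples `(x,v,v')`; the discarded direction costs nothing because
the sphere has mass one. -/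
lemma measurePreserving_proj :
    MeasurePreserving (fun y : (Pos n × Dir n) × Dir n => (y.1.1, y.2))
      ((phaseMeasure n).prod (dirMeasure n)) (phaseMeasure n) := by
  have h1 : MeasurePreserving (Prod.fst : (Pos n × Dir n) × Dir n → Pos n × Dir n)
      ((phaseMeasure n).prod (dirMeasure n)) (phaseMeasure n) := measurePreserving_fst
  exact h1.comp (measurePreserving_swapRight volume (dirMeasure n))

omit [NeZero n] in
lemma IsKernel.integrable_prod (hk : IsKernel k m) {f : Pos n × Dir n → ℝ}
    (hf : MemLp f 2 (phaseMeasure n)) :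
    Integrable (fun y : (Pos n × Dir n) × Dir n => k y.1.2 y.2 * f y.1 ^ 2)
      ((phaseMeasure n).prod (dirMeasure n)) := by
  obtain ⟨hm, hsq⟩ := memLp_two_real_iff.1 hf
  have hkm : Measurable (fun y : (Pos n × Dir n) × Dir n => k y.1.2 y.2) :=
    hk.measurable.comp ((measurable_snd.comp measurable_fst).prodMk measurable_snd)
  have hmeas : AEStronglyMeasurable (fun y : (Pos n × Dir n) × Dir n => k y.1.2 y.2 * f y.1 ^ 2)
      ((phaseMeasure n).prod (dirMeasure n)) :=
    hkm.aestronglyMeasurable.mul (hm.comp_fst.pow 2)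
  rw [integrable_prod_iff hmeas]
  refine ⟨ae_of_all _ fun z => (hk.integrable z.2).mul_const (f z ^ 2), ?_⟩
  refine (hsq.const_mul m).congr (ae_of_all _ fun z => ?_)
  simp only
  rw [← hk.mass z.2, ← integral_mul_const]
  congr with v
  rw [Real.norm_eq_abs, abs_of_nonneg (mul_nonneg (hk.nonneg _ _) (sq_nonneg _))]

omit [NeZero n] in
lemma IsKernel.integral_prod (hk : IsKernel k m) {f : Pos n × Dir n → ℝ}
    (hf : MemLp f 2 (phaseMeasure n)) :
    ∫ y : (Pos n × Dir n) × Dir n, k y.1.2 y.2 * f y.1 ^ 2 ∂((phaseMeasure n).prod (dirMeasure n))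
      = m * ∫ z, f z ^ 2 ∂phaseMeasure n := by
  rw [MeasureTheory.integral_prod _ (hk.integrable_prod hf), ← integral_const_mul]
  congr with z
  simp only
  rw [integral_mul_const, hk.mass]

omit [NeZero n] in
-- Exchanging `v` and `v'` moves the square from the outer to the inner direction. Symmetry of the
-- kernel thus takes the place of boundedness, which `σ` need not have.
lemma IsKernel.integrable_prod' (hk : IsKernel k m) {f : Pos n × Dir n → ℝ}
    (hf : MemLp f 2 (phaseMeasure n)) :
    Integrable (fun y : (Pos n × Dir n) × Dir n => k y.1.2 y.2 * f (y.1.1, y.2) ^ 2)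
      ((phaseMeasure n).prod (dirMeasure n)) := by
  have h := (measurePreserving_swapRight volume (dirMeasure n)).integrable_comp_of_integrable
    (hk.integrable_prod hf)
  refine h.congr (ae_of_all _ fun y => ?_)
  simp only [Function.comp]
  rw [hk.symm y.1.2 y.2]
  rfl

omit [NeZero n] in
lemma IsKernel.integral_prod' (hk : IsKernel k m) {f : Pos n × Dir n → ℝ}
    (hf : MemLp f 2 (phaseMeasure n)) :
    ∫ y : (Pos n × Dir n) × Dir n, k y.1.2 y.2 * f (y.1.1, y.2) ^ 2
      ∂((phaseMeasure n).prod (dirMeasure n)) = m * ∫ z, f z ^ 2 ∂phaseMeasure n := by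
  rw [← hk.integral_prod hf]
  have h := (measurePreserving_swapRight volume (dirMeasure n)).integral_comp'
    (fun y : (Pos n × Dir n) × Dir n => k y.1.2 y.2 * f y.1 ^ 2)
  refine Eq.trans (integral_congr_ae (ae_of_all _ fun y => ?_)) h
  simp only
  rw [hk.symm y.1.2 y.2]
  rfl

lemma aestronglyMeasurable_section {f : Pos n × Dir n → ℝ}
    (hf : AEStronglyMeasurable f (phaseMeasure n)) :
    ∀ᵐ z ∂phaseMeasure n, AEStronglyMeasurable (fun v' => f (z.1, v')) (dirMeasure n) := by
  have := (hf.comp_measurePreserving measurePreserving_proj).prodMk_left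
  exact this

omit [NeZero n] in
lemma IsKernel.ae_integrable_sq (hk : IsKernel k m) {f : Pos n × Dir n → ℝ}
    (hf : MemLp f 2 (phaseMeasure n)) : ∀ᵐ z ∂phaseMeasure n,
      Integrable (fun v' => k z.2 v' * f (z.1, v') ^ 2) (dirMeasure n) :=
  (hk.integrable_prod' hf).prod_right_ae

lemma IsKernel.ae_integrable (hk : IsKernel k m) {f : Pos n × Dir n → ℝ}
    (hf : MemLp f 2 (phaseMeasure n)) : ∀ᵐ z ∂phaseMeasure n,
      Integrable (fun v' => k z.2 v' * f (z.1, v')) (dirMeasure n) := by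
  filter_upwards [hk.ae_integrable_sq hf, aestronglyMeasurable_section hf.1] with z h1 h2
  exact integrable_weight_mul (hk.integrable z.2) (hk.nonneg z.2) h2 h1

lemma IsKernel.aestronglyMeasurable_kernelOp (hk : IsKernel k m) {f : Pos n × Dir n → ℝ}
    (hf : AEStronglyMeasurable f (phaseMeasure n)) :
    AEStronglyMeasurable (kernelOp k f) (phaseMeasure n) := by
  have hkm : Measurable (fun y : (Pos n × Dir n) × Dir n => k y.1.2 y.2) :=
    hk.measurable.comp ((measurable_snd.comp measurable_fst).prodMk measurable_snd)
  have : AEStronglyMeasurable (fun y : (Pos n × Dir n) × Dir n => k y.1.2 y.2 * f (y.1.1, y.2))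
      ((phaseMeasure n).prod (dirMeasure n)) :=
    hkm.aestronglyMeasurable.mul (hf.comp_measurePreserving measurePreserving_proj)
  exact this.integral_prod_right'

/-- The kernel operator is bounded by its mass on `L²`. -/
lemma IsKernel.memLp_kernelOp (hk : IsKernel k m) {f : Pos n × Dir n → ℝ}
    (hf : MemLp f 2 (phaseMeasure n)) : MemLp (kernelOp k f) 2 (phaseMeasure n) ∧
      ∫ z, kernelOp k f z ^ 2 ∂phaseMeasure n ≤ m ^ 2 * ∫ z, f z ^ 2 ∂phaseMeasure n := by
  have hm1 := hk.aestronglyMeasurable_kernelOp hf.1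
  have hint := (hk.integrable_prod' hf).integral_prod_left
  -- Schur's test: Cauchy–Schwarz in `v'` yields one factor `m`, and integration in `v`, by
  -- symmetry, the second.
  have hle : ∀ᵐ z ∂phaseMeasure n, kernelOp k f z ^ 2
      ≤ m * ∫ v', k z.2 v' * f (z.1, v') ^ 2 ∂dirMeasure n := by
    filter_upwards [hk.ae_integrable_sq hf, aestronglyMeasurable_section hf.1] with z h1 h2
    have := sq_integral_weight_mul_le (hk.integrable z.2) (hk.nonneg z.2) h2 h1
    rwa [hk.mass] at this
  have hi2 : Integrable (fun z => kernelOp k f z ^ 2) (phaseMeasure n) := by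
    refine (hint.const_mul m).mono' (hm1.pow 2) ?_
    filter_upwards [hle] with x hx
    rwa [Real.norm_eq_abs, abs_of_nonneg (sq_nonneg _)]
  refine ⟨memLp_two_real_iff.2 ⟨hm1, hi2⟩, ?_⟩
  refine (integral_mono_ae hi2 (hint.const_mul m) hle).trans (le_of_eq ?_)
  rw [integral_const_mul, ← MeasureTheory.integral_prod _ (hk.integrable_prod' hf),
    hk.integral_prod' hf]
  ring

lemma IsKernel.integrable_triple (hk : IsKernel k m) {f F : Pos n × Dir n → ℝ}
    (hf : MemLp f 2 (phaseMeasure n)) (hF : MemLp F 2 (phaseMeasure n)) :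
    Integrable (fun y : (Pos n × Dir n) × Dir n => k y.1.2 y.2 * f (y.1.1, y.2) * F y.1)
      ((phaseMeasure n).prod (dirMeasure n)) := by
  have hkm : Measurable (fun y : (Pos n × Dir n) × Dir n => k y.1.2 y.2) :=
    hk.measurable.comp ((measurable_snd.comp measurable_fst).prodMk measurable_snd)
  refine ((hk.integrable_prod' hf).add (hk.integrable_prod hF)).mono'
    ((hkm.aestronglyMeasurable.mul (hf.1.comp_measurePreserving measurePreserving_proj)).mul
      hF.1.comp_fst) (ae_of_all _ fun y => ?_)
  rw [Real.norm_eq_abs, abs_mul, abs_mul, abs_of_nonneg (hk.nonneg _ _)]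
  simp only [Pi.add_apply]
  rw [mul_assoc, ← mul_add]
  refine mul_le_mul_of_nonneg_left ?_ (hk.nonneg _ _)
  rw [← sq_abs (f _), ← sq_abs (F _)]
  nlinarith [sq_nonneg (|f (y.1.1, y.2)| - |F y.1|), sq_nonneg |f (y.1.1, y.2)|, sq_nonneg |F y.1|]

/-- Self-adjointness: both sides are one triple integral over `(x,v,v')` up to exchanging `v` and
`v'`. -/
lemma IsKernel.integral_kernelOp_mul (hk : IsKernel k m) {f F : Pos n × Dir n → ℝ}
    (hf : MemLp f 2 (phaseMeasure n)) (hF : MemLp F 2 (phaseMeasure n)) :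
    ∫ z, kernelOp k f z * F z ∂phaseMeasure n = ∫ z, f z * kernelOp k F z ∂phaseMeasure n := by
  have h1 : ∫ z, kernelOp k f z * F z ∂phaseMeasure n
      = ∫ y : (Pos n × Dir n) × Dir n, k y.1.2 y.2 * f (y.1.1, y.2) * F y.1
        ∂((phaseMeasure n).prod (dirMeasure n)) := by
    rw [MeasureTheory.integral_prod _ (hk.integrable_triple hf hF)]
    simp only [kernelOp, integral_mul_const]
  have h2 : ∫ z, f z * kernelOp k F z ∂phaseMeasure n
      = ∫ y : (Pos n × Dir n) × Dir n, k y.1.2 y.2 * F (y.1.1, y.2) * f y.1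
        ∂((phaseMeasure n).prod (dirMeasure n)) := by
    rw [MeasureTheory.integral_prod _ (hk.integrable_triple hF hf)]
    simp only [kernelOp, integral_mul_const, mul_comm (f _)]
  rw [h1, h2]
  have h := (measurePreserving_swapRight volume (dirMeasure n)).integral_comp'
    (fun y : (Pos n × Dir n) × Dir n => k y.1.2 y.2 * F (y.1.1, y.2) * f y.1)
  refine Eq.trans (integral_congr_ae (ae_of_all _ fun y => ?_)) h
  simp only
  rw [hk.symm y.1.2 y.2, mul_right_comm]
  rfl

/-- The velocity average is the operator of the constant kernel, so facts about averages become
special cases of facts about kernels. -/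
lemma isKernel_one : IsKernel (fun _ _ : Dir n => 1) 1 :=
  ⟨measurable_const, fun _ _ => zero_le_one, fun _ _ => rfl, fun _ => integrable_const _,
    fun _ => by simp⟩

omit [NeZero n] in
lemma kernelOp_one (f : Pos n × Dir n → ℝ) (z : Pos n × Dir n) :
    kernelOp (fun _ _ => 1) f z = velAvg f z.1 := by
  simp [kernelOp, velAvg]

lemma memLp_velAvg {f : Pos n × Dir n → ℝ} (hf : MemLp f 2 (phaseMeasure n)) :
    MemLp (velAvg f) 2 volume ∧ ∫ x, velAvg f x ^ 2 ≤ ∫ z, f z ^ 2 ∂phaseMeasure n := by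
  have := memLp_integral_prod (μ := (volume : Measure (Pos n))) (ν := dirMeasure n) hf
  rw [probReal_univ, one_mul] at this
  exact this

variable {σ : ℝ → ℝ} {σ₀ : ℝ}

/-- Subtracting a constant `b ≤ σ₀` from the scattering kernel leaves a kernel of mass `1 - b`. -/
lemma isKernel_sub (hσ_meas : Measurable σ)
    (hσ_norm : ∀ v : Dir n, ∫ v', σ (cosine v v') ∂dirMeasure n = 1)
    (hσ_lower : ∀ v v' : Dir n, σ₀ ≤ σ (cosine v v')) {b : ℝ} (hb : b ≤ σ₀) :
    IsKernel (fun v v' : Dir n => σ (cosine v v') - b) (1 - b) where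
  measurable := (hσ_meas.comp measurable_cosine).sub_const b
  nonneg v v' := by linarith [hσ_lower v v']
  symm v v' := by rw [cosine_comm]
  integrable v := (integrable_kernel hσ_norm v).sub (integrable_const b)
  mass v := by
    rw [integral_sub (integrable_kernel hσ_norm v) (integrable_const b), hσ_norm]
    simp

end Kernel

/-! ### Free transport and its average over path lengths. -/

section Shift

/-- Free transport by path length `t`. -/
def shift (t : ℝ) (z : Pos n × Dir n) : Pos n × Dir n := (z.1 - t • (z.2 : Pos n), z.2)

lemma continuous_shift : Continuous (fun y : ℝ × (Pos n × Dir n) => shift y.1 y.2) := by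
  unfold shift; fun_prop

lemma shift_shift_neg (t : ℝ) (z : Pos n × Dir n) : shift t (shift (-t) z) = z := by
  simp [shift]

lemma shift_zero (z : Pos n × Dir n) : shift 0 z = z := by simp [shift]

/-- For each fixed direction this is a translation of `ℝⁿ`, so it is a skew product over the sphere.
-/
lemma measurePreserving_shift (t : ℝ) :
    MeasurePreserving (shift t) (phaseMeasure n) (phaseMeasure n) := by
  have h1 : MeasurePreserving (fun y : Dir n × Pos n => (y.1, y.2 - t • (y.1 : Pos n)))
      ((dirMeasure n).prod volume) ((dirMeasure n).prod volume) := by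
    refine (MeasurePreserving.id (dirMeasure n)).skew_product
      (g := fun (v : Dir n) (x : Pos n) => x - t • (v : Pos n)) ?_ ?_
    · exact Continuous.measurable (by unfold Function.uncurry; fun_prop)
    · exact ae_of_all _ fun v => (measurePreserving_sub_right volume (t • (v : Pos n))).map_eq
  have h2 := (Measure.measurePreserving_swap (μ := dirMeasure n) (ν := (volume : Measure (Pos n))))
  have h3 := (Measure.measurePreserving_swap (μ := (volume : Measure (Pos n))) (ν := dirMeasure n))
  exact h2.comp (h1.comp h3)

lemma measurePreserving_jointShift (ε : ℝ) (ν : Measure ℝ) [SFinite ν] :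
    MeasurePreserving (fun y : ℝ × (Pos n × Dir n) => (y.1, shift (ε * y.1) y.2))
      (ν.prod (phaseMeasure n)) (ν.prod (phaseMeasure n)) := by
  refine (MeasurePreserving.id ν).skew_product
    (g := fun (s : ℝ) (z : Pos n × Dir n) => shift (ε * s) z) ?_ ?_
  · have : Continuous (fun y : ℝ × (Pos n × Dir n) => shift (ε * y.1) y.2) := by
      unfold shift; fun_prop
    exact this.measurable
  · exact ae_of_all _ fun s => (measurePreserving_shift (ε * s)).map_eq

lemma quasiMeasurePreserving_shift (ε : ℝ) (ν : Measure ℝ) [SFinite ν] :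
    Measure.QuasiMeasurePreserving (fun y : ℝ × (Pos n × Dir n) => shift (ε * y.1) y.2)
      (ν.prod (phaseMeasure n)) (phaseMeasure n) :=
  Measure.quasiMeasurePreserving_snd.comp (measurePreserving_jointShift ε ν).quasiMeasurePreserving

lemma integral_shift (t : ℝ) (F : Pos n × Dir n → ℝ) :
    ∫ z, F (shift t z) ∂phaseMeasure n = ∫ z, F z ∂phaseMeasure n := by
  let e : (Pos n × Dir n) ≃ᵐ (Pos n × Dir n) :=
    { toFun := shift t
      invFun := shift (-t)
      left_inv := fun z => by simpa using shift_shift_neg (-t) z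
      right_inv := shift_shift_neg t
      measurable_toFun := (measurePreserving_shift t).measurable
      measurable_invFun := (measurePreserving_shift (-t)).measurable }
  exact (measurePreserving_shift t).integral_comp e.measurableEmbedding F

variable {P : Measure ℝ} [IsProbabilityMeasure P]

/-- The average of free transport over the path-length law. -/
noncomputable def pathAvg (P : Measure ℝ) (ε : ℝ) (f : Pos n × Dir n → ℝ) (z : Pos n × Dir n) : ℝ :=
  ∫ τ, f (shift (ε * τ) z) ∂P

lemma measurePreserving_shift_prod (ε : ℝ) :
    MeasurePreserving (fun y : (Pos n × Dir n) × ℝ => shift (ε * y.2) y.1)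
      ((phaseMeasure n).prod P) (phaseMeasure n) := by
  have h1 : MeasurePreserving (Prod.snd : ℝ × (Pos n × Dir n) → _)
    (P.prod (phaseMeasure n)) (phaseMeasure n) := measurePreserving_snd
  exact h1.comp ((measurePreserving_jointShift ε P).comp Measure.measurePreserving_swap)

/-- Averaging is a contraction: Cauchy–Schwarz for the probability `P`, then invariance of `dx dv`
under every shift. -/
lemma memLp_pathAvg (ε : ℝ) {f : Pos n × Dir n → ℝ} (hf : MemLp f 2 (phaseMeasure n)) :
    MemLp (pathAvg P ε f) 2 (phaseMeasure n) ∧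
      ∫ z, pathAvg P ε f z ^ 2 ∂phaseMeasure n ≤ ∫ z, f z ^ 2 ∂phaseMeasure n := by
  have hmp := measurePreserving_shift_prod (n := n) (P := P) ε
  have h1 := hf.comp_measurePreserving hmp
  obtain ⟨h2, h3⟩ := memLp_integral_prod h1
  refine ⟨h2, h3.trans (le_of_eq ?_)⟩
  rw [probReal_univ, one_mul]
  have h4 := hmp.map_eq
  conv_rhs => rw [← h4]
  rw [integral_map hmp.measurable.aemeasurable]
  · rfl
  · rw [h4]; exact (hf.1.pow 2)

lemma integrable_shift_mul (ε : ℝ) {f F : Pos n × Dir n → ℝ} (hf : MemLp f 2 (phaseMeasure n))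
    (hF : MemLp F 2 (phaseMeasure n)) :
    Integrable (fun y : (Pos n × Dir n) × ℝ => f (shift (ε * y.2) y.1) * F y.1)
      ((phaseMeasure n).prod P) := by
  have hmp := measurePreserving_shift_prod (n := n) (P := P) ε
  exact (hf.comp_measurePreserving hmp).integrable_mul
    (hF.comp_measurePreserving measurePreserving_fst)

lemma integral_pathAvg_mul (ε : ℝ) {f F : Pos n × Dir n → ℝ} (hf : MemLp f 2 (phaseMeasure n))
    (hF : MemLp F 2 (phaseMeasure n)) :
    ∫ z, pathAvg P ε f z * F z ∂phaseMeasure n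
      = ∫ τ, ∫ z, f z * F (shift (-(ε * τ)) z) ∂phaseMeasure n ∂P := by
  have h1 : ∫ z, pathAvg P ε f z * F z ∂phaseMeasure n
      = ∫ z, ∫ τ, f (shift (ε * τ) z) * F z ∂P ∂phaseMeasure n := by
    simp only [pathAvg, integral_mul_const]
  rw [h1, integral_integral_swap (integrable_shift_mul ε hf hF)]
  congr with τ
  rw [← integral_shift (-(ε * τ))]
  congr with z
  rw [shift_shift_neg]

instance isLocallyFiniteMeasure_phaseMeasure : IsLocallyFiniteMeasure (phaseMeasure n) := by
  unfold phaseMeasure; infer_instance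

/-- Strong continuity of free transport. -/
lemma tendsto_integral_shift_sub_sq {f : Pos n × Dir n → ℝ} (hf : MemLp f 2 (phaseMeasure n)) :
    Tendsto (fun t : ℝ => ∫ z, (f (shift t z) - f z) ^ 2 ∂phaseMeasure n) (𝓝 0) (𝓝 0) := by
  let g : ℝ → C(Pos n × Dir n, Pos n × Dir n) := fun t =>
    ⟨shift t, continuous_shift.comp (by fun_prop : Continuous fun z => (t, z))⟩
  have hg : Continuous g := ContinuousMap.continuous_of_continuous_uncurry _ continuous_shift
  have h1 := (tendsto_const_nhds (x := hf.toLp f) (f := 𝓝 (0 : ℝ))).compMeasurePreservingLp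
    (hg.tendsto 0) (fun t => measurePreserving_shift t) (measurePreserving_shift 0) (by simp)
  have h2 := (tendsto_iff_norm_sub_tendsto_zero.1 h1).pow 2
  simp only [ne_eq, OfNat.ofNat_ne_zero, not_false_eq_true, zero_pow] at h2
  refine h2.congr fun t => ?_
  have h3 := real_inner_self_eq_norm_sq
    (Lp.compMeasurePreserving (g t) (measurePreserving_shift t) (hf.toLp f)
      - Lp.compMeasurePreserving (g 0) (measurePreserving_shift 0) (hf.toLp f))
  rw [← h3, L2.inner_def]
  refine integral_congr_ae ?_
  have ht : ∀ t, (Lp.compMeasurePreserving (g t) (measurePreserving_shift t) (hf.toLp f))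
      =ᵐ[phaseMeasure n] fun z => f (shift t z) := by
    intro t
    refine (Lp.coeFn_compMeasurePreserving _ _).trans ?_
    exact (measurePreserving_shift t).quasiMeasurePreserving.ae_eq_comp hf.coeFn_toLp
  filter_upwards [Lp.coeFn_sub (Lp.compMeasurePreserving (g t) (measurePreserving_shift t)
    (hf.toLp f)) (Lp.compMeasurePreserving (g 0) (measurePreserving_shift 0) (hf.toLp f)),
    ht t, ht 0] with z h4 h5 h6
  rw [h4, Pi.sub_apply, h5, h6, shift_zero]
  simp [sq]

end Shift

end NonclassicalTransport

namespace NonclassicalTransport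

variable {n : ℕ}

/-! ### From the transport equation to the equation for the boundary value. -/

section Reduction

lemma sq_eLpNorm_toReal {X : Type*} [MeasurableSpace X] {μ : Measure X} {f : X → ℝ}
    (hf : MemLp f 2 μ) : (eLpNorm f 2 μ).toReal ^ 2 = ∫ x, f x ^ 2 ∂μ := by
  have h3 := real_inner_self_eq_norm_sq (hf.toLp f)
  rw [Lp.norm_toLp, L2.inner_def] at h3
  rw [← h3]
  refine integral_congr_ae ?_
  filter_upwards [hf.coeFn_toLp] with x hx
  rw [hx]
  simp [sq]

/-- A bound uniform in `s` becomes an `L²` bound under a probability in `s`. Absolute continuity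
carries over null sets and measurability. -/
lemma memLp_uncurry {u : ℝ → Pos n × Dir n → ℝ} (hu : MemLinftyL2 u) {P : Measure ℝ}
    [IsProbabilityMeasure P] (hP : P ≪ pathMeasure) :
    MemLp (fun y : ℝ × (Pos n × Dir n) => u y.1 y.2) 2 (P.prod (phaseMeasure n)) := by
  obtain ⟨hm, M, hM⟩ := hu
  have hm' : AEStronglyMeasurable (fun y : ℝ × (Pos n × Dir n) => u y.1 y.2)
      (P.prod (phaseMeasure n)) := hm.mono_ac (hP.prod Measure.AbsolutelyContinuous.rfl)
  refine memLp_two_real_iff.2 ⟨hm', ?_⟩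
  have hmem : ∀ᵐ s ∂P, MemLp (u s) 2 (phaseMeasure n) ∧ ∫ z, u s z ^ 2 ∂phaseMeasure n ≤ M ^ 2 := by
    filter_upwards [hP.ae_le hM, hm'.prodMk_left] with s h1 h2
    have h3 : MemLp (u s) 2 (phaseMeasure n) := ⟨h2, h1.trans_lt ENNReal.coe_lt_top⟩
    refine ⟨h3, ?_⟩
    rw [← sq_eLpNorm_toReal h3]
    have : (eLpNorm (u s) 2 (phaseMeasure n)).toReal ≤ M := by
      have := ENNReal.toReal_mono ENNReal.coe_ne_top h1
      simpa using this
    gcongr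
  have hsq : AEStronglyMeasurable (fun y : ℝ × (Pos n × Dir n) => u y.1 y.2 ^ 2)
    (P.prod (phaseMeasure n)) := hm'.pow 2
  rw [integrable_prod_iff hsq]
  refine ⟨hmem.mono fun s hs => hs.1.integrable_sq, ?_⟩
  refine Integrable.of_bound hsq.norm.integral_prod_right' (M ^ 2 : ℝ) ?_
  filter_upwards [hmem] with s hs
  have : ∀ z, ‖u s z ^ 2‖ = u s z ^ 2 := fun z => Real.norm_of_nonneg (sq_nonneg _)
  simp only [this]
  rw [Real.norm_of_nonneg (integral_nonneg fun _ => sq_nonneg _)]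
  exact hs.2

lemma ae_ae_section {A : Pos n × Dir n → Prop} (h : ∀ᵐ z ∂phaseMeasure n, A z) :
    ∀ᵐ z ∂phaseMeasure n, ∀ᵐ v' ∂dirMeasure n, A (z.1, v') := by
  have h1 : ∀ᵐ x ∂(volume : Measure (Pos n)), ∀ᵐ v' ∂dirMeasure n, A (x, v') :=
    Measure.ae_ae_of_ae_prod h
  exact Measure.quasiMeasurePreserving_fst.ae h1

lemma kernelOp_congr {k : Dir n → Dir n → ℝ} {f f' : Pos n × Dir n → ℝ}
    (h : f =ᵐ[phaseMeasure n] f') : kernelOp k f =ᵐ[phaseMeasure n] kernelOp k f' := by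
  filter_upwards [ae_ae_section h] with z hz
  refine integral_congr_ae ?_
  filter_upwards [hz] with v' hv
  rw [hv]

variable [NeZero n] {p : ℝ → ℝ} {k : Dir n → Dir n → ℝ} {m : ℝ}

omit [NeZero n] in
/-- Exchange of the path-length and velocity integrals in the collision operator. -/
lemma collision_eq_kernelOp (hp0 : ∀ s, 0 < s → 0 ≤ p s) (hp_one : ∫ s, p s ∂pathMeasure = 1)
    (hp : Integrable p pathMeasure) (hk : IsKernel k m) {u : ℝ → Pos n × Dir n → ℝ}
    (hu : MemLinftyL2 u) :
    MemLp (fun z => ∫ τ, u τ z ∂pathLaw p) 2 (phaseMeasure n) ∧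
    ∀ᵐ z ∂phaseMeasure n,
      ∫ τ, ∫ v', k z.2 v' * p τ * u τ (z.1, v') ∂dirMeasure n ∂pathMeasure
        = kernelOp k (fun z => ∫ τ, u τ z ∂pathLaw p) z := by
  have := isProbabilityMeasure_pathLaw hp0 hp_one
  set P := pathLaw p with hPdef
  have hU := memLp_uncurry hu (pathLaw_absolutelyContinuous p)
  have hU' : MemLp (fun y : (Pos n × Dir n) × ℝ => u y.2 y.1) 2 ((phaseMeasure n).prod P) :=
    hU.comp_measurePreserving Measure.measurePreserving_swap
  refine ⟨(memLp_integral_prod hU').1, ?_⟩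
  obtain ⟨hm, hsq⟩ := memLp_two_real_iff.1 hU'
  -- the function `√∫ u²` is square integrable
  have hW : Integrable (fun z => ∫ τ, u τ z ^ 2 ∂P) (phaseMeasure n) := hsq.integral_prod_left
  have hsW : MemLp (fun z => √(∫ τ, u τ z ^ 2 ∂P)) 2 (phaseMeasure n) := by
    refine memLp_two_real_iff.2 ⟨Real.continuous_sqrt.comp_aestronglyMeasurable hW.1, ?_⟩
    refine hW.congr (ae_of_all _ fun z => ?_)
    exact (Real.sq_sqrt (integral_nonneg fun _ => sq_nonneg _)).symm
  -- The kernel bound for `√∫u²` shows that `∫∫ k u²` is finite for almost every `z`. Weighted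
  -- Cauchy–Schwarz then gives the integrability of `k u` that Fubini requires, although `k` may be
  -- unbounded.
  have h1 := hk.ae_integrable_sq hsW
  have h2 := ae_ae_section hsq.prod_right_ae
  have h3 : ∀ᵐ z ∂phaseMeasure n, AEStronglyMeasurable
      (fun y : Dir n × ℝ => u y.2 (z.1, y.1)) ((dirMeasure n).prod P) := by
    have h4 := hm.comp_measurePreserving
      ((measurePreserving_prodAssoc (volume : Measure (Pos n)) (dirMeasure n) P).symm)
    exact Measure.quasiMeasurePreserving_fst.ae h4.prodMk_left
  filter_upwards [h1, h2, h3] with z h1 h2 h3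
  have hkm : Measurable (k z.2) := hk.measurable.comp measurable_prodMk_left
  have hkI : Integrable (fun y : Dir n × ℝ => k z.2 y.1) ((dirMeasure n).prod P) :=
    (hk.integrable z.2).comp_fst P
  have hI2 : Integrable (fun y : Dir n × ℝ => k z.2 y.1 * u y.2 (z.1, y.1) ^ 2)
      ((dirMeasure n).prod P) := by
    have hm2 : AEStronglyMeasurable (fun y : Dir n × ℝ => k z.2 y.1 * u y.2 (z.1, y.1) ^ 2)
        ((dirMeasure n).prod P) := hkI.1.mul (h3.pow 2)
    rw [integrable_prod_iff hm2]
    have h2' : ∀ᵐ v' ∂dirMeasure n, Integrable (fun τ => k z.2 v' * u τ (z.1, v') ^ 2) P :=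
      h2.mono fun v hv => hv.const_mul (k z.2 v)
    refine ⟨h2', ?_⟩
    refine h1.congr (ae_of_all _ fun v => ?_)
    simp only
    rw [Real.sq_sqrt (integral_nonneg fun _ => sq_nonneg _), ← integral_const_mul]
    congr with τ
    rw [Real.norm_of_nonneg (mul_nonneg (hk.nonneg _ _) (sq_nonneg _))]
  have hI : Integrable (fun y : Dir n × ℝ => k z.2 y.1 * u y.2 (z.1, y.1))
      ((dirMeasure n).prod P) :=
    integrable_weight_mul hkI (fun _ => hk.nonneg _ _) h3 hI2
  have h5 : ∫ τ, ∫ v', k z.2 v' * p τ * u τ (z.1, v') ∂dirMeasure n ∂pathMeasure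
      = ∫ τ, ∫ v', k z.2 v' * u τ (z.1, v') ∂dirMeasure n ∂P := by
    rw [hPdef, integral_pathLaw hp0 hp.aemeasurable]
    congr with τ
    rw [smul_eq_mul, ← integral_const_mul]
    congr with v'
    ring
  rw [h5, ← integral_integral_swap hI]
  simp only [kernelOp, integral_const_mul]

variable {σ : ℝ → ℝ} {σ₀ c : ℝ} {Q : Pos n × Dir n → ℝ}

omit [NeZero n] in
lemma memLinftyL2_shift {g : Pos n × Dir n → ℝ} (hg : MemLp g 2 (phaseMeasure n)) (ε : ℝ) :
    MemLinftyL2 (fun s z => g (shift (ε * s) z)) := by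
  refine ⟨hg.1.comp_quasiMeasurePreserving (quasiMeasurePreserving_shift ε pathMeasure),
    (eLpNorm g 2 (phaseMeasure n)).toNNReal, ae_of_all _ fun s => ?_⟩
  rw [ENNReal.coe_toNNReal hg.2.ne]
  exact (eLpNorm_comp_measurePreserving hg.1 (measurePreserving_shift _)).le

/-- The reduced equation for the boundary value `g` of a transport solution. -/
structure IsReduced (P : Measure ℝ) (k : Dir n → Dir n → ℝ) (Q : Pos n × Dir n → ℝ) (ε θ : ℝ)
    (g : Pos n × Dir n → ℝ) : Prop where
  memLp : MemLp g 2 (phaseMeasure n)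
  eq : ∀ᵐ z ∂phaseMeasure n, g z = kernelOp k (pathAvg P ε g) z + θ * Q z

omit [NeZero n] in
/-- The path-length average of a function that is almost everywhere transported. -/
lemma integral_eq_pathAvg {P : Measure ℝ} [IsProbabilityMeasure P] (hP : P ≪ pathMeasure)
    {u : ℝ → Pos n × Dir n → ℝ} {g : Pos n × Dir n → ℝ} {ε : ℝ}
    (h : ∀ᵐ y ∂pathMeasure.prod (phaseMeasure n), u y.1 y.2 = g (shift (ε * y.1) y.2)) :
    (fun z => ∫ τ, u τ z ∂P) =ᵐ[phaseMeasure n] pathAvg P ε g := by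
  have h1 : ∀ᵐ y ∂P.prod (phaseMeasure n), u y.1 y.2 = g (shift (ε * y.1) y.2) :=
    (hP.prod Measure.AbsolutelyContinuous.rfl).ae_le h
  have h2 : ∀ᵐ y ∂(phaseMeasure n).prod P, u y.2 y.1 = g (shift (ε * y.2) y.1) :=
    Measure.measurePreserving_swap.quasiMeasurePreserving.ae h1
  filter_upwards [Measure.ae_ae_of_ae_prod h2] with z hz using integral_congr_ae hz

/-- The right side of the transport equation depends on `(s,x,v)` only through the point `(x - εsv,
v)`, so `u` is transported from `g = K f + θQ`, with `f` the path-length average of `u`. Inserting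
`u = g ∘ shift` gives `f = A_ε g` and closes the equation. -/
lemma exists_reduced (hp0 : ∀ s, 0 < s → 0 ≤ p s) (hp_one : ∫ s, p s ∂pathMeasure = 1)
    (hp : Integrable p pathMeasure) (hσ_meas : Measurable σ)
    (hσ_norm : ∀ v : Dir n, ∫ v', σ (cosine v v') ∂dirMeasure n = 1) (hσ₀ : 0 < σ₀)
    (hσ_lower : ∀ v v' : Dir n, σ₀ ≤ σ (cosine v v'))
    (hQ2 : MemLp Q 2 (phaseMeasure n)) {ε θ : ℝ} (hθ : θ * (1 - c) ≤ σ₀)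
    {u : ℝ → Pos n × Dir n → ℝ} (hu : IsTransportSolution σ c p Q ε θ u) :
    ∃ g, IsReduced (pathLaw p) (fun v v' => σ (cosine v v') - θ * (1 - c)) Q ε θ g ∧
      (∀ᵐ y ∂pathMeasure.prod (phaseMeasure n), u y.1 y.2 = g (shift (ε * y.1) y.2)) ∧
      (∀ᵐ z ∂phaseMeasure n, scatteredAverage σ p u z
        = kernelOp (fun v v' => σ (cosine v v') - 0) (pathAvg (pathLaw p) ε g) z) := by
  have := isProbabilityMeasure_pathLaw hp0 hp_one
  obtain ⟨hu1, hu2⟩ := hu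
  have hk := isKernel_sub hσ_meas hσ_norm hσ_lower hθ
  -- The average `φ` uses the unperturbed kernel, written `σ - 0` so that it is the case `b = 0` of
  -- the same family.
  have hk0 := isKernel_sub hσ_meas hσ_norm hσ_lower hσ₀.le
  obtain ⟨hf, hcol⟩ := collision_eq_kernelOp hp0 hp_one hp hk hu1
  obtain ⟨-, hcol0⟩ := collision_eq_kernelOp hp0 hp_one hp hk0 hu1
  set f : Pos n × Dir n → ℝ := fun z => ∫ τ, u τ z ∂pathLaw p with hfdef
  set g : Pos n × Dir n → ℝ := fun z =>
    kernelOp (fun v v' => σ (cosine v v') - θ * (1 - c)) f z + θ * Q z with hgdef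
  have hg : MemLp g 2 (phaseMeasure n) := (hk.memLp_kernelOp hf).1.add (hQ2.const_mul θ)
  have hug : ∀ᵐ y ∂pathMeasure.prod (phaseMeasure n), u y.1 y.2 = g (shift (ε * y.1) y.2) := by
    filter_upwards [hu2, (quasiMeasurePreserving_shift ε pathMeasure).ae hcol] with y h1 h2
    rw [h1, hgdef]
    simp only
    rw [← h2]
    rfl
  have hfg : f =ᵐ[phaseMeasure n] pathAvg (pathLaw p) ε g :=
    integral_eq_pathAvg (pathLaw_absolutelyContinuous p) hug
  refine ⟨g, ⟨hg, ?_⟩, hug, ?_⟩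
  · filter_upwards [kernelOp_congr (k := fun v v' => σ (cosine v v') - θ * (1 - c)) hfg] with z hz
    rw [hgdef, ← hz]
  · filter_upwards [kernelOp_congr (k := fun v v' => σ (cosine v v') - 0) hfg, hcol0] with z h1 h2
    rw [← h1, ← h2]
    simp only [scatteredAverage, sub_zero]

end Reduction

end NonclassicalTransport

namespace NonclassicalTransport

variable {n : ℕ}

/-! ### Elementary `L²` inequalities written with integrals of squares. -/

section L2norm

variable {X : Type*} [MeasurableSpace X] {μ : Measure X} {f g : X → ℝ}

lemma integrable_mul_of_memLp (hf : MemLp f 2 μ) (hg : MemLp g 2 μ) :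
    Integrable (fun x => f x * g x) μ := hf.integrable_mul hg

lemma integral_sq_add (hf : MemLp f 2 μ) (hg : MemLp g 2 μ) :
    ∫ x, (f x + g x) ^ 2 ∂μ = ∫ x, f x ^ 2 ∂μ + 2 * ∫ x, f x * g x ∂μ + ∫ x, g x ^ 2 ∂μ := by
  have h1 := integrable_mul_of_memLp hf hg
  have h2 : Integrable (fun x => f x ^ 2 + 2 * (f x * g x)) μ :=
    hf.integrable_sq.add (h1.const_mul 2)
  have h3 : ∀ x, (f x + g x) ^ 2 = f x ^ 2 + 2 * (f x * g x) + g x ^ 2 := fun x => by ring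
  simp_rw [h3]
  rw [integral_add h2 hg.integrable_sq, integral_add hf.integrable_sq (h1.const_mul 2),
    integral_const_mul]

lemma abs_integral_mul_le (hf : MemLp f 2 μ) (hg : MemLp g 2 μ) :
    |∫ x, f x * g x ∂μ| ≤ √(∫ x, f x ^ 2 ∂μ) * √(∫ x, g x ^ 2 ∂μ) := by
  have h1 := abs_real_inner_le_norm (hf.toLp f) (hg.toLp g)
  have h2 : ∀ {f : X → ℝ} (hf : MemLp f 2 μ), ‖hf.toLp f‖ = √(∫ x, f x ^ 2 ∂μ) := by
    intro f hf
    rw [Lp.norm_toLp, ← sq_eLpNorm_toReal hf, Real.sqrt_sq ENNReal.toReal_nonneg]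
  rw [h2, h2, L2.inner_def] at h1
  refine le_trans (le_of_eq ?_) h1
  congr 1
  refine integral_congr_ae ?_
  filter_upwards [hf.coeFn_toLp, hg.coeFn_toLp] with x h3 h4
  rw [h3, h4]
  simp [mul_comm]

lemma sqrt_integral_sq_add_le (hf : MemLp f 2 μ) (hg : MemLp g 2 μ) :
    √(∫ x, (f x + g x) ^ 2 ∂μ) ≤ √(∫ x, f x ^ 2 ∂μ) + √(∫ x, g x ^ 2 ∂μ) := by
  have hf0 : 0 ≤ ∫ x, f x ^ 2 ∂μ := integral_nonneg fun _ => sq_nonneg _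
  have hg0 : 0 ≤ ∫ x, g x ^ 2 ∂μ := integral_nonneg fun _ => sq_nonneg _
  refine Real.sqrt_le_iff.2 ⟨by positivity, ?_⟩
  rw [integral_sq_add hf hg, add_sq, Real.sq_sqrt hf0, Real.sq_sqrt hg0]
  have := (le_abs_self _).trans (abs_integral_mul_le hf hg)
  linarith

lemma integral_sq_const_mul (a : ℝ) : ∫ x, (a * f x) ^ 2 ∂μ = a ^ 2 * ∫ x, f x ^ 2 ∂μ := by
  rw [← integral_const_mul]; congr with x; ring

lemma integral_sq_add_le (hf : MemLp f 2 μ) (hg : MemLp g 2 μ) :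
    ∫ x, (f x + g x) ^ 2 ∂μ ≤ 2 * ∫ x, f x ^ 2 ∂μ + 2 * ∫ x, g x ^ 2 ∂μ := by
  rw [← integral_const_mul, ← integral_const_mul,
    ← integral_add (hf.integrable_sq.const_mul 2) (hg.integrable_sq.const_mul 2)]
  refine integral_mono (hf.add hg).integrable_sq
    ((hf.integrable_sq.const_mul 2).add (hg.integrable_sq.const_mul 2)) fun x => ?_
  simp only
  nlinarith [sq_nonneg (f x - g x)]

end L2norm

/-! ### Uniform bounds for the reduced equation. -/

section Estimates

variable [NeZero n] {k k' : Dir n → Dir n → ℝ} {m m' : ℝ} {f h : Pos n × Dir n → ℝ}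

lemma IsKernel.kernelOp_sub (hk : IsKernel k m) (hf : MemLp f 2 (phaseMeasure n))
    (hh : MemLp h 2 (phaseMeasure n)) :
    ∀ᵐ z ∂phaseMeasure n, kernelOp k (fun z => f z - h z) z = kernelOp k f z - kernelOp k h z := by
  filter_upwards [hk.ae_integrable hf, hk.ae_integrable hh] with z h1 h2
  rw [kernelOp, kernelOp, kernelOp, ← integral_sub h1 h2]
  congr with v
  ring

omit [NeZero n] in
lemma IsKernel.kernelOp_fst (hk : IsKernel k m) (ρ : Pos n → ℝ) (z : Pos n × Dir n) :
    kernelOp k (fun z => ρ z.1) z = m * ρ z.1 := by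
  simp only [kernelOp]
  rw [integral_mul_const, hk.mass]

/-- On functions of zero velocity average, a constant may be added to the kernel. -/
lemma IsKernel.kernelOp_eq_of_sub_const (hk : IsKernel k m) {b : ℝ}
    (hkk : ∀ v v', k' v v' = k v v' + b) (hf : MemLp f 2 (phaseMeasure n)) :
    ∀ᵐ z ∂phaseMeasure n, kernelOp k' f z = kernelOp k f z + b * velAvg f z.1 := by
  filter_upwards [hk.ae_integrable hf, isKernel_one.ae_integrable hf] with z h1 h2
  simp only [one_mul] at h2
  rw [kernelOp, kernelOp, velAvg, ← integral_const_mul, ← integral_add h1 (h2.const_mul b)]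
  congr with v
  rw [hkk]; ring

lemma velAvg_sub_velAvg (hf : MemLp f 2 (phaseMeasure n)) :
    ∀ᵐ z ∂phaseMeasure n, velAvg (fun z => f z - velAvg f z.1) z.1 = 0 := by
  filter_upwards [isKernel_one.kernelOp_sub hf (memLp_fst (memLp_velAvg hf).1)] with z hz
  rw [isKernel_one.kernelOp_fst (velAvg f)] at hz
  simp only [kernelOp_one] at hz
  rw [hz]; ring

/-- `∫ F(x) f(x,v) = ∫ F(x) (∫ f(x,v) dv)`. -/
lemma integral_fst_mul {F : Pos n → ℝ} (hF : MemLp F 2 volume) (hf : MemLp f 2 (phaseMeasure n)) :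
    ∫ z, F z.1 * f z ∂phaseMeasure n = ∫ x, F x * velAvg f x := by
  rw [phaseMeasure, integral_prod _ (integrable_mul_of_memLp (memLp_fst hF) hf)]
  simp only [integral_const_mul, velAvg]

/-- Functions of position are orthogonal to functions of zero velocity mean. -/
lemma integral_velAvg_mul_sub (hf : MemLp f 2 (phaseMeasure n)) {F : Pos n → ℝ}
    (hF : MemLp F 2 volume) :
    ∫ z, F z.1 * (f z - velAvg f z.1) ∂phaseMeasure n = 0 := by
  have h := isKernel_one.integral_kernelOp_mul (memLp_fst (n := n) hF)
    (hf.sub (memLp_fst (memLp_velAvg hf).1))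
  simp only [isKernel_one.kernelOp_fst, one_mul, kernelOp_one] at h
  refine h.trans (integral_eq_zero_of_ae ?_)
  filter_upwards [velAvg_sub_velAvg hf] with z hz
  have : velAvg (f - fun z => velAvg f z.1) z.1 = 0 := hz
  rw [this, mul_zero]; rfl

variable {σ : ℝ → ℝ} {σ₀ c : ℝ} {Q : Pos n × Dir n → ℝ} {P : Measure ℝ} [IsProbabilityMeasure P]

set_option maxHeartbeats 800000 in
/-- A priori bounds, uniform in the scaling parameter: the solution of the reduced equation is
bounded, and is within `O(√θ)` of a function of position. -/
lemma IsReduced.estimates (hc1 : c < 1) (hσ_meas : Measurable σ)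
    (hσ_norm : ∀ v : Dir n, ∫ v', σ (cosine v v') ∂dirMeasure n = 1) (hσ₀ : 0 < σ₀)
    (hσ_lower : ∀ v v' : Dir n, σ₀ ≤ σ (cosine v v')) (hQ : MemLp Q 2 (phaseMeasure n)) :
    ∃ C : ℝ, 0 ≤ C ∧ ∀ (ε θ : ℝ) (g : Pos n × Dir n → ℝ), 0 < θ → θ ≤ 1 → θ * (1 - c) ≤ σ₀ →
      IsReduced P (fun v v' => σ (cosine v v') - θ * (1 - c)) Q ε θ g →
      ∫ z, g z ^ 2 ∂phaseMeasure n ≤ C ∧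
      MemLp (fun x => (1 - θ * (1 - c)) * velAvg (pathAvg P ε g) x) 2 volume ∧
      ∫ x, ((1 - θ * (1 - c)) * velAvg (pathAvg P ε g) x) ^ 2 ≤ C ∧
      ∫ z, (g z - (1 - θ * (1 - c)) * velAvg (pathAvg P ε g) z.1) ^ 2 ∂phaseMeasure n ≤ C * θ := by
  have hσ₁ : σ₀ ≤ 1 := lower_le_one hσ_lower hσ_norm
  have hs : (1 - σ₀) ^ 2 ≤ 1 - σ₀ := by
    linarith [mul_nonneg hσ₀.le (sub_nonneg.2 hσ₁), sq σ₀, sub_sq 1 σ₀]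
  set q : ℝ := √(∫ z, Q z ^ 2 ∂phaseMeasure n) with hqdef
  have hq0 : 0 ≤ q := Real.sqrt_nonneg _
  have hqq : ∫ z, Q z ^ 2 ∂phaseMeasure n = q ^ 2 :=
    (Real.sq_sqrt (integral_nonneg fun _ => sq_nonneg _)).symm
  set G : ℝ := q / (1 - c) with hG
  have hc2 : 0 < 1 - c := by linarith
  have hG0 : 0 ≤ G := by positivity
  -- `G` bounds `‖g‖`. The fraction over `σ₀` bounds `‖f - velAvg f‖²/θ`. The doubling and `2q²`
  -- come from adding the source `θQ` with `(x+y)² ≤ 2x² + 2y²`.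
  refine ⟨G ^ 2 + (2 * ((2 * G * q + q ^ 2) / σ₀) + 2 * q ^ 2), by positivity, ?_⟩
  intro ε θ g hθ hθ1 hθσ hg
  obtain ⟨hgL, hge⟩ := hg
  set κ : ℝ := 1 - θ * (1 - c) with hκ
  have hθ2 : θ ^ 2 ≤ θ := by rw [sq]; exact mul_le_of_le_one_left hθ.le hθ1
  have hκ0 : 0 ≤ κ := by linarith
  have hκ1 : κ ≤ 1 := by
    have := mul_nonneg hθ.le (sub_nonneg.2 hc1.le)
    linarith
  have hk := isKernel_sub hσ_meas hσ_norm hσ_lower hθσ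
  have hk0 := isKernel_sub hσ_meas hσ_norm hσ_lower le_rfl
  set f := pathAvg P ε g with hfdef
  obtain ⟨hf, hfle⟩ := memLp_pathAvg (P := P) ε hgL
  rw [← hfdef] at hf hfle
  obtain ⟨hρ, hρle⟩ := memLp_velAvg hf
  have hρ' : MemLp (fun z : Pos n × Dir n => velAvg f z.1) 2 (phaseMeasure n) := memLp_fst hρ
  have hw : MemLp (fun z => f z - velAvg f z.1) 2 (phaseMeasure n) := hf.sub hρ'
  set w := fun z => f z - velAvg f z.1 with hwdef
  obtain ⟨hKf, hKfle⟩ := hk.memLp_kernelOp hf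
  obtain ⟨hKw, hKwle⟩ := hk0.memLp_kernelOp hw
  set K := fun v v' : Dir n => σ (cosine v v') - θ * (1 - c)
  set K₀ := fun v v' : Dir n => σ (cosine v v') - σ₀
  -- the bound on `g`
  have hg1 : ∫ z, g z ^ 2 ∂phaseMeasure n
      = ∫ z, (kernelOp K f z + θ * Q z) ^ 2 ∂phaseMeasure n := by
    refine integral_congr_ae ?_
    filter_upwards [hge] with z hz
    rw [hz]
  set A : ℝ := ∫ z, g z ^ 2 ∂phaseMeasure n with hA
  have hA0 : 0 ≤ A := integral_nonneg fun _ => sq_nonneg _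
  have hKfA : √(∫ z, kernelOp K f z ^ 2 ∂phaseMeasure n) ≤ κ * √A := by
    rw [← Real.sqrt_sq hκ0, ← Real.sqrt_mul (sq_nonneg κ)]
    refine Real.sqrt_le_sqrt (hKfle.trans ?_)
    exact mul_le_mul_of_nonneg_left hfle (sq_nonneg κ)
  -- From `‖g‖ ≤ κ‖g‖ + θq`, where `1 - κ = θ(1-c)`: the factor `θ` cancels and the bound is
  -- uniform.
  have hgG : √A ≤ G := by
    have h1 := sqrt_integral_sq_add_le hKf (hQ.const_mul θ)
    rw [← hg1, integral_sq_const_mul, Real.sqrt_mul (sq_nonneg θ), Real.sqrt_sq hθ.le] at h1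
    have h2 : √A ≤ κ * √A + θ * q := h1.trans (by gcongr)
    rw [hG, le_div_iff₀ hc2]
    have h3 : θ * (√A * (1 - c)) ≤ θ * q := by rw [hκ] at h2; linarith
    exact le_of_mul_le_mul_left h3 hθ
  have hAG : A ≤ G ^ 2 := by
    rw [← Real.sq_sqrt hA0]; gcongr
  -- splitting of `K f`
  have hsplit : ∀ᵐ z ∂phaseMeasure n, kernelOp K f z = κ * velAvg f z.1 + kernelOp K₀ w z := by
    have hb : ∀ v v', K v v' = K₀ v v' + (σ₀ - θ * (1 - c)) := fun v v' => by
      simp only [K, K₀]; ring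
    filter_upwards [hk.kernelOp_sub hf hρ', hk0.kernelOp_eq_of_sub_const hb hw,
      velAvg_sub_velAvg hf] with z h1 h2 h3
    rw [hk.kernelOp_fst (velAvg f)] at h1
    have h3' : velAvg w z.1 = 0 := h3
    rw [h3', mul_zero, add_zero] at h2
    rw [← h2, hwdef, h1]
    ring
  have hκρ : MemLp (fun x => κ * velAvg f x) 2 volume := hρ.const_mul κ
  -- `K₀` is symmetric and multiplies functions of position by a constant, so it moves onto the
  -- first factor, which is orthogonal to `w`.
  have hortho : ∫ z, (κ * velAvg f z.1) * kernelOp K₀ w z ∂phaseMeasure n = 0 := by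
    rw [← hk0.integral_kernelOp_mul (memLp_fst hκρ) hw]
    simp only [hk0.kernelOp_fst (fun x => κ * velAvg f x), mul_assoc]
    have := integral_velAvg_mul_sub hf (hκρ.const_mul (1 - σ₀))
    simpa only [mul_assoc] using this
  have hKf2 : ∫ z, kernelOp K f z ^ 2 ∂phaseMeasure n
      = κ ^ 2 * (∫ x, velAvg f x ^ 2) + ∫ z, kernelOp K₀ w z ^ 2 ∂phaseMeasure n := by
    have h1 : ∫ z, kernelOp K f z ^ 2 ∂phaseMeasure n
        = ∫ z, (κ * velAvg f z.1 + kernelOp K₀ w z) ^ 2 ∂phaseMeasure n := by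
      refine integral_congr_ae ?_
      filter_upwards [hsplit] with z hz
      rw [hz]
    rw [h1, integral_sq_add (memLp_fst hκρ) hKw, hortho, integral_sq_const_mul, mul_zero, add_zero]
    congr 2
    simp only [sq]
    rw [integral_fst_mul hρ hρ']
    simp [velAvg]
  have hf2 : ∫ z, f z ^ 2 ∂phaseMeasure n
      = (∫ x, velAvg f x ^ 2) + ∫ z, w z ^ 2 ∂phaseMeasure n := by
    have h1 := integral_sq_add hρ' hw
    have h2 : ∀ z : Pos n × Dir n, velAvg f z.1 + w z = f z := fun z => by simp [hwdef]
    simp only [h2] at h1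
    rw [h1, integral_velAvg_mul_sub hf hρ, mul_zero, add_zero]
    congr 1
    simp only [sq]
    rw [integral_fst_mul hρ hρ']
    simp [velAvg]
  set R : ℝ := ∫ x, velAvg f x ^ 2 with hR
  have hR0 : 0 ≤ R := integral_nonneg fun _ => sq_nonneg _
  set W : ℝ := ∫ z, w z ^ 2 ∂phaseMeasure n with hW
  have hW0 : 0 ≤ W := integral_nonneg fun _ => sq_nonneg _
  -- Contraction of the path average gives `R + W ≤ A`, while the equation gives `A ≤ κ²R + (1-σ₀)²W
  -- + 2Gqθ + q²θ²`. Subtracting leaves `σ₀W` bounded by a multiple of `θ`; this is where `σ ≥ σ₀`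
  -- acts as a spectral gap.
  have hWle : W ≤ (2 * G * q + q ^ 2) / σ₀ * θ := by
    have h1 := integral_sq_add hKf (hQ.const_mul θ)
    rw [← hg1, integral_sq_const_mul, hqq, hKf2] at h1
    have h2 := (le_abs_self _).trans (abs_integral_mul_le hKf (hQ.const_mul θ))
    rw [integral_sq_const_mul, Real.sqrt_mul (sq_nonneg θ), Real.sqrt_sq hθ.le] at h2
    have h3 : √(∫ z, kernelOp K f z ^ 2 ∂phaseMeasure n) * (θ * q) ≤ G * (θ * q) := by
      refine mul_le_mul_of_nonneg_right (hKfA.trans ?_) (by positivity)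
      exact (mul_le_of_le_one_left (Real.sqrt_nonneg A) hκ1).trans hgG
    have h4 : κ ^ 2 * R ≤ 1 * R := mul_le_mul_of_nonneg_right (pow_le_one₀ hκ0 hκ1) hR0
    have h5 : θ ^ 2 * q ^ 2 ≤ θ * q ^ 2 := by
      exact mul_le_mul_of_nonneg_right hθ2 (sq_nonneg q)
    have h6 : (1 - σ₀) ^ 2 * W ≤ (1 - σ₀) * W := mul_le_mul_of_nonneg_right hs hW0
    rw [div_mul_eq_mul_div, le_div_iff₀ hσ₀]
    linarith
  have hr : ∀ᵐ z ∂phaseMeasure n, g z - κ * velAvg f z.1 = kernelOp K₀ w z + θ * Q z := by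
    filter_upwards [hge, hsplit] with z h1 h2
    rw [h1, h2]; ring
  refine ⟨hAG.trans (le_add_of_nonneg_right (by positivity)), hκρ, ?_, ?_⟩
  · rw [integral_sq_const_mul]
    have h1 : κ ^ 2 * R ≤ 1 * R :=
      mul_le_mul_of_nonneg_right (pow_le_one₀ hκ0 hκ1) hR0
    refine le_trans ?_ (le_add_of_nonneg_right (by positivity))
    linarith
  · have h1 : ∫ z, (g z - κ * velAvg f z.1) ^ 2 ∂phaseMeasure n
        = ∫ z, (kernelOp K₀ w z + θ * Q z) ^ 2 ∂phaseMeasure n := by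
      refine integral_congr_ae ?_
      filter_upwards [hr] with z hz
      rw [hz]
    rw [h1]
    refine (integral_sq_add_le hKw (hQ.const_mul θ)).trans ?_
    rw [integral_sq_const_mul, hqq]
    have h2 : (1 - σ₀) ^ 2 * W ≤ 1 * W :=
      mul_le_mul_of_nonneg_right (by linarith) hW0
    have h5 : θ ^ 2 * q ^ 2 ≤ θ * q ^ 2 := by
      exact mul_le_mul_of_nonneg_right hθ2 (sq_nonneg q)
    have h6 : 0 ≤ G ^ 2 * θ := by positivity
    linarith

end Estimates

end NonclassicalTransport

namespace NonclassicalTransport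

variable {n : ℕ}

/-! ### Plancherel for explicit inverse Fourier integrals, and products with Schwartz functions. -/

section Plancherel

open scoped SchwartzMap LineDeriv
open Complex (I)

variable {E : Type*} [NormedAddCommGroup E] [InnerProductSpace ℝ E] [FiniteDimensional ℝ E]
  [MeasurableSpace E] [BorelSpace E]

lemma continuous_fourierInv {h : E → ℂ} (hh : Integrable h) : Continuous (𝓕⁻ h) :=
  VectorFourier.fourierIntegral_continuous (L := -innerₗ E) Real.continuous_fourierChar
    (by simp only [LinearMap.neg_apply, innerₗ_apply_apply]; fun_prop) hh

/-- The inverse Fourier integral and the `L²` inverse Fourier transform agree on `L¹ ∩ L²`. -/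
lemma fourierInv_toLp_ae_eq {h : E → ℂ} (hh : Integrable h) (hh2 : MemLp h 2 volume) :
    (𝓕⁻ (hh2.toLp h) : Lp ℂ 2 (volume : Measure E)) =ᵐ[volume] 𝓕⁻ h := by
  have h1 : LocallyIntegrable (𝓕⁻ (hh2.toLp h) : Lp ℂ 2 (volume : Measure E)) volume :=
    (Lp.memLp _).locallyIntegrable (by norm_num)
  have h2 : LocallyIntegrable (𝓕⁻ h) volume := (continuous_fourierInv hh).locallyIntegrable
  -- Both sides are tested against smooth bumps: the `L²` transform is known through tempered
  -- distributions, the integral through Fubini, and each moves the transform onto the bump.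
  refine ae_eq_of_integral_contDiff_smul_eq h1 h2 fun χ hχ hχc => ?_
  have hχc' : HasCompactSupport (fun x => (χ x : ℂ)) := hχc.comp_left Complex.ofReal_zero
  have hχ' : ContDiff ℝ ∞ (fun x => (χ x : ℂ)) := Complex.ofRealCLM.contDiff.comp hχ
  set X : 𝓢(E, ℂ) := hχc'.toSchwartzMap hχ' with hX
  have e1 : ∫ x, χ x • (𝓕⁻ (hh2.toLp h) : Lp ℂ 2 (volume : Measure E)) x
      = ∫ x, 𝓕⁻ X x • h x := by
    have e2 := congrArg (fun T => T X) (Lp.fourierInv_toTemperedDistribution_eq (hh2.toLp h))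
    simp only [TemperedDistribution.fourierInv_apply, Lp.toTemperedDistribution_apply] at e2
    rw [← integral_congr_ae (hh2.coeFn_toLp.mono fun x hx => by rw [hx])] at e2
    rw [e2]
    rfl
  have e3 : ∫ x, χ x • 𝓕⁻ h x = ∫ x, 𝓕⁻ X x • h x := by
    have e4 := VectorFourier.integral_fourierIntegral_smul_eq_flip (L := -innerₗ E)
      (μ := volume) (ν := volume) (f := (X : E → ℂ)) (g := h) Real.continuous_fourierChar
      (by simp only [LinearMap.neg_apply, innerₗ_apply_apply]; fun_prop) X.integrable hh
    have e5 : (-innerₗ E).flip = -innerₗ E := by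
      ext x y; simp [real_inner_comm]
    rw [e5] at e4
    rw [SchwartzMap.fourierInv_coe]
    exact e4.symm
  rw [e1, e3]

lemma memLp_fourierInv {h : E → ℂ} (hh : Integrable h) (hh2 : MemLp h 2 volume) :
    MemLp (𝓕⁻ h) 2 volume := (memLp_congr_ae (fourierInv_toLp_ae_eq hh hh2)).1 (Lp.memLp _)

lemma integral_norm_sq_eq {X : Type*} [MeasurableSpace X] {μ : Measure X} {f : X → ℂ}
    (hf : MemLp f 2 μ) : ∫ x, ‖f x‖ ^ 2 ∂μ = ‖hf.toLp f‖ ^ 2 := by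
  have h3 := inner_self_eq_norm_sq_to_K (𝕜 := ℂ) (hf.toLp f)
  rw [L2.inner_def] at h3
  have h4 : ∫ x, inner ℂ (hf.toLp f x) (hf.toLp f x) ∂μ = ((∫ x, ‖f x‖ ^ 2 ∂μ : ℝ) : ℂ) := by
    rw [← integral_complex_ofReal]
    refine integral_congr_ae ?_
    filter_upwards [hf.coeFn_toLp] with x hx
    rw [hx, inner_self_eq_norm_sq_to_K]
    simp
  refine Complex.ofReal_injective (h4.symm.trans (h3.trans ?_))
  simp

lemma integral_norm_sq_fourierInv {h : E → ℂ} (hh : Integrable h) (hh2 : MemLp h 2 volume) :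
    ∫ x, ‖𝓕⁻ h x‖ ^ 2 = ∫ x, ‖h x‖ ^ 2 := by
  have h1 : (memLp_fourierInv hh hh2).toLp _ = (𝓕⁻ (hh2.toLp h) : Lp ℂ 2 (volume : Measure E)) :=
    Lp.ext ((MemLp.coeFn_toLp _).trans (fourierInv_toLp_ae_eq hh hh2).symm)
  rw [integral_norm_sq_eq (memLp_fourierInv hh hh2), integral_norm_sq_eq hh2, h1,
    ← Lp.norm_fourier_eq, FourierTransform.fourier_fourierInv_eq]

/-- The complexification of a real Schwartz function. -/
noncomputable def cplx (φ : 𝓢(E, ℝ)) : 𝓢(E, ℂ) := φ.postcompCLM Complex.ofRealCLM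

/-- The squared norm of `(1 + ‖ξ‖²) χ`. -/
noncomputable def weightSq (χ : 𝓢(E, ℂ)) : ℝ := ∫ ξ, ((1 + ‖ξ‖ ^ 2) * ‖χ ξ‖) ^ 2

variable (χ : 𝓢(E, ℂ))

lemma integrable_weight : Integrable (fun ξ => (1 + ‖ξ‖ ^ 2) * ‖χ ξ‖) := by
  have h := (χ.integrable_pow_mul volume 0).add (χ.integrable_pow_mul volume 2)
  refine h.congr (ae_of_all _ fun ξ => ?_)
  simp only [Pi.add_apply]
  ring

lemma integrable_weight_sq : Integrable (fun ξ => ((1 + ‖ξ‖ ^ 2) * ‖χ ξ‖) ^ 2) := by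
  have h := ((χ.integrable_pow_mul volume 0).add (((χ.integrable_pow_mul volume 2).const_mul 2).add
    (χ.integrable_pow_mul volume 4))).const_mul (SchwartzMap.seminorm ℝ 0 0 χ)
  have hc : Continuous (fun ξ => ((1 + ‖ξ‖ ^ 2) * ‖χ ξ‖) ^ 2) := by
    have := χ.continuous
    fun_prop
  refine h.mono' hc.aestronglyMeasurable (ae_of_all _ fun ξ => ?_)
  rw [Real.norm_of_nonneg (sq_nonneg _)]
  have h1 := SchwartzMap.norm_le_seminorm ℝ χ ξ
  simp only [Pi.add_apply]
  have h2 : 0 ≤ (1 + ‖ξ‖ ^ 2) ^ 2 * ‖χ ξ‖ := by positivity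
  nlinarith [mul_le_mul_of_nonneg_left h1 h2]

variable {χ} {s : E → ℂ} {C : ℝ}

lemma integrable_mul_schwartz (hs : AEStronglyMeasurable s volume) (hC : ∀ ξ, ‖s ξ‖ ≤ C * (1 + ‖ξ‖ ^ 2)) :
    Integrable (fun ξ => s ξ * χ ξ) := by
  refine ((integrable_weight χ).const_mul C).mono' (hs.mul χ.continuous.aestronglyMeasurable)
    (ae_of_all _ fun ξ => ?_)
  rw [norm_mul, ← mul_assoc]
  exact mul_le_mul_of_nonneg_right (hC ξ) (norm_nonneg _)

omit [FiniteDimensional ℝ E] [MeasurableSpace E] [BorelSpace E] in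
lemma norm_sq_mul_schwartz_le (hC : ∀ ξ, ‖s ξ‖ ≤ C * (1 + ‖ξ‖ ^ 2)) (ξ : E) :
    ‖s ξ * χ ξ‖ ^ 2 ≤ C ^ 2 * ((1 + ‖ξ‖ ^ 2) * ‖χ ξ‖) ^ 2 := by
  rw [← mul_pow, norm_mul, ← mul_assoc]
  exact pow_le_pow_left₀ (by positivity) (mul_le_mul_of_nonneg_right (hC ξ) (norm_nonneg _)) 2

lemma memLp_mul_schwartz (hs : AEStronglyMeasurable s volume) (hC : ∀ ξ, ‖s ξ‖ ≤ C * (1 + ‖ξ‖ ^ 2)) :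
    MemLp (fun ξ => s ξ * χ ξ) 2 volume := by
  have h1 : AEStronglyMeasurable (fun ξ => s ξ * χ ξ) volume :=
    hs.mul χ.continuous.aestronglyMeasurable
  rw [memLp_two_iff_integrable_sq_norm h1]
  refine ((integrable_weight_sq χ).const_mul (C ^ 2)).mono' (h1.norm.pow 2) (ae_of_all _ fun ξ => ?_)
  rw [Real.norm_of_nonneg (sq_nonneg _)]
  exact norm_sq_mul_schwartz_le hC ξ

lemma integral_norm_sq_mul_schwartz_le (hs : AEStronglyMeasurable s volume)
    (hC : ∀ ξ, ‖s ξ‖ ≤ C * (1 + ‖ξ‖ ^ 2)) :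
    ∫ ξ, ‖s ξ * χ ξ‖ ^ 2 ≤ C ^ 2 * weightSq χ := by
  rw [weightSq, ← integral_const_mul]
  exact integral_mono (memLp_mul_schwartz hs hC).norm.integrable_sq
    ((integrable_weight_sq χ).const_mul _) (norm_sq_mul_schwartz_le hC)

/-- Fourier inversion for a translated Schwartz function with a first-order correction. -/
lemma schwartz_translate_eq_fourierInv (φ : 𝓢(E, ℝ)) (b d : ℝ) (v x y : E) :
    ((b * φ (x + y) + d * fderiv ℝ φ (x + y) v : ℝ) : ℂ)
      = 𝓕⁻ (fun ξ => Complex.exp ((2 * Real.pi * inner ℝ y ξ : ℝ) * I) *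
          ((b + d * (2 * Real.pi * inner ℝ v ξ : ℝ) * I) * 𝓕 (cplx φ) ξ)) x := by
  have hinv : ∀ f : 𝓢(E, ℂ), f (x + y) = 𝓕⁻ (𝓕 f : 𝓢(E, ℂ)) (x + y) := fun f => by
    rw [FourierTransform.fourierInv_fourier_eq]
  have hder : (fderiv ℝ φ (x + y) v : ℂ) = (∂_{v} (cplx φ)) (x + y) := by
    rw [SchwartzMap.lineDerivOp_apply_eq_fderiv]
    have h1 : (cplx φ : E → ℂ) = fun z => (φ z : ℂ) := rfl
    have h2 : HasFDerivAt (fun z => (φ z : ℂ)) (Complex.ofRealCLM.comp (fderiv ℝ φ (x + y))) (x + y) :=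
      Complex.ofRealCLM.hasFDerivAt.comp (x + y) (φ.differentiable (x + y)).hasFDerivAt
    rw [h1, h2.fderiv]
    rfl
  have hφ : (φ (x + y) : ℂ) = cplx φ (x + y) := rfl
  have key : ((b * φ (x + y) + d * fderiv ℝ φ (x + y) v : ℝ) : ℂ)
      = ((b : ℂ) • cplx φ + (d : ℂ) • ∂_{v} (cplx φ)) (x + y) := by
    push_cast
    rw [hφ, hder]
    rfl
  rw [key, hinv, FourierTransform.fourier_add, FourierTransform.fourier_smul, FourierTransform.fourier_smul,
    SchwartzMap.fourier_lineDerivOp_eq, SchwartzMap.fourierInv_coe, Real.fourierInv_eq', Real.fourierInv_eq']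
  congr with ξ
  have ht : (inner ℝ · v : E → ℝ).HasTemperateGrowth := by fun_prop
  simp only [add_apply, smul_apply, SchwartzMap.smulLeftCLM_apply_apply ht,
    inner_add_right, smul_eq_mul]
  rw [← mul_assoc (Complex.exp _), ← Complex.exp_add, real_inner_comm v ξ, real_inner_comm y ξ]
  push_cast
  simp only [Complex.real_smul]
  ring_nf

end Plancherel

end NonclassicalTransport

namespace NonclassicalTransport

variable {n : ℕ}

/-! ### Corrected test functions and their Fourier representation. -/

section TestFunctions

open scoped SchwartzMap
open Complex (I)

/-- A Schwartz function with a first-order correction in the velocity. -/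
noncomputable def corrected (φ : 𝓢(Pos n, ℝ)) (b d : ℝ) (z : Pos n × Dir n) : ℝ :=
  b * φ z.1 + d * fderiv ℝ φ z.1 (z.2 : Pos n)

lemma continuous_corrected (φ : 𝓢(Pos n, ℝ)) (b d : ℝ) : Continuous (corrected φ b d) := by
  have h1 := φ.continuous
  have h2 : Continuous (fderiv ℝ φ) := (φ.smooth 1).continuous_fderiv one_ne_zero
  unfold corrected
  exact (continuous_const.mul (h1.comp continuous_fst)).add (continuous_const.mul
    ((h2.comp continuous_fst).clm_apply (continuous_subtype_val.comp continuous_snd)))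

lemma memLp_fderiv [NeZero n] (φ : 𝓢(Pos n, ℝ)) :
    MemLp (fun z : Pos n × Dir n => fderiv ℝ φ z.1 (z.2 : Pos n)) 2 (phaseMeasure n) := by
  have h1 : MemLp (fun x => ‖fderiv ℝ φ x‖) 2 volume :=
    ((SchwartzMap.fderivCLM ℝ (Pos n) ℝ φ).memLp 2 volume).norm
  have h2 := memLp_fst h1
  refine h2.mono ?_ (ae_of_all _ fun z => ?_)
  · refine ((continuous_corrected φ 0 1).congr fun z => ?_).aestronglyMeasurable
    simp [corrected]
  · rw [norm_norm]
    refine (ContinuousLinearMap.le_opNorm _ _).trans (le_of_eq ?_)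
    rw [norm_eq_of_mem_sphere, mul_one]

lemma memLp_corrected [NeZero n] (φ : 𝓢(Pos n, ℝ)) (b d : ℝ) :
    MemLp (corrected φ b d) 2 (phaseMeasure n) :=
  ((memLp_fst (φ.memLp 2 volume)).const_mul b).add ((memLp_fderiv φ).const_mul d)

variable {σ : ℝ → ℝ} [NeZero n]

/-- The correction is linear in the velocity, hence an eigenfunction with eigenvalue the mean
cosine; the constant `b` sees only the velocity average, where the correction vanishes. -/
lemma kernelOp_corrected (hσ_norm : ∀ v : Dir n, ∫ v', σ (cosine v v') ∂dirMeasure n = 1)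
    (e : Dir n) (b d : ℝ) (φ : 𝓢(Pos n, ℝ)) (z : Pos n × Dir n) :
    kernelOp (fun v v' => σ (cosine v v') - b) (corrected φ 1 d) z
      = corrected φ (1 - b) (d * meanCosine σ e) z := by
  set ξ := (InnerProductSpace.toDual ℝ (Pos n)).symm (fderiv ℝ φ z.1) with hξ
  have hd : ∀ v : Pos n, fderiv ℝ φ z.1 v = inner ℝ v ξ := fun v => by
    rw [real_inner_comm, hξ, InnerProductSpace.toDual_symm_apply]
  have h1 : ∀ v' : Dir n, (σ (cosine z.2 v') - b) * corrected φ 1 d (z.1, v')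
      = φ z.1 * σ (cosine z.2 v') + d * (σ (cosine z.2 v') * inner ℝ (v' : Pos n) ξ)
        - (b * φ z.1 + b * d * inner ℝ (v' : Pos n) ξ) := by
    intro v'
    simp only [corrected, hd]
    ring
  have i1 := (integrable_kernel hσ_norm z.2).const_mul (φ z.1)
  have i2 := (integrable_kernel_mul_inner hσ_norm z.2 ξ).const_mul d
  have i3 : Integrable (fun v' : Dir n => b * d * inner ℝ (v' : Pos n) ξ) (dirMeasure n) :=
    (integrable_inner_dir ξ).const_mul _
  have i4 : Integrable (fun v' : Dir n => φ z.1 * σ (cosine z.2 v')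
      + d * (σ (cosine z.2 v') * inner ℝ (v' : Pos n) ξ)) (dirMeasure n) := i1.add i2
  have i5 : Integrable (fun v' : Dir n => b * φ z.1 + b * d * inner ℝ (v' : Pos n) ξ)
      (dirMeasure n) := (integrable_const _).add i3
  simp only [kernelOp, h1]
  rw [integral_sub i4 i5, integral_add i1 i2, integral_add (integrable_const _) i3,
    integral_const_mul (φ z.1), integral_const_mul d, integral_const_mul (b * d), hσ_norm,
    integral_kernel_mul_inner hσ_norm e, integral_inner_dir]
  simp only [corrected, hd, integral_const, probReal_univ, smul_eq_mul]
  ring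

variable {P : Measure ℝ} [IsProbabilityMeasure P]

/-- The adjoint transport operator applied to a corrected Schwartz function. -/
noncomputable def testFun (P : Measure ℝ) (a μ₀ κ ε : ℝ) (φ : 𝓢(Pos n, ℝ)) (z : Pos n × Dir n) : ℝ :=
  corrected φ 1 (ε * a) z - pathAvg P (-ε) (corrected φ κ (ε * a * μ₀)) z

lemma memLp_testFun (a μ₀ κ ε : ℝ) (φ : 𝓢(Pos n, ℝ)) :
    MemLp (testFun P a μ₀ κ ε φ) 2 (phaseMeasure n) :=
  (memLp_corrected φ _ _).sub (memLp_pathAvg _ (memLp_corrected φ _ _)).1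

omit [NeZero n] in
/-- The adjoint of the path-length average reverses the direction of flight. -/
lemma integral_pathAvg_mul_eq (ε : ℝ) {f F : Pos n × Dir n → ℝ}
    (hf : MemLp f 2 (phaseMeasure n)) (hF : MemLp F 2 (phaseMeasure n)) :
    ∫ z, pathAvg P ε f z * F z ∂phaseMeasure n = ∫ z, f z * pathAvg P (-ε) F z ∂phaseMeasure n := by
  have h1 : ∫ z, f z * pathAvg P (-ε) F z ∂phaseMeasure n
      = ∫ z, pathAvg P (-ε) F z * f z ∂phaseMeasure n := by simp only [mul_comm]
  rw [integral_pathAvg_mul ε hf hF, h1]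
  have h2 : ∫ z, pathAvg P (-ε) F z * f z ∂phaseMeasure n
      = ∫ z, ∫ τ, F (shift (-ε * τ) z) * f z ∂P ∂phaseMeasure n := by
    simp only [pathAvg, integral_mul_const]
  rw [h2]
  refine ((integral_integral_swap (integrable_shift_mul (-ε) hF hf)).trans ?_).symm
  simp only [neg_mul, mul_comm (F _)]

/-- The weak form of the reduced equation, exact for every `ε`: the kernel is symmetric and the
adjoint of the path average is the backward one, so both move onto the test function. -/
lemma IsReduced.integral_mul_testFun (hσ_meas : Measurable σ)
    (hσ_norm : ∀ v : Dir n, ∫ v', σ (cosine v v') ∂dirMeasure n = 1) {σ₀ : ℝ}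
    (hσ_lower : ∀ v v' : Dir n, σ₀ ≤ σ (cosine v v')) (e : Dir n) {Q g : Pos n × Dir n → ℝ}
    (hQ : MemLp Q 2 (phaseMeasure n)) {b ε θ : ℝ} (hb : b ≤ σ₀)
    (hg : IsReduced P (fun v v' => σ (cosine v v') - b) Q ε θ g) (a : ℝ) (φ : 𝓢(Pos n, ℝ)) :
    ∫ z, g z * testFun P a (meanCosine σ e) (1 - b) ε φ z ∂phaseMeasure n
      = θ * ∫ z, Q z * corrected φ 1 (ε * a) z ∂phaseMeasure n := by
  have hk := isKernel_sub hσ_meas hσ_norm hσ_lower hb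
  have hψ := memLp_corrected φ 1 (ε * a)
  have hψ2 := memLp_corrected φ (1 - b) (ε * a * meanCosine σ e)
  have hA := (memLp_pathAvg (P := P) ε hg.memLp).1
  have h1 : ∫ z, g z * corrected φ 1 (ε * a) z ∂phaseMeasure n
      = ∫ z, (kernelOp (fun v v' => σ (cosine v v') - b) (pathAvg P ε g) z
          * corrected φ 1 (ε * a) z + θ * (Q z * corrected φ 1 (ε * a) z)) ∂phaseMeasure n := by
    refine integral_congr_ae ?_
    filter_upwards [hg.eq] with z hz
    rw [hz]; ring
  have h2 : ∫ z, g z * testFun P a (meanCosine σ e) (1 - b) ε φ z ∂phaseMeasure n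
      = ∫ z, (g z * corrected φ 1 (ε * a) z
        - g z * pathAvg P (-ε) (corrected φ (1 - b) (ε * a * meanCosine σ e)) z)
        ∂phaseMeasure n := by
    congr with z
    rw [testFun]; ring
  rw [h2, integral_sub (integrable_mul_of_memLp hg.memLp hψ)
    (integrable_mul_of_memLp hg.memLp (memLp_pathAvg _ hψ2).1), h1,
    integral_add (integrable_mul_of_memLp (hk.memLp_kernelOp hA).1 hψ)
      ((integrable_mul_of_memLp hQ hψ).const_mul θ),
    hk.integral_kernelOp_mul hA hψ, integral_const_mul, ← integral_pathAvg_mul_eq ε hg.memLp hψ2]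
  simp only [kernelOp_corrected hσ_norm e]
  ring

omit [NeZero n] in
lemma aestronglyMeasurable_symb (a μ₀ κ ε : ℝ) (v : Dir n) :
    AEStronglyMeasurable (fun ξ : Pos n => symb P a μ₀ κ (freq ε v ξ)) volume :=
  ((continuous_symb P a μ₀ κ).comp (by unfold freq; fun_prop)).aestronglyMeasurable

omit [NeZero n] in
/-- In Fourier variables, the test functions are the symbol times the transform. -/
lemma testFun_eq_fourierInv (a μ₀ κ ε : ℝ) (φ : 𝓢(Pos n, ℝ)) (z : Pos n × Dir n) :
    (testFun P a μ₀ κ ε φ z : ℂ)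
      = 𝓕⁻ (fun ξ => symb P a μ₀ κ (freq ε z.2 ξ) * 𝓕 (cplx φ) ξ) z.1 := by
  obtain ⟨x, v⟩ := z
  set χ : 𝓢(Pos n, ℂ) := 𝓕 (cplx φ) with hχ
  have h1 : ((corrected φ 1 (ε * a) (x, v) : ℝ) : ℂ)
      = ∫ ξ, Complex.exp ((2 * Real.pi * inner ℝ ξ x : ℝ) * I) *
        ((1 + a * freq ε v ξ * I) * χ ξ) := by
    have h := schwartz_translate_eq_fourierInv φ 1 (ε * a) (v : Pos n) x 0
    rw [add_zero, Real.fourierInv_eq'] at h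
    refine h.trans ?_
    congr with ξ
    simp only [inner_zero_left, mul_zero, Complex.ofReal_zero, zero_mul, Complex.exp_zero, one_mul,
      smul_eq_mul, freq, Complex.ofReal_one, hχ]
    push_cast
    ring
  set G : Pos n → ℂ := fun ξ => Complex.exp ((2 * Real.pi * inner ℝ ξ x : ℝ) * I) *
        ((κ + a * μ₀ * freq ε v ξ * I) * χ ξ) with hG
  have hfr : Continuous (fun ξ : Pos n => freq ε v ξ) := by unfold freq; fun_prop
  have hexp : Continuous (fun ξ : Pos n => Complex.exp ((2 * Real.pi * inner ℝ ξ x : ℝ) * I)) := by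
    fun_prop
  have hlin : ∀ b d : ℝ, Integrable (fun ξ : Pos n =>
      Complex.exp ((2 * Real.pi * inner ℝ ξ x : ℝ) * I) * ((b + d * freq ε v ξ * I) * χ ξ)) := by
    intro b d
    have h2 : Integrable (fun ξ : Pos n => (b + d * freq ε v ξ * I : ℂ) * χ ξ) := by
      refine integrable_mul_schwartz (C := |b| + |d| * (|ε| * Real.pi)) ?_ fun ξ => ?_
      · exact (by fun_prop : Continuous fun ξ : Pos n => (b + d * freq ε v ξ * I : ℂ)).aestronglyMeasurable
      · refine (norm_add_le _ _).trans ?_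
        simp only [norm_mul, Complex.norm_real, Complex.norm_I, mul_one, Real.norm_eq_abs]
        have h3 := abs_freq_le ε v ξ
        have h4 : |ε| * (2 * Real.pi * ‖ξ‖) ≤ |ε| * (Real.pi * (1 + ‖ξ‖ ^ 2)) := by
          refine mul_le_mul_of_nonneg_left ?_ (abs_nonneg ε)
          have := mul_le_mul_of_nonneg_left (two_mul_norm_le ξ) Real.pi_pos.le
          linarith
        have h5 := mul_le_mul_of_nonneg_left (h3.trans h4) (abs_nonneg d)
        have h6 : 0 ≤ |b| * ‖ξ‖ ^ 2 := by positivity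
        linarith
    refine h2.norm.mono' (hexp.aestronglyMeasurable.mul h2.1) (ae_of_all _ fun ξ => ?_)
    rw [norm_mul, Complex.norm_exp_ofReal_mul_I, one_mul]
  have hGi : Integrable G := by
    refine (hlin κ (a * μ₀)).congr (ae_of_all _ fun ξ => ?_)
    simp only [hG]
    push_cast
    rfl
  have h2 : ∀ τ : ℝ, ((corrected φ κ (ε * a * μ₀) (shift (-ε * τ) (x, v)) : ℝ) : ℂ)
      = ∫ ξ, G ξ * Complex.exp ((freq ε v ξ * τ : ℝ) * I) := by
    intro τ
    have h := schwartz_translate_eq_fourierInv φ κ (ε * a * μ₀) (v : Pos n) x ((ε * τ) • (v : Pos n))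
    rw [Real.fourierInv_eq'] at h
    have h3 : shift (-ε * τ) (x, v) = (x + (ε * τ) • (v : Pos n), v) := by
      simp [shift, neg_mul, sub_neg_eq_add]
    rw [corrected, h3]
    refine h.trans ?_
    congr with ξ
    simp only [inner_smul_left, smul_eq_mul, freq, hG, hχ]
    have h4 : (2 * Real.pi * ((starRingEnd ℝ) (ε * τ) * inner ℝ (v : Pos n) ξ) : ℝ)
        = ε * (2 * Real.pi * inner ℝ (v : Pos n) ξ) * τ := by
      simp only [conj_trivial]; ring
    rw [h4]
    push_cast
    ring
  -- A flight of length `τ` multiplies the transform by `e^{itτ}`; after Fubini the average over `P`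
  -- is the characteristic function.
  have h3 : ((pathAvg P (-ε) (corrected φ κ (ε * a * μ₀)) (x, v) : ℝ) : ℂ)
      = ∫ ξ, G ξ * charFun P (freq ε v ξ) := by
    rw [pathAvg, ← integral_complex_ofReal]
    simp only [h2]
    have hI : Integrable (fun y : ℝ × Pos n => G y.2 * Complex.exp ((freq ε v y.2 * y.1 : ℝ) * I))
        (P.prod volume) := by
      have h4 := hGi.comp_snd P
      refine h4.norm.mono' (h4.1.mul (Continuous.aestronglyMeasurable ?_)) (ae_of_all _ fun y => ?_)
      · have := hfr.comp (continuous_snd : Continuous (Prod.snd : ℝ × Pos n → Pos n))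
        simp only [Function.comp_def] at this
        fun_prop
      · rw [norm_mul, Complex.norm_exp_ofReal_mul_I, mul_one]
    rw [integral_integral_swap hI]
    congr with ξ
    rw [integral_const_mul, charFun_eq_integral]
  have hi1 : Integrable (fun ξ : Pos n => Complex.exp ((2 * Real.pi * inner ℝ ξ x : ℝ) * I) *
      ((1 + a * freq ε v ξ * I) * χ ξ)) := by
    refine (hlin 1 a).congr (ae_of_all _ fun ξ => ?_)
    push_cast
    rfl
  have hi2 : Integrable (fun ξ : Pos n => G ξ * charFun P (freq ε v ξ)) := by
    refine hGi.norm.mono' (hGi.1.mul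
      ((continuous_charFun (μ := P)).comp hfr).aestronglyMeasurable) (ae_of_all _ fun ξ => ?_)
    rw [norm_mul]
    exact mul_le_of_le_one_right (norm_nonneg _) (norm_charFun_le_one _)
  rw [testFun, Complex.ofReal_sub, h1, h3, ← integral_sub hi1 hi2, Real.fourierInv_eq']
  congr with ξ
  simp only [hG, symb, smul_eq_mul]
  ring

variable {a μ₀ κ ε β : ℝ} {φ : 𝓢(Pos n, ℝ)}

/-- Plancherel in `x` for each fixed direction turns a pointwise bound on the symbol into an `L²`
bound, with the quadratic growth absorbed by the Schwartz function. -/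
lemma integral_testFun_sq_le
    (hβ : ∀ (ξ : Pos n) (v : Dir n), ‖symb P a μ₀ κ (freq ε v ξ)‖ ≤ β * (1 + ‖ξ‖ ^ 2)) :
    ∫ z, testFun P a μ₀ κ ε φ z ^ 2 ∂phaseMeasure n ≤ β ^ 2 * weightSq (𝓕 (cplx φ)) := by
  have hL := memLp_testFun (P := P) a μ₀ κ ε φ
  have hsq := hL.integrable_sq
  rw [phaseMeasure, integral_prod_symm _ hsq]
  have h1 : ∀ v : Dir n, ∫ x, testFun P a μ₀ κ ε φ (x, v) ^ 2 ≤ β ^ 2 * weightSq (𝓕 (cplx φ)) := by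
    intro v
    have hs := aestronglyMeasurable_symb (P := P) a μ₀ κ ε v
    have hC := fun ξ => hβ ξ v
    refine le_trans (le_of_eq ?_) (integral_norm_sq_mul_schwartz_le hs hC)
    rw [← integral_norm_sq_fourierInv (integrable_mul_schwartz hs hC) (memLp_mul_schwartz hs hC)]
    congr with x
    rw [← testFun_eq_fourierInv a μ₀ κ ε φ (x, v), Complex.norm_real, Real.norm_eq_abs, sq_abs]
  have h2 := integral_mono hsq.integral_prod_right (integrable_const _) h1
  simpa using h2

omit [IsProbabilityMeasure P] in
lemma norm_integral_symb_le
    (hβ : ∀ (ξ : Pos n) (v : Dir n), ‖symb P a μ₀ κ (freq ε v ξ)‖ ≤ β * (1 + ‖ξ‖ ^ 2)) (ξ : Pos n) :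
    ‖∫ v : Dir n, symb P a μ₀ κ (freq ε v ξ) ∂dirMeasure n‖ ≤ β * (1 + ‖ξ‖ ^ 2) := by
  have := norm_integral_le_of_norm_le_const (μ := dirMeasure n) (ae_of_all _ (hβ ξ))
  simpa using this

omit [NeZero n] in
lemma continuous_symb_freq (a μ₀ κ ε : ℝ) :
    Continuous (fun y : Dir n × Pos n => symb P a μ₀ κ (freq ε y.1 y.2)) :=
  (continuous_symb P a μ₀ κ).comp (continuous_freq ε)

omit [NeZero n] in
lemma aestronglyMeasurable_integral_symb (a μ₀ κ ε : ℝ) :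
    AEStronglyMeasurable (fun ξ : Pos n => ∫ v : Dir n, symb P a μ₀ κ (freq ε v ξ) ∂dirMeasure n)
      volume := by
  have h1 : Continuous (fun y : Pos n × Dir n => symb P a μ₀ κ (freq ε y.2 y.1)) :=
    (continuous_symb P a μ₀ κ).comp (by unfold freq; fun_prop)
  have h2 : AEStronglyMeasurable (fun y : Pos n × Dir n => symb P a μ₀ κ (freq ε y.2 y.1))
      ((volume : Measure (Pos n)).prod (dirMeasure n)) := h1.aestronglyMeasurable
  exact h2.integral_prod_right'

omit [NeZero n] in
lemma velAvg_testFun_eq_fourierInv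
    (hβ : ∀ (ξ : Pos n) (v : Dir n), ‖symb P a μ₀ κ (freq ε v ξ)‖ ≤ β * (1 + ‖ξ‖ ^ 2)) (x : Pos n) :
    (velAvg (testFun P a μ₀ κ ε φ) x : ℂ)
      = 𝓕⁻ (fun ξ => (∫ v : Dir n, symb P a μ₀ κ (freq ε v ξ) ∂dirMeasure n) * 𝓕 (cplx φ) ξ) x := by
  rw [velAvg, ← integral_complex_ofReal, Real.fourierInv_eq']
  simp only [testFun_eq_fourierInv, Real.fourierInv_eq']
  have hI : Integrable (fun y : Dir n × Pos n =>
      Complex.exp ((2 * Real.pi * inner ℝ y.2 x : ℝ) * I) •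
        (symb P a μ₀ κ (freq ε y.1 y.2) * 𝓕 (cplx φ) y.2)) ((dirMeasure n).prod volume) := by
    refine (((integrable_weight (𝓕 (cplx φ))).const_mul β).comp_snd (dirMeasure n)).mono'
      (Continuous.aestronglyMeasurable ?_) (ae_of_all _ fun y => ?_)
    · have h1 := continuous_symb_freq (n := n) (P := P) a μ₀ κ ε
      have h2 := (𝓕 (cplx φ)).continuous.comp (continuous_snd (X := Dir n) (Y := Pos n))
      simp only [Function.comp_def] at h2
      fun_prop
    · rw [smul_eq_mul, norm_mul, norm_mul, Complex.norm_exp_ofReal_mul_I, one_mul, ← mul_assoc]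
      exact mul_le_mul_of_nonneg_right (hβ _ _) (norm_nonneg _)
  rw [integral_integral_swap hI]
  congr with ξ
  simp only [smul_eq_mul]
  rw [integral_const_mul, integral_mul_const]

end TestFunctions

end NonclassicalTransport

namespace NonclassicalTransport

variable {n : ℕ}

/-! ### Weak limits identified through a Fourier multiplier with dense range. -/

section WeakLimit

open scoped SchwartzMap
open Complex (I)

/-- Weak convergence of a bounded family may be tested on a total set. -/
lemma tendsto_inner_of_total {H ι : Type*} [NormedAddCommGroup H] [InnerProductSpace ℂ H]
    [CompleteSpace H] {l : Filter ι} {S : Set H}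
    (hS : ∀ G : H, (∀ x ∈ S, inner ℂ x G = 0) → G = 0) {R : ι → H} {C : ℝ}
    (hC : ∀ i, ‖R i‖ ≤ C) {U : H}
    (hT : ∀ x ∈ S, Tendsto (fun i => inner ℂ x (R i)) l (𝓝 (inner ℂ x U))) (h : H) :
    Tendsto (fun i => inner ℂ h (R i)) l (𝓝 (inner ℂ h U)) := by
  have hC' : 0 < |C| + ‖U‖ + 1 := by positivity
  have hspan : ∀ x ∈ Submodule.span ℂ S,
      Tendsto (fun i => inner ℂ x (R i)) l (𝓝 (inner ℂ x U)) := by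
    intro x hx
    induction hx using Submodule.span_induction with
    | mem x hx => exact hT x hx
    | zero => simpa using tendsto_const_nhds
    | add x y _ _ hx hy => simpa only [inner_add_left] using hx.add hy
    | smul a x _ hx => simpa only [inner_smul_left] using hx.const_mul _
  have hdense : (Submodule.span ℂ S).topologicalClosure = ⊤ := by
    rw [Submodule.topologicalClosure_eq_top_iff, Submodule.eq_bot_iff]
    intro G hG
    refine hS G fun x hx => ?_
    exact (Submodule.mem_orthogonal _ _).1 hG x (Submodule.subset_span hx)
  have hmem : h ∈ closure (Submodule.span ℂ S : Set H) := by
    rw [← Submodule.topologicalClosure_coe, hdense]; trivial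
  rw [Metric.tendsto_nhds]
  intro δ hδ
  obtain ⟨x, hx, hxh⟩ := Metric.mem_closure_iff.1 hmem (δ / (2 * (|C| + ‖U‖ + 1))) (by positivity)
  rw [dist_eq_norm] at hxh
  filter_upwards [Metric.tendsto_nhds.1 (hspan x hx) (δ / 2) (by positivity)] with i hi
  rw [dist_eq_norm] at hi ⊢
  have e : inner ℂ h (R i) - inner ℂ h U
      = inner ℂ (h - x) (R i - U) + (inner ℂ x (R i) - inner ℂ x U) := by
    simp only [inner_sub_left, inner_sub_right]; ring
  rw [e]
  refine (norm_add_le _ _).trans_lt ?_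
  have h1 : ‖inner ℂ (h - x) (R i - U)‖ ≤ ‖h - x‖ * (|C| + ‖U‖ + 1) := by
    refine (norm_inner_le_norm _ _).trans (mul_le_mul_of_nonneg_left ?_ (norm_nonneg _))
    have := norm_sub_le (R i) U
    linarith [hC i, le_abs_self C]
  have h2 : ‖h - x‖ * (|C| + ‖U‖ + 1) < δ / 2 := by
    have := mul_lt_mul_of_pos_right hxh hC'
    have e2 : δ / (2 * (|C| + ‖U‖ + 1)) * (|C| + ‖U‖ + 1) = δ / 2 := by field_simp
    rwa [e2] at this
  linarith

/-- Real square-integrable functions as complex ones. -/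
noncomputable def toC {X : Type*} [MeasurableSpace X] {μ : Measure X} {f : X → ℝ}
    (hf : MemLp f 2 μ) : Lp ℂ 2 μ := (hf.ofReal (K := ℂ)).toLp _

section toC

variable {X : Type*} [MeasurableSpace X] {μ : Measure X} {f g : X → ℝ}

lemma coeFn_toC (hf : MemLp f 2 μ) : ∀ᵐ x ∂μ, toC hf x = (f x : ℂ) := MemLp.coeFn_toLp _

lemma inner_toC_left (hf : MemLp f 2 μ) (G : Lp ℂ 2 μ) :
    inner ℂ (toC hf) G = ∫ x, (f x : ℂ) * G x ∂μ := by
  rw [L2.inner_def]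
  refine integral_congr_ae ?_
  filter_upwards [coeFn_toC hf] with x hx
  rw [hx]
  simp [mul_comm]

lemma inner_toC (hf : MemLp f 2 μ) (hg : MemLp g 2 μ) :
    inner ℂ (toC hf) (toC hg) = ((∫ x, f x * g x ∂μ : ℝ) : ℂ) := by
  rw [inner_toC_left, ← integral_complex_ofReal]
  refine integral_congr_ae ?_
  filter_upwards [coeFn_toC hg] with x hx
  rw [hx]
  push_cast
  rfl

lemma norm_toC_sq (hf : MemLp f 2 μ) : ‖toC hf‖ ^ 2 = ∫ x, f x ^ 2 ∂μ := by
  rw [toC, ← integral_norm_sq_eq]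
  congr with x
  simp

end toC

/-- A real symbol, positive and of at most quadratic growth. -/
structure IsSymbol (m : Pos n → ℝ) : Prop where
  continuous : Continuous m
  lower : ∃ κ : ℝ, 0 < κ ∧ ∀ ξ, κ ≤ m ξ
  upper : ∃ C : ℝ, ∀ ξ, ‖(m ξ : ℂ)‖ ≤ C * (1 + ‖ξ‖ ^ 2)

variable {m : Pos n → ℝ}

lemma IsSymbol.memLp (hm : IsSymbol m) (χ : 𝓢(Pos n, ℂ)) :
    MemLp (fun ξ => (m ξ : ℂ) * χ ξ) 2 volume := by
  obtain ⟨C, hC⟩ := hm.upper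
  exact memLp_mul_schwartz (Complex.continuous_ofReal.comp hm.continuous).aestronglyMeasurable hC

lemma IsSymbol.integrable (hm : IsSymbol m) (χ : 𝓢(Pos n, ℂ)) :
    Integrable (fun ξ => (m ξ : ℂ) * χ ξ) volume := by
  obtain ⟨C, hC⟩ := hm.upper
  exact integrable_mul_schwartz (Complex.continuous_ofReal.comp hm.continuous).aestronglyMeasurable hC

lemma IsSymbol.pos (hm : IsSymbol m) (ξ : Pos n) : 0 < m ξ := by
  obtain ⟨κ, h0, h⟩ := hm.lower
  exact h0.trans_le (h ξ)

/-- The Fourier multiplier `m` on Schwartz functions, with values in `L²`. -/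
noncomputable def IsSymbol.apply (hm : IsSymbol m) (φ : 𝓢(Pos n, ℂ)) :
    Lp ℂ 2 (volume : Measure (Pos n)) := 𝓕⁻ ((hm.memLp (𝓕 φ)).toLp _)

lemma IsSymbol.inner_apply (hm : IsSymbol m) (φ : 𝓢(Pos n, ℂ)) (G : Lp ℂ 2 (volume : Measure (Pos n))) :
    inner ℂ (hm.apply φ) G = ∫ ξ, (starRingEnd ℂ) (m ξ * 𝓕 φ ξ) * (𝓕 G : Lp ℂ 2 volume) ξ := by
  rw [← Lp.inner_fourier_eq, IsSymbol.apply, FourierTransform.fourier_fourierInv_eq, L2.inner_def]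
  refine integral_congr_ae ?_
  filter_upwards [(hm.memLp (𝓕 φ)).coeFn_toLp] with ξ hξ
  rw [hξ]
  simp [mul_comm]

lemma IsSymbol.apply_add_I_smul (hm : IsSymbol m) (φ ψ : 𝓢(Pos n, ℂ)) :
    hm.apply (φ + I • ψ) = hm.apply φ + I • hm.apply ψ := by
  rw [IsSymbol.apply, IsSymbol.apply, IsSymbol.apply, ← FourierTransform.fourierInv_smul,
    ← FourierTransform.fourierInv_add]
  congr 1
  rw [← MemLp.toLp_const_smul, ← MemLp.toLp_add]
  congr 1
  funext ξ
  simp only [FourierTransform.fourier_add, FourierTransform.fourier_smul, add_apply, smul_apply,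
    Pi.add_apply, Pi.smul_apply, smul_eq_mul]
  ring

/-- The images of real Schwartz functions under the multiplier are total. -/
lemma IsSymbol.eq_zero_of_inner_apply (hm : IsSymbol m) (G : Lp ℂ 2 (volume : Measure (Pos n)))
    (h : ∀ φ : 𝓢(Pos n, ℝ), inner ℂ (hm.apply (cplx φ)) G = 0) : G = 0 := by
  have h1 : ∀ φ : 𝓢(Pos n, ℂ), inner ℂ (hm.apply φ) G = 0 := by
    intro φ
    -- Splitting into real and imaginary parts extends the orthogonality from real to complex
    -- Schwartz functions, among which any `𝓕φ` may be prescribed.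
    have e : φ = cplx (φ.postcompCLM Complex.reCLM) + I • cplx (φ.postcompCLM Complex.imCLM) := by
      ext x
      simp only [add_apply, smul_apply, cplx, SchwartzMap.postcompCLM_apply, Complex.ofRealCLM_apply, smul_eq_mul]
      have := Complex.re_add_im (φ x)
      simp only [Complex.reCLM_apply, Complex.imCLM_apply]
      rw [mul_comm I, this]
    rw [e, hm.apply_add_I_smul, inner_add_left, inner_smul_left, h, h, mul_zero, add_zero]
  have hloc : LocallyIntegrable (fun ξ => (m ξ : ℂ) • (𝓕 G : Lp ℂ 2 (volume : Measure (Pos n))) ξ)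
      volume := by
    have h2 : LocallyIntegrable (𝓕 G : Lp ℂ 2 (volume : Measure (Pos n))) volume :=
      (Lp.memLp _).locallyIntegrable (by norm_num)
    rw [locallyIntegrable_iff] at h2 ⊢
    intro K hK
    exact (h2 K hK).continuousOn_smul (Complex.continuous_ofReal.comp hm.continuous).continuousOn hK
  -- Taking `𝓕φ` to be an arbitrary smooth bump shows that `m 𝓕G` vanishes as a distribution;
  -- positivity of `m` then gives `𝓕G = 0`.
  have h3 : ∀ᵐ ξ, (m ξ : ℂ) • (𝓕 G : Lp ℂ 2 (volume : Measure (Pos n))) ξ = 0 := by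
    refine ae_eq_zero_of_integral_contDiff_smul_eq_zero hloc fun χ hχ hχc => ?_
    have hχc' : HasCompactSupport (fun x => (χ x : ℂ)) := hχc.comp_left Complex.ofReal_zero
    have hχ' : ContDiff ℝ ∞ (fun x => (χ x : ℂ)) := Complex.ofRealCLM.contDiff.comp hχ
    have h4 := h1 (𝓕⁻ (hχc'.toSchwartzMap hχ'))
    rw [hm.inner_apply, FourierTransform.fourier_fourierInv_eq] at h4
    rw [← h4]
    congr with ξ
    simp only [map_mul, Complex.conj_ofReal, smul_eq_mul, Complex.real_smul]
    change _ = (m ξ : ℂ) * (starRingEnd ℂ) ((χ ξ : ℝ) : ℂ) * _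
    rw [Complex.conj_ofReal]
    ring
  have h5 : (𝓕 G : Lp ℂ 2 (volume : Measure (Pos n))) = 0 := by
    refine Lp.ext ?_
    filter_upwards [h3, Lp.coeFn_zero ℂ 2 (volume : Measure (Pos n))] with ξ h6 h7
    rw [h7]
    rcases smul_eq_zero.1 h6 with h8 | h8
    · exact absurd (Complex.ofReal_eq_zero.1 h8) (hm.pos ξ).ne'
    · exact h8
  rw [← norm_eq_zero, ← Lp.norm_fourier_eq, h5, norm_zero]

/-- The solution of `m(D) U = F`. -/
lemma IsSymbol.exists_solution (hm : IsSymbol m) (F : Lp ℂ 2 (volume : Measure (Pos n))) :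
    ∃ U : Lp ℂ 2 (volume : Measure (Pos n)),
      (∀ᵐ ξ, (m ξ : ℂ) * (𝓕 U : Lp ℂ 2 (volume : Measure (Pos n))) ξ
        = (𝓕 F : Lp ℂ 2 (volume : Measure (Pos n))) ξ) ∧
      ∀ φ : 𝓢(Pos n, ℂ), inner ℂ (hm.apply φ) U = inner ℂ (φ.toLp 2) F := by
  obtain ⟨κ, hκ, hm1⟩ := hm.lower
  -- The positive lower bound, supplied by absorption `1 - c`, makes division by the symbol bounded
  -- on `L²`.
  have hL : MemLp (fun ξ => (m ξ : ℂ)⁻¹ * (𝓕 F : Lp ℂ 2 (volume : Measure (Pos n))) ξ) 2 volume := by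
    refine (Lp.memLp (𝓕 F : Lp ℂ 2 (volume : Measure (Pos n)))).of_le_mul (c := κ⁻¹) ?_
      (ae_of_all _ fun ξ => ?_)
    · refine AEStronglyMeasurable.mul ?_ (Lp.aestronglyMeasurable _)
      exact ((Complex.continuous_ofReal.comp hm.continuous).inv₀ fun ξ =>
        Complex.ofReal_ne_zero.2 (hm.pos ξ).ne').aestronglyMeasurable
    · rw [norm_mul, norm_inv, Complex.norm_real, Real.norm_of_nonneg (hm.pos ξ).le]
      gcongr
      exact hm1 ξ
  refine ⟨𝓕⁻ (hL.toLp _), ?_, fun φ => ?_⟩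
  · rw [FourierTransform.fourier_fourierInv_eq]
    filter_upwards [hL.coeFn_toLp] with ξ hξ
    rw [hξ, mul_inv_cancel_left₀ (Complex.ofReal_ne_zero.2 (hm.pos ξ).ne')]
  · rw [hm.inner_apply, FourierTransform.fourier_fourierInv_eq, ← Lp.inner_fourier_eq,
      SchwartzMap.toLp_fourier_eq, L2.inner_def]
    refine integral_congr_ae ?_
    filter_upwards [hL.coeFn_toLp, (𝓕 φ).coeFn_toLp 2 volume] with ξ h1 h2
    rw [h1, h2]
    have := Complex.ofReal_ne_zero.2 (hm.pos ξ).ne'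
    simp only [map_mul, Complex.conj_ofReal, RCLike.inner_apply]
    field_simp

/-- Identification of the weak limit of a bounded family from its pairings with approximations of
`m(D) φ`. -/
lemma IsSymbol.exists_weak_limit (hm : IsSymbol m) {F : Pos n → ℝ} (hF : MemLp F 2 volume)
    {ρ : ℝ → Pos n → ℝ} {l : Filter ℝ} [l.NeBot] (hρ : ∀ ε, MemLp (ρ ε) 2 volume) {C : ℝ}
    (hC : ∀ ε, ∫ x, ρ ε x ^ 2 ≤ C)
    (hT : ∀ φ : 𝓢(Pos n, ℝ), ∃ T : ℝ → Pos n → ℝ, (∀ ε, MemLp (T ε) 2 volume) ∧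
      Tendsto (fun ε => ∫ x, ‖(T ε x : ℂ) - 𝓕⁻ (fun ξ => (m ξ : ℂ) * 𝓕 (cplx φ) ξ) x‖ ^ 2) l (𝓝 0) ∧
      Tendsto (fun ε => ∫ x, ρ ε x * T ε x) l (𝓝 (∫ x, F x * φ x))) :
    ∃ Ψ₀ : Pos n → ℝ, ∃ hΨ : MemLp Ψ₀ 2 volume,
      (∀ h : Pos n → ℝ, MemLp h 2 volume →
        Tendsto (fun ε => ∫ x, h x * ρ ε x) l (𝓝 (∫ x, h x * Ψ₀ x))) ∧
      ∀ᵐ ξ, (m ξ : ℂ) * (𝓕 (toC hΨ) : Lp ℂ 2 (volume : Measure (Pos n))) ξ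
        = (𝓕 (toC hF) : Lp ℂ 2 (volume : Measure (Pos n))) ξ := by
  obtain ⟨U, hU1, hU2⟩ := hm.exists_solution (toC hF)
  have hR : ∀ ε, ‖toC (hρ ε)‖ ≤ √C := fun ε => by
    refine Real.le_sqrt_of_sq_le ?_
    rw [norm_toC_sq]
    exact hC ε
  have hweak : ∀ h : Lp ℂ 2 (volume : Measure (Pos n)),
      Tendsto (fun ε => inner ℂ h (toC (hρ ε))) l (𝓝 (inner ℂ h U)) := by
    refine tendsto_inner_of_total (S := Set.range fun φ : 𝓢(Pos n, ℝ) => hm.apply (cplx φ))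
      (fun G hG => hm.eq_zero_of_inner_apply G fun φ => hG _ ⟨φ, rfl⟩) hR ?_
    rintro _ ⟨φ, rfl⟩
    obtain ⟨T, hTL, hT1, hT2⟩ := hT φ
    have e1 : inner ℂ (hm.apply (cplx φ)) U = ((∫ x, F x * φ x : ℝ) : ℂ) := by
      have e2 : (cplx φ).toLp 2 = toC (φ.memLp 2 volume) := rfl
      rw [hU2, e2, inner_toC]
      simp only [mul_comm]
    simp only
    rw [e1]
    -- Replace `m(D)φ` by its approximation `T ε`: the error is a strongly vanishing factor against
    -- a bounded one.
    have e3 : ∀ ε, inner ℂ (hm.apply (cplx φ)) (toC (hρ ε))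
        = ((∫ x, ρ ε x * T ε x : ℝ) : ℂ) - inner ℂ (toC (hTL ε) - hm.apply (cplx φ)) (toC (hρ ε)) := by
      intro ε
      rw [inner_sub_left, inner_toC]
      simp only [mul_comm]
      ring
    simp only [e3]
    have e4 : Tendsto (fun ε => inner ℂ (toC (hTL ε) - hm.apply (cplx φ)) (toC (hρ ε))) l (𝓝 0) := by
      have e5 : ∀ ε, ‖toC (hTL ε) - hm.apply (cplx φ)‖
          = √(∫ x, ‖(T ε x : ℂ) - 𝓕⁻ (fun ξ => (m ξ : ℂ) * 𝓕 (cplx φ) ξ) x‖ ^ 2) := by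
        intro ε
        have e6 := memLp_fourierInv (hm.integrable (𝓕 (cplx φ))) (hm.memLp _)
        have e7 : hm.apply (cplx φ) = e6.toLp _ :=
          Lp.ext ((fourierInv_toLp_ae_eq (hm.integrable _) (hm.memLp _)).trans e6.coeFn_toLp.symm)
        have e8 := integral_norm_sq_eq (((hTL ε).ofReal (K := ℂ)).sub e6)
        simp only [Pi.sub_apply] at e8
        rw [e7, toC, ← MemLp.toLp_sub]
        refine ((congrArg Real.sqrt e8).trans (Real.sqrt_sq (norm_nonneg _))).symm
      have e9 := (hT1.sqrt.mul_const (√C))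
      rw [Real.sqrt_zero, zero_mul] at e9
      refine squeeze_zero_norm (fun ε => ?_) e9
      refine (norm_inner_le_norm _ _).trans ?_
      rw [e5]
      exact mul_le_mul_of_nonneg_left (hR ε) (Real.sqrt_nonneg _)
    simpa using hT2.ofReal.sub e4
  have hUL : MemLp (U : Pos n → ℂ) 2 volume := Lp.memLp U
  have hre : MemLp (fun x => (U x).re) 2 volume := hUL.re
  have him : MemLp (fun x => (U x).im) 2 volume := hUL.im
  have hint : ∀ {h : Pos n → ℝ}, MemLp h 2 volume → Integrable (fun x => (h x : ℂ) * U x) volume :=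
    fun {h} hh => (hh.ofReal (K := ℂ)).integrable_mul hUL
  have hrelim : ∀ h : Pos n → ℝ, MemLp h 2 volume →
      Tendsto (fun ε => ∫ x, h x * ρ ε x) l (𝓝 (∫ x, h x * (U x).re)) := by
    intro h hh
    have h1 := (Complex.continuous_re.tendsto _).comp (hweak (toC hh))
    simp only [Function.comp_def, inner_toC, Complex.ofReal_re] at h1
    rw [inner_toC_left] at h1
    have h2 := integral_re (hint hh)
    simp only [RCLike.re_to_complex, Complex.re_ofReal_mul] at h2
    rwa [← h2] at h1
  -- The functions `ρ ε` are real, so pairing the weak limit with its own imaginary part gives `∫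
  -- (Im U)² = 0`.
  have himzero : ∀ᵐ x, (U x).im = 0 := by
    have h1 := (Complex.continuous_im.tendsto _).comp (hweak (toC him))
    simp only [Function.comp_def, inner_toC, Complex.ofReal_im] at h1
    have h2 := tendsto_nhds_unique h1 tendsto_const_nhds
    have h3 := integral_im (hint him)
    simp only [RCLike.im_to_complex, Complex.im_ofReal_mul] at h3
    rw [inner_toC_left, ← h3] at h2
    have h4 : ∫ x, (U x).im ^ 2 = 0 := by simpa only [sq] using h2
    have h5 := (integral_eq_zero_iff_of_nonneg (fun x => sq_nonneg _) him.integrable_sq).1 h4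
    filter_upwards [h5] with x hx
    simpa using hx
  refine ⟨fun x => (U x).re, hre, hrelim, ?_⟩
  have hUC : toC hre = U := by
    refine Lp.ext ?_
    filter_upwards [coeFn_toC hre, himzero] with x h1 h2
    rw [h1]
    apply Complex.ext <;> simp [h2]
  rw [hUC]
  exact hU1

end WeakLimit

end NonclassicalTransport

namespace NonclassicalTransport

variable {n : ℕ}

/-! ### Passage to the limit in the reduced equation. -/

section Diffusion

open scoped SchwartzMap
open Complex (I)

lemma fourierInv_sub {f g : Pos n → ℂ} (hf : Integrable f) (hg : Integrable g) (x : Pos n) :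
    𝓕⁻ f x - 𝓕⁻ g x = 𝓕⁻ (fun ξ => f ξ - g ξ) x := by
  have h : ∀ {f : Pos n → ℂ}, Integrable f → Integrable (fun v =>
      Complex.exp (((2 * Real.pi * inner ℝ v x : ℝ) : ℂ) * I) • f v) := by
    intro f hf
    have hc : Continuous (fun v : Pos n =>
        Complex.exp (((2 * Real.pi * inner ℝ v x : ℝ) : ℂ) * I)) := by fun_prop
    refine hf.norm.mono' (hc.aestronglyMeasurable.smul hf.1) (ae_of_all _ fun v => ?_)
    rw [norm_smul, Complex.norm_exp_ofReal_mul_I, one_mul]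
  rw [Real.fourierInv_eq', Real.fourierInv_eq', Real.fourierInv_eq', ← integral_sub (h hf) (h hg)]
  congr with v
  rw [smul_sub]

variable [NeZero n] {P : Measure ℝ} [IsProbabilityMeasure P] {a μ₀ c : ℝ} {θ : ℝ → ℝ}
  {m : Pos n → ℝ}

/-- The averaged, rescaled test functions converge in `L²`. -/
lemma SymbolLimit.tendsto_test (h : SymbolLimit P a μ₀ c θ m) (hm : IsSymbol m)
    (hθ : ∀ᶠ ε in 𝓝[>] (0 : ℝ), 0 < θ ε) (φ : 𝓢(Pos n, ℝ)) :
    Tendsto (fun ε => ∫ x, ‖(((θ ε)⁻¹ * velAvg (testFun P a μ₀ (1 - θ ε * (1 - c)) ε φ) x : ℝ) : ℂ)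
      - 𝓕⁻ (fun ξ => (m ξ : ℂ) * 𝓕 (cplx φ) ξ) x‖ ^ 2) (𝓝[>] 0) (𝓝 0) := by
  obtain ⟨C, hC⟩ := h.bound
  obtain ⟨C', hC'⟩ := hm.upper
  obtain ⟨β, -, hβ⟩ := h.small
  set S : ℝ → Pos n → ℂ := fun ε ξ =>
    ∫ v : Dir n, symb P a μ₀ (1 - θ ε * (1 - c)) (freq ε v ξ) ∂dirMeasure n with hS
  have hSm : ∀ ε, AEStronglyMeasurable (S ε) volume := fun ε =>
    aestronglyMeasurable_integral_symb _ _ _ _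
  have hmm : AEStronglyMeasurable (fun ξ => (m ξ : ℂ)) volume :=
    (Complex.continuous_ofReal.comp hm.continuous).aestronglyMeasurable
  have hDm : ∀ ε, AEStronglyMeasurable (fun ξ => S ε ξ / (θ ε : ℂ) - m ξ) volume := by
    intro ε
    refine AEStronglyMeasurable.sub ?_ hmm
    refine ((hSm ε).const_mul (θ ε : ℂ)⁻¹).congr (ae_of_all _ fun ξ => ?_)
    simp only
    ring
  have hDC : ∀ᶠ ε in 𝓝[>] (0 : ℝ), ∀ ξ, ‖S ε ξ / (θ ε : ℂ) - m ξ‖ ≤ (C + C') * (1 + ‖ξ‖ ^ 2) := by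
    filter_upwards [hC, hθ] with ε h1 h2 ξ
    have h3 : ‖S ε ξ / (θ ε : ℂ)‖ ≤ C * (1 + ‖ξ‖ ^ 2) := by
      rw [norm_div, Complex.norm_real, Real.norm_of_nonneg h2.le, div_le_iff₀ h2]
      exact (h1 ξ).trans (le_of_eq (by ring))
    refine (norm_sub_le _ _).trans ?_
    rw [add_mul]
    exact add_le_add h3 (hC' ξ)
  -- Convergence takes place on the frequency side by dominated convergence, quadratic growth
  -- against Schwartz decay; Plancherel carries it back to position space.
  have h0 : Tendsto (fun ε => ∫ ξ, ‖(S ε ξ / (θ ε : ℂ) - m ξ) * 𝓕 (cplx φ) ξ‖ ^ 2) (𝓝[>] 0)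
      (𝓝 (∫ _ : Pos n, (0 : ℝ))) := by
    refine tendsto_integral_filter_of_dominated_convergence
      (fun ξ => (C + C') ^ 2 * ((1 + ‖ξ‖ ^ 2) * ‖𝓕 (cplx φ) ξ‖) ^ 2)
      (Eventually.of_forall fun ε =>
        (((hDm ε).mul (𝓕 (cplx φ)).continuous.aestronglyMeasurable).norm.pow 2)) ?_
      ((integrable_weight_sq _).const_mul _) (ae_of_all _ fun ξ => ?_)
    · filter_upwards [hDC] with ε h1
      refine ae_of_all _ fun ξ => ?_
      rw [Real.norm_of_nonneg (sq_nonneg _)]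
      exact norm_sq_mul_schwartz_le h1 ξ
    · have h1 : Tendsto (fun ε => S ε ξ / (θ ε : ℂ)) (𝓝[>] 0) (𝓝 (m ξ : ℂ)) := h.tendsto ξ
      have h2 := (((h1.sub_const (m ξ : ℂ)).mul_const (𝓕 (cplx φ) ξ)).norm).pow 2
      simpa using h2
  rw [integral_zero] at h0
  refine h0.congr' ?_
  filter_upwards [hDC, hβ] with ε h1 h2
  have hSi : Integrable (fun ξ => S ε ξ * 𝓕 (cplx φ) ξ) := integrable_mul_schwartz (hSm ε)
    (norm_integral_symb_le h2)
  have hSi' : Integrable (fun ξ => S ε ξ / (θ ε : ℂ) * 𝓕 (cplx φ) ξ) := by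
    refine (hSi.const_mul (θ ε : ℂ)⁻¹).congr (ae_of_all _ fun ξ => ?_)
    simp only
    ring
  rw [← integral_norm_sq_fourierInv (integrable_mul_schwartz (hDm ε) h1)
    (memLp_mul_schwartz (hDm ε) h1)]
  congr with x
  congr 2
  have h3 : (((θ ε)⁻¹ * velAvg (testFun P a μ₀ (1 - θ ε * (1 - c)) ε φ) x : ℝ) : ℂ)
      = 𝓕⁻ (fun ξ => S ε ξ / (θ ε : ℂ) * 𝓕 (cplx φ) ξ) x := by
    rw [Complex.ofReal_mul, velAvg_testFun_eq_fourierInv h2, Real.fourierInv_eq',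
      Real.fourierInv_eq', ← integral_const_mul]
    congr with ξ
    simp only [smul_eq_mul, Complex.ofReal_inv, hS]
    ring
  rw [h3, fourierInv_sub hSi' (hm.integrable _)]
  simp only [sub_mul]

variable {σ : ℝ → ℝ} {σ₀ : ℝ} {Q : Pos n × Dir n → ℝ}

/-- The diffusion limit of the reduced equation: the solutions converge weakly to the solution of
the limit equation with symbol `m`. -/
lemma SymbolLimit.exists_limit (e : Dir n) (h : SymbolLimit P a (meanCosine σ e) c θ m)
    (hm : IsSymbol m) (hc1 : c < 1) (hσ_meas : Measurable σ)
    (hσ_norm : ∀ v : Dir n, ∫ v', σ (cosine v v') ∂dirMeasure n = 1) (hσ₀ : 0 < σ₀)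
    (hσ_lower : ∀ v v' : Dir n, σ₀ ≤ σ (cosine v v')) (hQ : MemLp Q 2 (phaseMeasure n))
    (hθ : ∀ᶠ ε in 𝓝[>] (0 : ℝ), 0 < θ ε) (hθ0 : Tendsto θ (𝓝[>] 0) (𝓝 0))
    {g : ℝ → Pos n × Dir n → ℝ}
    (hg : ∀ᶠ ε in 𝓝[>] (0 : ℝ),
      IsReduced P (fun v v' => σ (cosine v v') - θ ε * (1 - c)) Q ε (θ ε) (g ε)) :
    ∃ Ψ₀ : Pos n → ℝ, ∃ hΨ : MemLp Ψ₀ 2 volume,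
      (∀ h : Pos n × Dir n → ℝ, MemLp h 2 (phaseMeasure n) →
        Tendsto (fun ε => ∫ z, h z * g ε z ∂phaseMeasure n) (𝓝[>] 0)
          (𝓝 (∫ z, h z * Ψ₀ z.1 ∂phaseMeasure n))) ∧
      (∃ C : ℝ, ∀ᶠ ε in 𝓝[>] (0 : ℝ), ∫ z, g ε z ^ 2 ∂phaseMeasure n ≤ C) ∧
      ∀ᵐ ξ, (m ξ : ℂ) * (𝓕 (toC hΨ) : Lp ℂ 2 (volume : Measure (Pos n))) ξ
        = (𝓕 (toC (memLp_velAvg hQ).1) : Lp ℂ 2 (volume : Measure (Pos n))) ξ := by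
  obtain ⟨C, hC0, hest⟩ := IsReduced.estimates (P := P) hc1 hσ_meas hσ_norm hσ₀ hσ_lower hQ
  have hθsmall : ∀ᶠ ε in 𝓝[>] (0 : ℝ), 0 < θ ε ∧ θ ε ≤ 1 ∧ θ ε * (1 - c) ≤ σ₀ := by
    have h1 : Tendsto (fun ε => θ ε * (1 - c)) (𝓝[>] 0) (𝓝 0) := by
      simpa using hθ0.mul_const (1 - c)
    filter_upwards [hθ, hθ0.eventually (eventually_le_nhds zero_lt_one),
      h1.eventually (eventually_le_nhds hσ₀)] with ε h1 h2 h3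
    exact ⟨h1, h2, h3⟩
  set ρ' : ℝ → Pos n → ℝ := fun ε x => (1 - θ ε * (1 - c)) * velAvg (pathAvg P ε (g ε)) x with hρ'
  have hgood : ∀ᶠ ε in 𝓝[>] (0 : ℝ), ∫ z, g ε z ^ 2 ∂phaseMeasure n ≤ C ∧
      (MemLp (ρ' ε) 2 volume ∧ ∫ x, ρ' ε x ^ 2 ≤ C) ∧
      ∫ z, (g ε z - ρ' ε z.1) ^ 2 ∂phaseMeasure n ≤ C * θ ε := by
    filter_upwards [hθsmall, hg] with ε h1 h2
    obtain ⟨h3, h4, h5, h6⟩ := hest ε (θ ε) (g ε) h1.1 h1.2.1 h1.2.2 h2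
    exact ⟨h3, ⟨h4, h5⟩, h6⟩
  classical
  -- The weak-limit lemma asks for its bounds at every `ε`, whereas they hold only for small `ε`;
  -- elsewhere the family is set to zero.
  set ρ : ℝ → Pos n → ℝ := fun ε =>
    if MemLp (ρ' ε) 2 volume ∧ ∫ x, ρ' ε x ^ 2 ≤ C then ρ' ε else 0 with hρdef
  have hρ : ∀ ε, MemLp (ρ ε) 2 volume ∧ ∫ x, ρ ε x ^ 2 ≤ C := by
    intro ε
    simp only [hρdef]
    split_ifs with h1
    · exact h1
    · exact ⟨MemLp.zero, by simpa using hC0⟩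
  have hρeq : ∀ᶠ ε in 𝓝[>] (0 : ℝ), ρ ε = ρ' ε := by
    filter_upwards [hgood] with ε h1
    simp only [hρdef, if_pos h1.2.1]
  have hrem : ∀ F : ℝ → Pos n × Dir n → ℝ, (∀ ε, MemLp (F ε) 2 (phaseMeasure n)) →
      ∀ᶠ ε in 𝓝[>] (0 : ℝ), |∫ z, (g ε z - ρ ε z.1) * F ε z ∂phaseMeasure n|
        ≤ √C * √(θ ε) * √(∫ z, F ε z ^ 2 ∂phaseMeasure n) := by
    intro F hF
    filter_upwards [hgood, hρeq, hg] with ε h1 h2 h3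
    have h4 : MemLp (fun z => g ε z - ρ ε z.1) 2 (phaseMeasure n) :=
      h3.memLp.sub (memLp_fst (hρ ε).1)
    refine (abs_integral_mul_le h4 (hF ε)).trans ?_
    refine mul_le_mul_of_nonneg_right ?_ (Real.sqrt_nonneg _)
    rw [← Real.sqrt_mul hC0]
    refine Real.sqrt_le_sqrt ?_
    rw [h2]
    exact h1.2.2
  have hsplit : ∀ F : ℝ → Pos n × Dir n → ℝ, (∀ ε, MemLp (F ε) 2 (phaseMeasure n)) →
      ∀ᶠ ε in 𝓝[>] (0 : ℝ), ∫ z, g ε z * F ε z ∂phaseMeasure n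
        = (∫ x, ρ ε x * velAvg (F ε) x) + ∫ z, (g ε z - ρ ε z.1) * F ε z ∂phaseMeasure n := by
    intro F hF
    filter_upwards [hg] with ε h3
    have h5 := memLp_fst (n := n) (hρ ε).1
    have h4 : MemLp (fun z => g ε z - ρ ε z.1) 2 (phaseMeasure n) := h3.memLp.sub h5
    rw [← integral_fst_mul (hρ ε).1 (hF ε), ← integral_add (integrable_mul_of_memLp h5 (hF ε))
      (integrable_mul_of_memLp h4 (hF ε))]
    congr with z
    ring
  obtain ⟨Ψ₀, hΨ, hlim, heq⟩ := hm.exists_weak_limit (memLp_velAvg hQ).1 (l := 𝓝[>] (0 : ℝ))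
    (fun ε => (hρ ε).1) (fun ε => (hρ ε).2) (fun φ => by
      refine ⟨fun ε x => (θ ε)⁻¹ * velAvg (testFun P a (meanCosine σ e) (1 - θ ε * (1 - c)) ε φ) x,
        fun ε => (memLp_velAvg (memLp_testFun _ _ _ _ _)).1.const_mul _, h.tendsto_test hm hθ φ, ?_⟩
      set Φ : ℝ → Pos n × Dir n → ℝ :=
        fun ε => testFun P a (meanCosine σ e) (1 - θ ε * (1 - c)) ε φ with hΦdef
      have hΦ : ∀ ε, MemLp (Φ ε) 2 (phaseMeasure n) := fun ε => memLp_testFun _ _ _ _ _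
      obtain ⟨β, hβ0, hβ⟩ := h.small
      -- The weak form divided by `θ`: the source with its vanishing correction, minus what the
      -- velocity-dependent part `g - ρ` contributes.
      have hmain : ∀ᶠ ε in 𝓝[>] (0 : ℝ), ∫ x, ρ ε x * ((θ ε)⁻¹ * velAvg (Φ ε) x)
          = (∫ z, φ z.1 * Q z ∂phaseMeasure n
            + ε * (a * ∫ z, Q z * fderiv ℝ φ z.1 (z.2 : Pos n) ∂phaseMeasure n))
            - (θ ε)⁻¹ * ∫ z, (g ε z - ρ ε z.1) * Φ ε z ∂phaseMeasure n := by
        filter_upwards [hsplit Φ hΦ, hg, hθsmall] with ε h1 h2 h3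
        have h4 := h2.integral_mul_testFun hσ_meas hσ_norm hσ_lower e hQ h3.2.2 a φ
        have h5 : ∫ z, Q z * corrected φ 1 (ε * a) z ∂phaseMeasure n
            = ∫ z, φ z.1 * Q z ∂phaseMeasure n
              + ε * (a * ∫ z, Q z * fderiv ℝ φ z.1 (z.2 : Pos n) ∂phaseMeasure n) := by
          rw [← integral_const_mul, ← integral_const_mul,
            ← integral_add (integrable_mul_of_memLp (memLp_fst (φ.memLp 2 volume)) hQ)
              (((integrable_mul_of_memLp hQ (memLp_fderiv φ)).const_mul a).const_mul ε)]
          congr with z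
          rw [corrected]; ring
        rw [h5] at h4
        have h6 : ∫ x, ρ ε x * ((θ ε)⁻¹ * velAvg (Φ ε) x)
            = (θ ε)⁻¹ * ∫ x, ρ ε x * velAvg (Φ ε) x := by
          rw [← integral_const_mul]
          congr with x
          ring
        have h7 := h3.1.ne'
        rw [h6]
        rw [h1] at h4
        have h8 := eq_sub_of_add_eq h4
        rw [h8, mul_sub, inv_mul_cancel_left₀ h7]
      -- By Cauchy–Schwarz this is at most a constant times `θ⁻¹ · √θ · |β| = |β|/√θ`; hence the
      -- requirement that the unaveraged symbol be `o(√θ)`.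
      have hz : Tendsto (fun ε => (θ ε)⁻¹ * ∫ z, (g ε z - ρ ε z.1) * Φ ε z ∂phaseMeasure n)
          (𝓝[>] 0) (𝓝 0) := by
        have h1 := ((hβ0.abs).const_mul (√C * √(weightSq (𝓕 (cplx φ)))))
        rw [abs_zero, mul_zero] at h1
        refine squeeze_zero_norm' ?_ h1
        filter_upwards [hrem Φ hΦ, hβ, hθ] with ε h2 h3 h4
        rw [norm_mul, norm_inv, Real.norm_of_nonneg h4.le, Real.norm_eq_abs, inv_mul_le_iff₀ h4]
        refine h2.trans ?_
        have h5 : √(∫ z, Φ ε z ^ 2 ∂phaseMeasure n) ≤ |β ε| * √(weightSq (𝓕 (cplx φ))) := by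
          rw [← Real.sqrt_sq_eq_abs, ← Real.sqrt_mul (sq_nonneg _)]
          exact Real.sqrt_le_sqrt (integral_testFun_sq_le h3)
        refine (mul_le_mul_of_nonneg_left h5 (by positivity)).trans (le_of_eq ?_)
        rw [abs_div, abs_of_nonneg (Real.sqrt_nonneg (θ ε))]
        have h6 := Real.sqrt_pos.2 h4
        field_simp
        rw [Real.sq_sqrt h4.le]
        ring
      have hid : Tendsto (fun ε : ℝ => ∫ z, φ z.1 * Q z ∂phaseMeasure n
            + ε * (a * ∫ z, Q z * fderiv ℝ φ z.1 (z.2 : Pos n) ∂phaseMeasure n)) (𝓝[>] 0)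
          (𝓝 (∫ z, φ z.1 * Q z ∂phaseMeasure n)) := by
        have : Continuous (fun ε : ℝ => ∫ z, φ z.1 * Q z ∂phaseMeasure n
            + ε * (a * ∫ z, Q z * fderiv ℝ φ z.1 (z.2 : Pos n) ∂phaseMeasure n)) := by fun_prop
        simpa using (this.tendsto 0).mono_left (nhdsWithin_le_nhds (s := Ioi 0))
      have hfin := (hid.sub hz).congr' (hmain.mono fun ε hε => hε.symm)
      rw [sub_zero, integral_fst_mul (φ.memLp 2 volume) hQ] at hfin
      simpa only [mul_comm (φ _)] using hfin)
  refine ⟨Ψ₀, hΨ, fun F hF => ?_, ⟨C, hgood.mono fun ε h1 => h1.1⟩, heq⟩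
  -- Against a velocity-dependent test function, `ρ` sees only the velocity average of `F`, and `g -
  -- ρ` vanishes strongly.
  have h1 := hlim _ (memLp_velAvg hF).1
  have h2 : Tendsto (fun ε => ∫ z, (g ε z - ρ ε z.1) * F z ∂phaseMeasure n) (𝓝[>] 0) (𝓝 0) := by
    have h3 := ((hθ0.sqrt).const_mul (√C)).mul_const (√(∫ z, F z ^ 2 ∂phaseMeasure n))
    rw [Real.sqrt_zero, mul_zero, zero_mul] at h3
    exact squeeze_zero_norm' (hrem (fun _ => F) fun _ => hF) h3
  have h4 := h1.add h2
  have h5 : ∫ z, F z * Ψ₀ z.1 ∂phaseMeasure n = (∫ x, velAvg F x * Ψ₀ x) + 0 := by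
    rw [add_zero]
    simp only [mul_comm (F _), mul_comm (velAvg F _)]
    exact integral_fst_mul hΨ hF
  rw [h5]
  refine h4.congr' ?_
  filter_upwards [hsplit (fun _ => F) fun _ => hF] with ε h6
  simp only [mul_comm (F _), mul_comm (velAvg F _)]
  exact h6.symm

end Diffusion

end NonclassicalTransport

namespace NonclassicalTransport

variable {n : ℕ}

/-! ### From the Fourier identity to the limit equations. -/

section LimitEquation

open scoped SchwartzMap Laplacian

lemma memLp_of_ae_eq_coe {U : Lp ℂ 2 (volume : Measure (Pos n))} {u : Pos n → ℝ}
    (h : ∀ᵐ x, U x = (u x : ℂ)) : MemLp u 2 volume := by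
  refine (Lp.memLp U).re.ae_eq ?_
  filter_upwards [h] with x hx
  rw [hx]
  simp

lemma inner_toLp_coe {U : Lp ℂ 2 (volume : Measure (Pos n))} {u : Pos n → ℝ}
    (h : ∀ᵐ x, U x = (u x : ℂ)) (f : 𝓢(Pos n, ℂ)) {g : Pos n → ℝ} (hf : ∀ x, f x = (g x : ℂ)) :
    inner ℂ (f.toLp 2) U = ((∫ x, u x * g x : ℝ) : ℂ) := by
  rw [L2.inner_def, ← integral_complex_ofReal]
  refine integral_congr_ae ?_
  filter_upwards [h, f.coeFn_toLp 2 volume] with x h1 h2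
  rw [h1, h2, hf]
  simp

lemma fourier_neg_laplacian (f : 𝓢(Pos n, ℂ)) (ξ : Pos n) :
    𝓕 (-(Δ f)) ξ = (((2 * Real.pi * ‖ξ‖) ^ (2 : ℝ) : ℝ) : ℂ) * 𝓕 f ξ := by
  rw [FourierTransform.fourier_neg, SchwartzMap.laplacian_eq_fourierMultiplierCLM,
    SchwartzMap.fourierMultiplierCLM_apply, FourierTransform.fourier_smul,
    FourierTransform.fourier_fourierInv_eq]
  have ht : (fun x : Pos n => ‖x‖ ^ 2).HasTemperateGrowth := by fun_prop
  have h2 := SchwartzMap.smulLeftCLM_apply_apply (F := ℂ) ht (𝓕 f) ξ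
  rw [neg_apply, smul_apply, h2, Real.rpow_two, Complex.real_smul, Complex.real_smul]
  push_cast
  ring

/-- The Fourier multiplier of order two is the distributional Laplacian. -/
lemma IsFracLaplacian.isNegLaplacian {u w : Pos n → ℝ} (h : IsFracLaplacian 2 u w) :
    IsNegLaplacian u w := by
  obtain ⟨U, W, hU, hW, hUW⟩ := h
  refine ⟨memLp_of_ae_eq_coe hU, memLp_of_ae_eq_coe hW, fun g hg hgc => ?_⟩
  have hgc' : HasCompactSupport (fun x => (g x : ℂ)) := hgc.comp_left Complex.ofReal_zero
  have hg' : ContDiff ℝ ∞ (fun x => (g x : ℂ)) := Complex.ofRealCLM.contDiff.comp hg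
  set G : 𝓢(Pos n, ℂ) := hgc'.toSchwartzMap hg' with hG
  have hGx : ∀ x, G x = (g x : ℂ) := fun x => rfl
  have hΔ : ∀ x, (-(Δ G)) x = ((-(Laplacian.laplacian g x) : ℝ) : ℂ) := by
    intro x
    rw [neg_apply, SchwartzMap.laplacian_apply]
    have h1 : ContDiffAt ℝ 2 g x := (contDiff_infty.1 hg 2).contDiffAt
    have h2 := h1.laplacian_CLM_comp_left (l := Complex.ofRealCLM)
    have h3 : (G : Pos n → ℂ) = Complex.ofRealCLM ∘ g := rfl
    rw [h3, h2]
    simp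
  have e1 := inner_toLp_coe hU _ hΔ
  have e2 := inner_toLp_coe hW _ hGx
  refine Complex.ofReal_injective ?_
  have e3 : inner ℂ (𝓕 (G.toLp 2 volume) : Lp ℂ 2 (volume : Measure (Pos n))) (𝓕 W)
      = inner ℂ (G.toLp 2 volume) W := Lp.inner_fourier_eq _ _
  rw [← e1, ← e2, ← Lp.inner_fourier_eq, ← e3, SchwartzMap.toLp_fourier_eq,
    SchwartzMap.toLp_fourier_eq, L2.inner_def, L2.inner_def]
  refine integral_congr_ae ?_
  filter_upwards [hUW, (𝓕 G).coeFn_toLp 2 volume, (𝓕 (-(Δ G))).coeFn_toLp 2 volume] with ξ h1 h2 h3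
  rw [h1, h2, h3, fourier_neg_laplacian]
  simp only [RCLike.inner_apply, map_mul, Complex.conj_ofReal]
  ring

lemma SolvesFracDiffusion.solvesDiffusion {D κ : ℝ} {u f : Pos n → ℝ}
    (h : SolvesFracDiffusion 2 D κ u f) : SolvesDiffusion D κ u f := by
  obtain ⟨w, hw, he⟩ := h
  exact ⟨w, hw.isNegLaplacian, he⟩

lemma SolvesFracDiffusion.const_mul {α D κ : ℝ} {u f : Pos n → ℝ}
    (h : SolvesFracDiffusion α D κ u f) (b : ℝ) :
    SolvesFracDiffusion α D κ (fun x => b * u x) (fun x => b * f x) := by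
  obtain ⟨w, ⟨U, W, hU, hW, hUW⟩, he⟩ := h
  refine ⟨fun x => b * w x, ⟨(b : ℂ) • U, (b : ℂ) • W, ?_, ?_, ?_⟩, ?_⟩
  · filter_upwards [hU, Lp.coeFn_smul (b : ℂ) U] with x h1 h2
    rw [h2, Pi.smul_apply, h1, smul_eq_mul, Complex.ofReal_mul]
  · filter_upwards [hW, Lp.coeFn_smul (b : ℂ) W] with x h1 h2
    rw [h2, Pi.smul_apply, h1, smul_eq_mul, Complex.ofReal_mul]
  · rw [FourierTransform.fourier_smul, FourierTransform.fourier_smul]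
    filter_upwards [hUW, Lp.coeFn_smul (b : ℂ) (𝓕 U : Lp ℂ 2 (volume : Measure (Pos n))),
      Lp.coeFn_smul (b : ℂ) (𝓕 W : Lp ℂ 2 (volume : Measure (Pos n)))] with ξ h1 h2 h3
    rw [h2, h3, Pi.smul_apply, Pi.smul_apply, h1, smul_eq_mul, smul_eq_mul]
    ring
  · filter_upwards [he] with x hx
    rw [← hx]; ring

/-- The symbol of the limit equation. -/
noncomputable def limitSymbol (α D κ : ℝ) (ξ : Pos n) : ℝ := D * (2 * Real.pi * ‖ξ‖) ^ α + κ

lemma isSymbol_limitSymbol {α D κ : ℝ} (hα : 0 < α) (hα2 : α ≤ 2) (hD : 0 ≤ D) (hκ : 0 < κ) :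
    IsSymbol (limitSymbol (n := n) α D κ) := by
  have h0 : ∀ ξ : Pos n, 0 ≤ (2 * Real.pi * ‖ξ‖) ^ α := fun ξ => by positivity
  refine ⟨?_, ⟨κ, hκ, fun ξ => ?_⟩, ⟨D * (1 + (2 * Real.pi) ^ 2) + κ, fun ξ => ?_⟩⟩
  · unfold limitSymbol
    have : Continuous (fun ξ : Pos n => (2 * Real.pi * ‖ξ‖) ^ α) :=
      Continuous.rpow_const (by fun_prop) fun _ => Or.inr hα.le
    fun_prop
  · have := mul_nonneg hD (h0 ξ)
    unfold limitSymbol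
    linarith
  · have h1 : (2 * Real.pi * ‖ξ‖) ^ α ≤ (1 + (2 * Real.pi) ^ 2) * (1 + ‖ξ‖ ^ 2) := by
      have h2 : 0 ≤ 2 * Real.pi * ‖ξ‖ := by positivity
      have h3 : (2 * Real.pi * ‖ξ‖) ^ α ≤ 1 + (2 * Real.pi * ‖ξ‖) ^ 2 := by
        rcases le_total (2 * Real.pi * ‖ξ‖) 1 with h | h
        · exact (Real.rpow_le_one h2 h hα.le).trans (le_add_of_nonneg_right (sq_nonneg _))
        · refine (Real.rpow_le_rpow_of_exponent_le h hα2).trans ?_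
          rw [Real.rpow_two]
          linarith
      have h4 : 0 ≤ ‖ξ‖ ^ 2 + (2 * Real.pi) ^ 2 := by positivity
      rw [mul_pow] at h3
      linarith
    rw [Complex.norm_real, limitSymbol, Real.norm_of_nonneg (add_nonneg (mul_nonneg hD (h0 ξ)) hκ.le)]
    have h5 := mul_le_mul_of_nonneg_left h1 hD
    have h6 : 0 ≤ κ * ‖ξ‖ ^ 2 := by positivity
    linarith

/-- Since `D > 0`, the equation itself defines the candidate `w = D⁻¹(f - κu)` in `L²`, and the
Fourier identity says that `w` is the required multiple of `u`. -/
lemma solvesFracDiffusion_of_fourier {α D κ : ℝ} (hD : 0 < D) {u f : Pos n → ℝ} (hu : MemLp u 2 volume)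
    (hf : MemLp f 2 volume)
    (h : ∀ᵐ ξ, (limitSymbol α D κ ξ : ℂ) * (𝓕 (toC hu) : Lp ℂ 2 (volume : Measure (Pos n))) ξ
      = (𝓕 (toC hf) : Lp ℂ 2 (volume : Measure (Pos n))) ξ) : SolvesFracDiffusion α D κ u f := by
  refine ⟨fun x => D⁻¹ * (f x - κ * u x), ⟨toC hu, (D⁻¹ : ℂ) • (toC hf - (κ : ℂ) • toC hu),
    coeFn_toC hu, ?_, ?_⟩, ae_of_all _ fun x => ?_⟩
  · filter_upwards [coeFn_toC hu, coeFn_toC hf, Lp.coeFn_smul (D⁻¹ : ℂ) (toC hf - (κ : ℂ) • toC hu),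
      Lp.coeFn_sub (toC hf) ((κ : ℂ) • toC hu), Lp.coeFn_smul (κ : ℂ) (toC hu)] with x h1 h2 h3 h4 h5
    rw [h3, Pi.smul_apply, h4, Pi.sub_apply, h5, Pi.smul_apply, h1, h2]
    simp
  · rw [FourierTransform.fourier_smul, sub_eq_add_neg, FourierTransform.fourier_add,
      FourierTransform.fourier_neg, FourierTransform.fourier_smul, ← sub_eq_add_neg]
    set A := (𝓕 (toC hu) : Lp ℂ 2 (volume : Measure (Pos n)))
    set B := (𝓕 (toC hf) : Lp ℂ 2 (volume : Measure (Pos n)))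
    filter_upwards [h, Lp.coeFn_smul (D⁻¹ : ℂ) (B - (κ : ℂ) • A),
      Lp.coeFn_sub B ((κ : ℂ) • A), Lp.coeFn_smul (κ : ℂ) A] with x h1 h3 h4 h5
    rw [h3, Pi.smul_apply, h4, Pi.sub_apply, h5, Pi.smul_apply, ← h1, limitSymbol]
    have hD' : (D : ℂ) ≠ 0 := Complex.ofReal_ne_zero.2 hD.ne'
    simp only [smul_eq_mul, Complex.ofReal_add, Complex.ofReal_mul]
    field_simp
    ring
  · rw [mul_inv_cancel_left₀ hD.ne']; ring

end LimitEquation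

end NonclassicalTransport

namespace NonclassicalTransport

variable {n : ℕ}

/-! ### The scaling function `θ(ε)`. -/

section Scaling

lemma scaling_of_lt {α : ℝ} (h : α < 2) : scaling α = fun ε => ε ^ α := by
  funext ε; simp [scaling, h]

lemma scaling_two : scaling 2 = fun ε => -(ε ^ 2 * Real.log ε) := by
  funext ε; simp [scaling]

lemma scaling_of_gt {α : ℝ} (h : 2 < α) : scaling α = fun ε => ε ^ 2 := by
  funext ε; simp [scaling, h.ne', h.le]

lemma eventually_scaling_pos (α : ℝ) : ∀ᶠ ε in 𝓝[>] (0 : ℝ), 0 < scaling α ε := by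
  filter_upwards [eventually_pos_small one_pos] with ε ⟨h0, h1⟩
  unfold scaling
  split_ifs
  · exact Real.rpow_pos_of_pos h0 α
  · have := mul_neg_of_pos_of_neg (pow_pos h0 2) (Real.log_neg h0 h1)
    linarith
  · exact pow_pos h0 2

lemma tendsto_scaling {α : ℝ} (hα : 0 < α) : Tendsto (scaling α) (𝓝[>] 0) (𝓝 0) := by
  have hpow : ∀ β : ℝ, 0 < β → Tendsto (fun ε : ℝ => ε ^ β) (𝓝[>] 0) (𝓝 0) := fun β hβ => by
    have := ((Real.continuous_rpow_const hβ.le).tendsto 0).mono_left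
      (nhdsWithin_le_nhds (s := Ioi 0))
    rwa [Real.zero_rpow hβ.ne'] at this
  rcases lt_trichotomy α 2 with h | rfl | h
  · rw [scaling_of_lt h]; exact hpow α hα
  · rw [scaling_two]
    have := (tendsto_log_mul_rpow_nhdsGT_zero (r := 2) two_pos).neg
    simp only [Real.rpow_two, neg_zero] at this
    simpa only [mul_comm] using this
  · rw [scaling_of_gt h]
    simpa only [Real.rpow_two] using hpow 2 two_pos

/-- The ratio is `ε^{1-α/2}` or `1/√(-log ε)`. For `α > 2` it equals one, which is why only that
regime needs a corrector. -/
lemma tendsto_div_sqrt_scaling {α : ℝ} (hα : α ≤ 2) :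
    Tendsto (fun ε => ε / √(scaling α ε)) (𝓝[>] 0) (𝓝 0) := by
  rcases hα.lt_or_eq with h | rfl
  · rw [scaling_of_lt h]
    have hβ : 0 < 1 - α / 2 := by linarith
    have h1 := ((Real.continuous_rpow_const hβ.le).tendsto 0).mono_left
      (nhdsWithin_le_nhds (s := Ioi 0))
    rw [Real.zero_rpow hβ.ne'] at h1
    refine h1.congr' ?_
    filter_upwards [self_mem_nhdsWithin] with ε hε
    have hε : 0 < ε := hε
    rw [Real.rpow_sub hε, Real.rpow_one, Real.sqrt_eq_rpow, ← Real.rpow_mul hε.le]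
    congr 2
    ring
  · rw [scaling_two]
    have h1 : Tendsto (fun ε => √(-Real.log ε)) (𝓝[>] 0) atTop :=
      Real.tendsto_sqrt_atTop.comp (tendsto_neg_atBot_atTop.comp Real.tendsto_log_nhdsGT_zero)
    refine (h1.inv_tendsto_atTop).congr' ?_
    filter_upwards [eventually_pos_small one_pos] with ε ⟨h0, h2⟩
    have h3 : -(ε ^ 2 * Real.log ε) = ε ^ 2 * (-Real.log ε) := by ring
    have h4 : 0 < √(-Real.log ε) := Real.sqrt_pos.2 (neg_pos.2 (Real.log_neg h0 h2))
    rw [h3, Real.sqrt_mul (sq_nonneg ε), Real.sqrt_sq h0.le]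
    simp only [Pi.inv_apply]
    field_simp

end Scaling

/-! ### The diffusion coefficients: identification, independence of the axis, positivity. -/

section Coefficients

variable [NeZero n]

lemma integral_abs_two_pi_inner_rpow (α : ℝ) (ξ : Pos n) (e : Dir n) :
    ∫ v : Dir n, |2 * Real.pi * inner ℝ (v : Pos n) ξ| ^ α ∂dirMeasure n
      = (2 * Real.pi * ‖ξ‖) ^ α * ∫ v, |cosine v e| ^ α ∂dirMeasure n := by
  have h : ∀ v : Dir n, |2 * Real.pi * inner ℝ (v : Pos n) ξ| ^ α
      = (2 * Real.pi) ^ α * |inner ℝ (v : Pos n) ξ| ^ α := fun v => by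
    rw [abs_mul, abs_of_pos Real.two_pi_pos, Real.mul_rpow Real.two_pi_pos.le (abs_nonneg _)]
  simp only [h]
  rw [integral_const_mul, integral_abs_inner_rpow α ξ e,
    Real.mul_rpow Real.two_pi_pos.le (norm_nonneg _), mul_assoc]

lemma symbol_eq_limitSymbol (ℓ α κ : ℝ) (e : Dir n) :
    (fun ξ : Pos n => ℓ * (∫ v : Dir n, |2 * Real.pi * inner ℝ (v : Pos n) ξ| ^ α ∂dirMeasure n) + κ)
      = limitSymbol α (ℓ * ∫ v, |cosine v e| ^ α ∂dirMeasure n) κ := by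
  funext ξ
  rw [integral_abs_two_pi_inner_rpow α ξ e, limitSymbol]
  ring

lemma integral_abs_cosine_two (e : Dir n) :
    ∫ v, |cosine v e| ^ (2 : ℝ) ∂dirMeasure n = 1 / n := by
  simp only [Real.rpow_two, sq_abs]
  exact integral_cosine_sq e

/-- As `|cos| ≤ 1` and `α ≤ 2`, the integrand dominates `cos²`, whose mean is `1/n`. -/
lemma integral_abs_cosine_rpow_pos {α : ℝ} (hα : 0 < α) (hα2 : α ≤ 2) (e : Dir n) :
    0 < ∫ v, |cosine v e| ^ α ∂dirMeasure n := by
  have hn : (0 : ℝ) < 1 / n := by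
    have : 0 < n := Nat.pos_of_ne_zero (NeZero.ne n)
    positivity
  have hc : Continuous (fun v : Dir n => |cosine v e| ^ α) :=
    Continuous.rpow_const (continuous_cosine.comp (continuous_id.prodMk continuous_const)).abs
      fun _ => Or.inr hα.le
  refine hn.trans_le ?_
  rw [← integral_cosine_sq e]
  refine integral_mono (integrable_cosine_sq e)
    (hc.integrable_of_hasCompactSupport (HasCompactSupport.of_compactSpace _)) fun v => ?_
  simp only
  rw [← sq_abs, ← Real.rpow_two]
  rcases (abs_nonneg (cosine v e)).eq_or_lt with h | h
  · rw [← h, Real.zero_rpow two_ne_zero, Real.zero_rpow hα.ne']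
  · exact Real.rpow_le_rpow_of_exponent_ge h (abs_cosine_le_one v e) hα2

lemma integral_tailProfile_pos {α : ℝ} (hα : 1 < α) (hα2 : α < 2) :
    0 < ∫ s in Ioi 0, tailProfile α 1 s := by
  rw [setIntegral_pos_iff_support_of_nonneg_ae
    ((ae_restrict_mem measurableSet_Ioi).mono fun s hs => tailProfile_nonneg α 1 hs)
    (integrableOn_tailProfile hα hα2 1)]
  have hsub : Ioo (0 : ℝ) 1 ⊆ Function.support (tailProfile α 1) ∩ Ioi 0 := by
    intro s hs
    refine ⟨?_, hs.1⟩
    rw [Function.mem_support, tailProfile, mul_one]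
    refine mul_ne_zero (Real.rpow_pos_of_pos hs.1 _).ne' (sub_ne_zero.2 fun h => ?_)
    have := (Real.cos_eq_one_iff_of_lt_of_lt (by linarith [hs.1, Real.pi_pos])
      (by linarith [hs.2, Real.pi_gt_three])).1 h.symm
    exact hs.1.ne' this
  refine lt_of_lt_of_le ?_ (measure_mono hsub)
  simp

omit [NeZero n] in
-- Use `sin²(x/2) = (1 - cos x)/2` and the scaling of the tail profile in `v·e`.
lemma coeffFrac_eq {α : ℝ} (hα : 0 < α) (d₀ : ℝ) (e : Dir n) :
    coeffFrac α d₀ e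
      = (d₀ * ∫ s in Ioi 0, tailProfile α 1 s) * ∫ v, |cosine v e| ^ α ∂dirMeasure n := by
  have h : ∀ v : Dir n, ∫ τ, Real.sin (τ * cosine v e / 2) ^ 2 / τ ^ (α + 1) ∂pathMeasure
      = (∫ s in Ioi 0, tailProfile α 1 s) / 2 * |cosine v e| ^ α := by
    intro v
    rw [div_mul_eq_mul_div, mul_comm, ← integral_tailProfile_scale α _ hα.ne', ← integral_div]
    refine setIntegral_congr_fun measurableSet_Ioi fun τ hτ => ?_
    have hτ : 0 < τ := hτ
    simp only [tailProfile]
    have h1 : Real.sin (τ * cosine v e / 2) ^ 2 = (1 - Real.cos (τ * cosine v e)) / 2 := by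
      rw [Real.sin_sq_eq_half_sub]
      ring_nf
    have h2 : τ ^ (-α - 1) = (τ ^ (α + 1))⁻¹ := by
      rw [← Real.rpow_neg hτ.le]; congr 1; ring
    rw [h1, h2]
    ring
  simp only [coeffFrac, h]
  rw [integral_const_mul]
  ring

variable {σ p : ℝ → ℝ} {σ₀ : ℝ}

lemma integrable_id_pathLaw (hp0 : ∀ s, 0 < s → 0 ≤ p s) (hp : Integrable p pathMeasure)
    (hp_mean : Integrable (fun s => s * p s) pathMeasure) :
    Integrable (fun τ : ℝ => τ) (pathLaw p) := by
  rw [integrable_pathLaw_iff hp0 hp.aemeasurable]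
  simpa only [smul_eq_mul, mul_comm] using hp_mean

lemma coeffSmallTail_eq (hp0 : ∀ s, 0 < s → 0 ≤ p s) (hp : Integrable p pathMeasure) (e e' : Dir n) :
    coeffSmallTail σ p e = ((∫ τ, τ ^ 2 ∂pathLaw p) / 2
      + (∫ τ, τ ∂pathLaw p) / (1 - meanCosine σ e') * meanCosine σ e' * ∫ τ, τ ∂pathLaw p)
      * ∫ v, |cosine v e'| ^ (2 : ℝ) ∂dirMeasure n := by
  rw [integral_pathLaw hp0 hp.aemeasurable, integral_pathLaw hp0 hp.aemeasurable,
    integral_abs_cosine_two, meanCosine_congr e' e, coeffSmallTail]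
  simp only [smul_eq_mul]
  have hn : (n : ℝ) ≠ 0 := Nat.cast_ne_zero.2 (NeZero.ne n)
  field_simp
  ring

/-- With `m₁` and `M` the first two moments, the sign is that of `M(1-μ) + 2m₁²μ`. For `μ ≤ 0`, `m₁²
≤ M` bounds it below by `M(1+μ)`; then `|μ| < 1` concludes. `M > 0` because path lengths are
positive. -/
lemma coeffSmallTail_pos (hp0 : ∀ s, 0 < s → 0 ≤ p s) (hp_one : ∫ s, p s ∂pathMeasure = 1)
    (hp : Integrable p pathMeasure) (h1 : Integrable (fun τ : ℝ => τ) (pathLaw p))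
    (h2 : Integrable (fun τ : ℝ => τ ^ 2) (pathLaw p)) (hσ₀ : 0 < σ₀)
    (hσ_lower : ∀ v v' : Dir n, σ₀ ≤ σ (cosine v v'))
    (hσ_norm : ∀ v : Dir n, ∫ v', σ (cosine v v') ∂dirMeasure n = 1) (e : Dir n) :
    0 < coeffSmallTail σ p e := by
  have hP := isProbabilityMeasure_pathLaw hp0 hp_one
  have hμ := abs_lt.1 (abs_meanCosine_lt_one hσ₀ hσ_lower hσ_norm e)
  rw [coeffSmallTail_eq hp0 hp e e]
  refine mul_pos ?_ (integral_abs_cosine_rpow_pos two_pos le_rfl e)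
  set μ := meanCosine σ e
  have hm : (∫ τ, τ ∂pathLaw p) ^ 2 ≤ ∫ τ, τ ^ 2 ∂pathLaw p := by
    have := sq_integral_weight_mul_le (ν := pathLaw p) (k := fun _ => 1) (f := fun τ : ℝ => τ)
      (integrable_const 1) (fun _ => zero_le_one) h1.1 (by simpa using h2)
    simpa using this
  have hM : 0 < ∫ τ, τ ^ 2 ∂pathLaw p := by
    refine lt_of_le_of_ne (integral_nonneg fun _ => sq_nonneg _) fun h => ?_
    have h3 := (integral_eq_zero_iff_of_nonneg (fun τ => sq_nonneg τ) h2).1 h.symm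
    have h4 : ∀ᵐ τ ∂pathLaw p, False := by
      filter_upwards [h3, ae_pos_pathLaw (p := p)] with τ h5 h6
      exact (pow_pos h6 2).ne' h5
    simp at h4
    exact IsProbabilityMeasure.ne_zero (pathLaw p) h4
  set m₁ := ∫ τ, τ ∂pathLaw p
  set M := ∫ τ, τ ^ 2 ∂pathLaw p
  have hμ1 : 0 < 1 - μ := by linarith [hμ.2]
  have h5 : M / 2 + m₁ / (1 - μ) * μ * m₁ = (M * (1 - μ) + 2 * (m₁ ^ 2 * μ)) / (2 * (1 - μ)) := by
    field_simp
  rw [h5]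
  refine div_pos ?_ (by linarith)
  rcases le_total 0 μ with h6 | h6
  · have := mul_pos hM hμ1
    have := mul_nonneg (sq_nonneg m₁) h6
    linarith
  · have h7 : M * μ ≤ m₁ ^ 2 * μ := mul_le_mul_of_nonpos_right hm h6
    have h8 : 0 < M * (1 + μ) := mul_pos hM (by linarith [hμ.1])
    linarith

/-- The limit of the symbols in every regime of the tail exponent. -/
lemma exists_symbolLimit {c α d₀ : ℝ} (hc0 : 0 < c) (hc1 : c < 1) (hp0 : ∀ s, 0 < s → 0 ≤ p s)
    (hp_one : ∫ s, p s ∂pathMeasure = 1) (hp : Integrable p pathMeasure)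
    (hp_mean : Integrable (fun s => s * p s) pathMeasure) (hα : 1 < α) (hd₀ : 0 < d₀)
    (hp_tail : ∀ s : ℝ, 1 < s → p s = d₀ / s ^ (α + 1)) (hσ₀ : 0 < σ₀)
    (hσ_lower : ∀ v v' : Dir n, σ₀ ≤ σ (cosine v v'))
    (hσ_norm : ∀ v : Dir n, ∫ v', σ (cosine v v') ∂dirMeasure n = 1) (e : Dir n) :
    ∃ a α' D : ℝ, 0 < α' ∧ α' ≤ 2 ∧ 0 < D ∧
      SymbolLimit (n := n) (pathLaw p) a (meanCosine σ e) c (scaling α) (limitSymbol α' D (1 - c)) ∧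
      (2 < α → α' = 2 ∧ ∀ e' : Dir n, coeffSmallTail σ p e' = D) ∧
      (α < 2 → α' = α ∧ ∀ e' : Dir n, coeffFrac α d₀ e' = D) ∧
      (α = 2 → α' = 2 ∧ ∀ e' : Dir n, coeffBorderline d₀ e' = D) := by
  have hP := isProbabilityMeasure_pathLaw hp0 hp_one
  have h1 := integrable_id_pathLaw hp0 hp hp_mean
  have hθ := eventually_scaling_pos α
  have hθ0 := tendsto_scaling (zero_lt_one.trans hα)
  have hcos : ∀ (β : ℝ) (e' : Dir n), ∫ v, |cosine v e'| ^ β ∂dirMeasure n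
      = ∫ v, |cosine v e| ^ β ∂dirMeasure n := fun β e' => by
    simp only [cosine_comm _ e', cosine_comm _ e]
    exact integral_cosine_congr (fun x => |x| ^ β) e' e
  rcases lt_trichotomy α 2 with h | rfl | h
  · have hs := tailScaling_of_lt_two hp0 hp_one hp hα h hd₀ hp_tail
    rw [← scaling_of_lt h] at hs
    have hlim := symbolLimit_of_uncorrected (n := n) hs hc0 hc1 hθ hθ0
      (tendsto_div_sqrt_scaling h.le) h1 (meanCosine σ e)
    rw [symbol_eq_limitSymbol _ _ _ e] at hlim
    refine ⟨0, α, _, by linarith, h.le, ?_, hlim, fun h' => absurd h' (not_lt.2 h.le), fun _ =>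
      ⟨rfl, fun e' => ?_⟩, fun h' => absurd h' h.ne⟩
    · exact mul_pos (mul_pos hd₀ (integral_tailProfile_pos hα h))
        (integral_abs_cosine_rpow_pos (by linarith) h.le e)
    · rw [coeffFrac_eq (by linarith), hcos]
  · have hs := tailScaling_two hp0 hp_one hp hd₀ hp_tail
    rw [← scaling_two] at hs
    have hlim := symbolLimit_of_uncorrected (n := n) hs hc0 hc1 hθ hθ0
      (tendsto_div_sqrt_scaling le_rfl) h1 (meanCosine σ e)
    rw [symbol_eq_limitSymbol _ _ _ e] at hlim
    refine ⟨0, 2, _, two_pos, le_rfl, ?_, hlim, fun h' => absurd h' (lt_irrefl _),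
      fun h' => absurd h' (lt_irrefl _), fun _ => ⟨rfl, fun e' => ?_⟩⟩
    · exact mul_pos (half_pos hd₀) (integral_abs_cosine_rpow_pos two_pos le_rfl e)
    · rw [coeffBorderline, integral_cosine_sq, integral_abs_cosine_two]
  · have h2 : Integrable (fun τ : ℝ => τ ^ 2) (pathLaw p) := by
      rw [integrable_pathLaw_iff hp0 hp.aemeasurable]
      exact integrable_sq_mul h hp_tail hp
    have hμ := (abs_lt.1 (abs_meanCosine_lt_one hσ₀ hσ_lower hσ_norm e)).2
    -- The corrector `a = m₁/(1-μ₀)` is the one that cancels the first order; it is defined because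
    -- `μ₀ < 1`.
    have hlim := symbolLimit_of_sq (n := n) (P := pathLaw p) (μ₀ := meanCosine σ e)
      (a := (∫ τ, τ ∂pathLaw p) / (1 - meanCosine σ e)) hc0 hc1 h1 h2
      (div_mul_cancel₀ _ (by linarith))
    rw [symbol_eq_limitSymbol _ _ _ e] at hlim
    refine ⟨_, 2, _, two_pos, le_rfl, ?_, (by rw [scaling_of_gt h]; exact hlim), fun _ => ⟨rfl, fun e' => ?_⟩,
      fun h' => absurd h' (not_lt.2 h.le), fun h' => absurd h' h.ne'⟩
    · rw [← coeffSmallTail_eq hp0 hp e e]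
      exact coeffSmallTail_pos hp0 hp_one hp h1 h2 hσ₀ hσ_lower hσ_norm e
    · rw [← coeffSmallTail_eq hp0 hp e' e]

end Coefficients

end NonclassicalTransport

namespace NonclassicalTransport

variable {n : ℕ}

/-! ### Stability of weak convergence under shifts, averages and kernels. -/

section WeakConvergence

lemma TendstoWeakL2.congr {X : Type*} [MeasurableSpace X] {μ : Measure X} {f f' : ℝ → X → ℝ}
    {f₀ f₀' : X → ℝ} (h : TendstoWeakL2 μ f f₀) (hf : ∀ᶠ ε in 𝓝[>] (0 : ℝ), f ε =ᵐ[μ] f' ε)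
    (h₀ : f₀ =ᵐ[μ] f₀') : TendstoWeakL2 μ f' f₀' := by
  refine ⟨?_, h.2.1.ae_eq h₀, fun F hF => ?_⟩
  · filter_upwards [h.1, hf] with ε h1 h2 using h1.ae_eq h2
  have h3 : ∫ z, F z * f₀ z ∂μ = ∫ z, F z * f₀' z ∂μ :=
    integral_congr_ae (h₀.mono fun z hz => by simp only [hz])
  rw [← h3]
  refine (h.2.2 F hF).congr' ?_
  filter_upwards [hf] with ε h1
  exact integral_congr_ae (h1.mono fun z hz => by simp only [hz])

lemma TendstoWeakL2.const_mul {X : Type*} [MeasurableSpace X] {μ : Measure X} {f : ℝ → X → ℝ}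
    {f₀ : X → ℝ} (h : TendstoWeakL2 μ f f₀) (b : ℝ) :
    TendstoWeakL2 μ (fun ε x => b * f ε x) (fun x => b * f₀ x) := by
  refine ⟨h.1.mono fun ε h1 => h1.const_mul b, h.2.1.const_mul b, fun F hF => ?_⟩
  simp only [mul_left_comm _ b, integral_const_mul]
  exact (h.2.2 F hF).const_mul b

variable [NeZero n] {k : Dir n → Dir n → ℝ} {m : ℝ} {g : ℝ → Pos n × Dir n → ℝ}
  {f : ℝ → Pos n × Dir n → ℝ} {f₀ : Pos n × Dir n → ℝ} {C : ℝ}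

lemma TendstoWeakL2.kernelOp (h : TendstoWeakL2 (phaseMeasure n) f f₀) (hk : IsKernel k m) :
    TendstoWeakL2 (phaseMeasure n) (fun ε => kernelOp k (f ε)) (kernelOp k f₀) := by
  refine ⟨h.1.mono fun ε h1 => (hk.memLp_kernelOp h1).1, (hk.memLp_kernelOp h.2.1).1,
    fun F hF => ?_⟩
  rw [← hk.integral_kernelOp_mul hF h.2.1]
  refine (h.2.2 _ (hk.memLp_kernelOp hF).1).congr' ?_
  filter_upwards [h.1] with ε h1
  exact hk.integral_kernelOp_mul hF h1

lemma TendstoWeakL2.velAvg (h : TendstoWeakL2 (phaseMeasure n) f f₀) :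
    TendstoWeakL2 volume (fun ε => velAvg (f ε)) (velAvg f₀) := by
  refine ⟨h.1.mono fun ε h1 => (memLp_velAvg h1).1, (memLp_velAvg h.2.1).1, fun F hF => ?_⟩
  rw [← integral_fst_mul hF h.2.1]
  refine (h.2.2 _ (memLp_fst hF)).congr' ?_
  filter_upwards [h.1] with ε h1
  exact integral_fst_mul hF h1

omit [NeZero n] in
lemma integral_mul_shift (t : ℝ) (F G : Pos n × Dir n → ℝ) :
    ∫ z, F z * G (shift t z) ∂phaseMeasure n = ∫ z, F (shift (-t) z) * G z ∂phaseMeasure n := by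
  rw [← integral_shift t fun z => F (shift (-t) z) * G z]
  congr with z
  have := shift_shift_neg (-t) z
  rw [neg_neg] at this
  rw [this]

omit [NeZero n] in
/-- Vanishing shifts do not affect weak limits. -/
lemma TendstoWeakL2.tendsto_integral_mul_shift (h : TendstoWeakL2 (phaseMeasure n) g f₀)
    (hC : ∀ᶠ ε in 𝓝[>] (0 : ℝ), ∫ z, g ε z ^ 2 ∂phaseMeasure n ≤ C) {F : Pos n × Dir n → ℝ}
    (hF : MemLp F 2 (phaseMeasure n)) (s : ℝ) :
    Tendsto (fun ε => ∫ z, F z * g ε (shift (ε * s) z) ∂phaseMeasure n) (𝓝[>] (0 : ℝ))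
      (𝓝 (∫ z, F z * f₀ z ∂phaseMeasure n)) := by
  have ht : Tendsto (fun ε : ℝ => -(ε * s)) (𝓝[>] (0 : ℝ)) (𝓝 0) := by
    have : Continuous fun ε : ℝ => -(ε * s) := by fun_prop
    simpa using (this.tendsto 0).mono_left nhdsWithin_le_nhds
  -- The shift is moved onto the fixed function `F`, where it converges strongly; the bounded family
  -- `g` then only pairs with a vanishing error.
  have h1 := ((tendsto_integral_shift_sub_sq hF).comp ht).sqrt.mul_const (√C)
  simp only [Function.comp, Real.sqrt_zero, zero_mul] at h1
  have h2 : Tendsto (fun ε => ∫ z, (F (shift (-(ε * s)) z) - F z) * g ε z ∂phaseMeasure n)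
      (𝓝[>] (0 : ℝ)) (𝓝 0) := by
    refine squeeze_zero_norm' ?_ h1
    filter_upwards [h.1, hC] with ε h3 h4
    rw [Real.norm_eq_abs]
    refine (abs_integral_mul_le ((hF.comp_measurePreserving (measurePreserving_shift _)).sub hF)
      h3).trans ?_
    exact mul_le_mul_of_nonneg_left (Real.sqrt_le_sqrt h4) (Real.sqrt_nonneg _)
  have h3 := (h.2.2 F hF).add h2
  rw [add_zero] at h3
  refine h3.congr' ?_
  filter_upwards [h.1] with ε h4
  have hF' : MemLp (fun z => F (shift (-(ε * s)) z)) 2 (phaseMeasure n) :=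
    hF.comp_measurePreserving (measurePreserving_shift _)
  have h5 : Integrable (fun z => (F (shift (-(ε * s)) z) - F z) * g ε z) (phaseMeasure n) :=
    integrable_mul_of_memLp (hF'.sub hF) h4
  rw [integral_mul_shift, ← integral_add (integrable_mul_of_memLp hF h4) h5]
  congr with z
  ring

omit [NeZero n] in
lemma abs_integral_mul_shift_le {F G : Pos n × Dir n → ℝ} (hF : MemLp F 2 (phaseMeasure n))
    (hG : MemLp G 2 (phaseMeasure n)) (t : ℝ) :
    |∫ z, F z * G (shift t z) ∂phaseMeasure n|
      ≤ (eLpNorm F 2 (phaseMeasure n)).toReal * √(∫ z, G z ^ 2 ∂phaseMeasure n) := by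
  have h1 := abs_integral_mul_le hF (hG.comp_measurePreserving (measurePreserving_shift t))
  rw [← sq_eLpNorm_toReal hF, Real.sqrt_sq ENNReal.toReal_nonneg] at h1
  simp only [Function.comp] at h1
  rwa [integral_shift t fun z => G z ^ 2] at h1

omit [NeZero n] in
/-- Weak-* limits of transported functions. -/
lemma TendstoWeakL2.tendsto_integral_transported {ν : Measure ℝ} [SFinite ν]
    (h : TendstoWeakL2 (phaseMeasure n) g f₀)
    (hC : ∀ᶠ ε in 𝓝[>] (0 : ℝ), ∫ z, g ε z ^ 2 ∂phaseMeasure n ≤ C)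
    {F : ℝ → Pos n × Dir n → ℝ}
    (hF : AEStronglyMeasurable (fun y : ℝ × (Pos n × Dir n) => F y.1 y.2)
      (ν.prod (phaseMeasure n)))
    (hF' : ∫⁻ s, eLpNorm (F s) 2 (phaseMeasure n) ∂ν < ⊤) :
    Tendsto (fun ε => ∫ s, ∫ z, F s z * g ε (shift (ε * s) z) ∂phaseMeasure n ∂ν) (𝓝[>] (0 : ℝ))
      (𝓝 (∫ s, ∫ z, F s z * f₀ z ∂phaseMeasure n ∂ν)) := by
  have hmeas : AEMeasurable (fun s => eLpNorm (F s) 2 (phaseMeasure n)) ν := by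
    simp only [eLpNorm_eq_lintegral_rpow_enorm_toReal two_ne_zero ENNReal.ofNat_ne_top]
    exact (((hF.enorm.pow_const _).lintegral_prod_right').pow_const _)
  have hmem : ∀ᵐ s ∂ν, MemLp (F s) 2 (phaseMeasure n) := by
    filter_upwards [ae_lt_top' hmeas hF'.ne, hF.prodMk_left] with s h1 h2 using ⟨h2, h1⟩
  refine tendsto_integral_filter_of_dominated_convergence
    (fun s => (eLpNorm (F s) 2 (phaseMeasure n)).toReal * √C) ?_ ?_
    ((integrable_toReal_of_lintegral_ne_top hmeas hF'.ne).mul_const (√C)) ?_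
  · filter_upwards [h.1] with ε h1
    have h2 := h1.1.comp_quasiMeasurePreserving (quasiMeasurePreserving_shift ε ν)
    exact (hF.mul h2).integral_prod_right'
  · filter_upwards [h.1, hC] with ε h1 h2
    filter_upwards [hmem] with s hs
    exact (abs_integral_mul_shift_le hs h1 _).trans
      (mul_le_mul_of_nonneg_left (Real.sqrt_le_sqrt h2) ENNReal.toReal_nonneg)
  · filter_upwards [hmem] with s hs
    exact h.tendsto_integral_mul_shift hC hs s

omit [NeZero n] in
-- A test function independent of the path length is admissible because `P` has finite mass, so this
-- is the weak-* statement for such a function.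
lemma TendstoWeakL2.pathAvg {P : Measure ℝ} [IsProbabilityMeasure P]
    (h : TendstoWeakL2 (phaseMeasure n) g f₀)
    (hC : ∀ᶠ ε in 𝓝[>] (0 : ℝ), ∫ z, g ε z ^ 2 ∂phaseMeasure n ≤ C) :
    TendstoWeakL2 (phaseMeasure n) (fun ε => pathAvg P ε (g ε)) f₀ := by
  refine ⟨h.1.mono fun ε h1 => (memLp_pathAvg ε h1).1, h.2.1, fun F hF => ?_⟩
  have h1 := h.tendsto_integral_transported (ν := P) hC (F := fun _ => F) hF.1.comp_snd
    (by simpa using hF.2)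
  simp only [integral_const, probReal_univ, one_smul] at h1
  refine h1.congr' ?_
  filter_upwards [h.1] with ε h2
  have h3 := integrable_shift_mul (P := P) ε h2 hF
  have h4 := integral_integral_swap (f := fun z τ => g ε (shift (ε * τ) z) * F z) h3
  simp only [integral_mul_const] at h4
  simp only [mul_comm (F _)]
  exact h4.symm

end WeakConvergence

/-! ### The scattered source and the total flux. -/

section Averages

variable [NeZero n] {p : ℝ → ℝ} {σ : ℝ → ℝ} {σ₀ : ℝ} {Q : Pos n × Dir n → ℝ}

omit [NeZero n] in
lemma velAvg_congr {f f' : Pos n × Dir n → ℝ} (h : f =ᵐ[phaseMeasure n] f') :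
    velAvg f =ᵐ[volume] velAvg f' := by
  have h1 : ∀ᵐ x ∂(volume : Measure (Pos n)), ∀ᵐ v ∂dirMeasure n, f (x, v) = f' (x, v) :=
    Measure.ae_ae_of_ae_prod h
  filter_upwards [h1] with x hx using integral_congr_ae hx

lemma ae_of_ae_fst {A : Pos n → Prop} (h : ∀ᵐ z ∂phaseMeasure n, A z.1) :
    ∀ᵐ x ∂(volume : Measure (Pos n)), A x := by
  have h1 : ∀ᵐ x ∂(volume : Measure (Pos n)), ∀ᵐ _v ∂dirMeasure n, A x :=
    Measure.ae_ae_of_ae_prod h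
  filter_upwards [h1] with x hx
  exact hx.exists.choose_spec

/-- The scattered source converges weakly. -/
lemma tendstoWeakL2_scatteredSource (hp0 : ∀ s, 0 < s → 0 ≤ p s)
    (hp_one : ∫ s, p s ∂pathMeasure = 1) (hp : Integrable p pathMeasure)
    (hσ_meas : Measurable σ) (hσ_norm : ∀ v : Dir n, ∫ v', σ (cosine v v') ∂dirMeasure n = 1)
    (hσ₀ : 0 < σ₀) (hσ_lower : ∀ v v' : Dir n, σ₀ ≤ σ (cosine v v'))
    (hQ : MemLp Q 2 (phaseMeasure n)) :
    TendstoWeakL2 (phaseMeasure n) (fun ε => scatteredSource σ p Q ε)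
      (kernelOp (fun v v' => σ (cosine v v') - 0) Q) := by
  have := isProbabilityMeasure_pathLaw hp0 hp_one
  have hk := isKernel_sub hσ_meas hσ_norm hσ_lower hσ₀.le
  have h1 : TendstoWeakL2 (phaseMeasure n) (fun _ => Q) Q :=
    ⟨Eventually.of_forall fun _ => hQ, hQ, fun _ _ => tendsto_const_nhds⟩
  have h2 := (h1.pathAvg (P := pathLaw p) (Eventually.of_forall fun _ => le_rfl)).kernelOp hk
  refine h2.congr (Eventually.of_forall fun ε => ?_) EventuallyEq.rfl
  filter_upwards [(collision_eq_kernelOp hp0 hp_one hp hk (memLinftyL2_shift hQ ε)).2] with z hz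
  simp only [sub_zero] at hz ⊢
  exact hz.symm

/-- The total flux of a transported function. -/
lemma totalFlux_eq {Sigt : ℝ → ℝ} (hS : Integrable (survival Sigt) pathMeasure)
    (hpos : 0 < betaZero Sigt) {u : ℝ → Pos n × Dir n → ℝ} (hu : MemLinftyL2 u)
    {g : Pos n × Dir n → ℝ} {ε : ℝ}
    (h : ∀ᵐ y ∂pathMeasure.prod (phaseMeasure n), u y.1 y.2 = g (shift (ε * y.1) y.2)) :
    totalFlux Sigt u =ᵐ[volume] fun x => betaZero Sigt *
      velAvg (pathAvg (pathLaw fun s => (betaZero Sigt)⁻¹ * survival Sigt s) ε g) x := by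
  have hr0 : ∀ s, 0 < s → 0 ≤ (betaZero Sigt)⁻¹ * survival Sigt s := fun s _ =>
    mul_nonneg (inv_nonneg.2 hpos.le) (survival_pos _).le
  -- Normalized by `β₀`, survival is itself a path-length density. The total flux is then `β₀` times
  -- the collision integral for this density with the constant kernel one.
  have hr1 : ∫ s, (betaZero Sigt)⁻¹ * survival Sigt s ∂pathMeasure = 1 := by
    rw [integral_const_mul]
    exact inv_mul_cancel₀ hpos.ne'
  have := isProbabilityMeasure_pathLaw hr0 hr1
  have h1 := (collision_eq_kernelOp hr0 hr1 (hS.const_mul _) isKernel_one hu).2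
  simp only [kernelOp_one] at h1
  have h2 := ae_of_ae_fst (A := fun x => ∫ τ, ∫ v', 1 * ((betaZero Sigt)⁻¹ * survival Sigt τ)
    * u τ (x, v') ∂dirMeasure n ∂pathMeasure = velAvg (fun z => ∫ τ, u τ z
      ∂pathLaw fun s => (betaZero Sigt)⁻¹ * survival Sigt s) x) h1
  filter_upwards [h2, velAvg_congr (integral_eq_pathAvg
    (P := pathLaw fun s => (betaZero Sigt)⁻¹ * survival Sigt s) (pathLaw_absolutelyContinuous _) h)]
    with x h3 h4
  rw [← h4, ← h3]
  simp only [totalFlux, one_mul, mul_assoc, integral_const_mul]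
  rw [mul_inv_cancel_left₀ hpos.ne']
  simp only [integral_const_mul, mul_comm]

end Averages

end NonclassicalTransport

/-! ### The diffusion limit theorem. -/

open NonclassicalTransport in
theorem mainTheorem1
    (n : ℕ) (hn : 1 ≤ n)
    (c : ℝ) (hc0 : 0 < c) (hc1 : c < 1)
    (σ : ℝ → ℝ) (hσ_meas : Measurable σ)
    (hσ_norm : ∀ v : Dir n, ∫ v', σ (cosine v v') ∂dirMeasure n = 1)
    (σ₀ : ℝ) (hσ₀ : 0 < σ₀) (hσ_lower : ∀ v v' : Dir n, σ₀ ≤ σ (cosine v v'))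
    (Sigt : ℝ → ℝ) (hSigt_nonneg : ∀ s : ℝ, 0 < s → 0 ≤ Sigt s)
    (hSigt_int : ∀ s : ℝ, 0 < s → IntervalIntegrable Sigt volume 0 s)
    (hp_one : ∫ s, pathDensity Sigt s ∂pathMeasure = 1)
    (hp_mean : Integrable (fun s => s * pathDensity Sigt s) pathMeasure)
    (α d₀ : ℝ) (hd₀ : 0 < d₀)
    (hp_tail : ∀ s : ℝ, 1 < s → pathDensity Sigt s = d₀ / s ^ (α + 1))
    (Q : Pos n × Dir n → ℝ)
    (hQ1 : MemLp Q 1 (phaseMeasure n)) (hQ2 : MemLp Q 2 (phaseMeasure n))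
    (Ψ : ℝ → ℝ → Pos n × Dir n → ℝ)
    (hΨ : ∀ᶠ ε in 𝓝[>] (0 : ℝ),
      IsTransportSolution σ c (pathDensity Sigt) Q ε (scaling α ε) (Ψ ε)) :
    ∃ Ψ₀ : Pos n → ℝ, MemLp Ψ₀ 2 volume ∧
      -- weak-* convergence of the rescaled flux
      TendstoWeakStar Ψ (fun _ z => Ψ₀ z.1) ∧
      -- weak convergence of the averages
      TendstoWeakL2 (phaseMeasure n)
        (fun ε => scatteredAverage σ (pathDensity Sigt) (Ψ ε)) (fun z => Ψ₀ z.1) ∧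
      (∃ q : Pos n × Dir n → ℝ, TendstoWeakL2 (phaseMeasure n)
        (fun ε => scatteredSource σ (pathDensity Sigt) Q ε) q) ∧
      -- the total flux
      0 < betaZero Sigt ∧
      TendstoWeakL2 volume (fun ε => totalFlux Sigt (Ψ ε))
        (fun x => betaZero Sigt * Ψ₀ x) ∧
      -- the limit equations, with explicit positive coefficients
      ∀ e : Dir n,
        (2 < α →
          0 < coeffSmallTail σ (pathDensity Sigt) e ∧
          SolvesDiffusion (coeffSmallTail σ (pathDensity Sigt) e) (1 - c) Ψ₀
            (sourceAverage Q) ∧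
          SolvesDiffusion (coeffSmallTail σ (pathDensity Sigt) e) (1 - c)
            (fun x => betaZero Sigt * Ψ₀ x) (fun x => betaZero Sigt * sourceAverage Q x)) ∧
        (1 < α ∧ α < 2 →
          0 < coeffFrac α d₀ e ∧
          SolvesFracDiffusion α (coeffFrac α d₀ e) (1 - c) Ψ₀ (sourceAverage Q) ∧
          SolvesFracDiffusion α (coeffFrac α d₀ e) (1 - c)
            (fun x => betaZero Sigt * Ψ₀ x) (fun x => betaZero Sigt * sourceAverage Q x)) ∧
        (α = 2 →
          0 < coeffBorderline d₀ e ∧ coeffBorderline d₀ e = d₀ / (2 * (n : ℝ)) ∧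
          SolvesDiffusion (coeffBorderline d₀ e) (1 - c) Ψ₀ (sourceAverage Q) ∧
          SolvesDiffusion (coeffBorderline d₀ e) (1 - c)
            (fun x => betaZero Sigt * Ψ₀ x)
            (fun x => betaZero Sigt * sourceAverage Q x)) := by
  have : NeZero n := ⟨by omega⟩
  set p := pathDensity Sigt with hpdef
  have hp0 : ∀ s, 0 < s → 0 ≤ p s := fun s hs => pathDensity_nonneg hSigt_nonneg hs
  have hp : Integrable p pathMeasure := integrable_pathDensity hp_one
  have hα : 1 < α := one_lt_of_mean hd₀ hp_tail hp_mean
  have hP := isProbabilityMeasure_pathLaw hp0 hp_one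
  have hS := integrable_survival hSigt_nonneg hSigt_int hp_one hα hp_tail
  have hβ := betaZero_pos hS
  have hθ := eventually_scaling_pos α
  have hθ0 := tendsto_scaling (zero_lt_one.trans hα)
  have hk0 : IsKernel (fun v v' : Dir n => σ (cosine v v') - 0) (1 - 0) :=
    isKernel_sub hσ_meas hσ_norm hσ_lower hσ₀.le
  -- An arbitrary axis for computing the symbol; `D` agrees with the stated coefficient for every
  -- other axis.
  obtain ⟨e₀, -⟩ := exists_smul_dir (0 : Pos n)
  obtain ⟨a, α', D, hα'0, hα'2, hD, hlim, hgt, hlt, heq⟩ := exists_symbolLimit hc0 hc1 hp0 hp_one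
    hp hp_mean hα hd₀ hp_tail hσ₀ hσ_lower hσ_norm e₀
  have hκ : 0 < 1 - c := by linarith
  have hsmall : ∀ᶠ ε in 𝓝[>] (0 : ℝ), scaling α ε * (1 - c) ≤ σ₀ := by
    have h1 : Tendsto (fun ε => scaling α ε * (1 - c)) (𝓝[>] 0) (𝓝 0) := by
      simpa using hθ0.mul_const (1 - c)
    exact h1.eventually (eventually_le_nhds hσ₀)
  -- Smallness of `θ(1-c)` relative to `σ₀` keeps the perturbed kernel nonnegative; one boundary
  -- value is chosen for each small `ε`.
  obtain ⟨g, hg⟩ := Filter.skolem.1 ((hΨ.and hsmall).mono fun ε h =>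
    exists_reduced hp0 hp_one hp hσ_meas hσ_norm hσ₀ hσ_lower hQ2 h.2 h.1)
  obtain ⟨Ψ₀, hΨ₀, hw, ⟨C, hC⟩, hfourier⟩ := hlim.exists_limit e₀
    (isSymbol_limitSymbol hα'0 hα'2 hD.le hκ) hc1 hσ_meas hσ_norm hσ₀ hσ_lower hQ2 hθ hθ0
    (hg.mono fun ε h => h.1)
  have hweak : TendstoWeakL2 (phaseMeasure n) g (fun z => Ψ₀ z.1) :=
    ⟨hg.mono fun ε h => h.1.memLp, memLp_fst hΨ₀, hw⟩
  have hsol : SolvesFracDiffusion α' D (1 - c) Ψ₀ (sourceAverage Q) :=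
    solvesFracDiffusion_of_fourier hD hΨ₀ (memLp_velAvg hQ2).1 hfourier
  have hsolβ := hsol.const_mul (betaZero Sigt)
  refine ⟨Ψ₀, hΨ₀, ⟨hΨ.mono fun ε h => h.1, ?_, fun h hh => ?_⟩, ?_,
    ⟨_, tendstoWeakL2_scatteredSource hp0 hp_one hp hσ_meas hσ_norm hσ₀ hσ_lower hQ2⟩, hβ, ?_,
    fun e => ⟨fun h => ?_, fun h => ?_, fun h => ?_⟩⟩
  · simpa [shift] using memLinftyL2_shift (memLp_fst hΨ₀) 0
  · refine (hweak.tendsto_integral_transported hC hh.1 hh.2).congr' ?_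
    filter_upwards [hg] with ε h1
    refine integral_congr_ae ?_
    filter_upwards [Measure.ae_ae_of_ae_prod h1.2.1] with s hs
    exact integral_congr_ae (hs.mono fun z hz => by simp only [hz])
  · refine ((hweak.pathAvg (P := pathLaw p) hC).kernelOp hk0).congr ?_ (ae_of_all _ fun z => ?_)
    · exact hg.mono fun ε h => h.2.2.mono fun z hz => hz.symm
    -- The unperturbed kernel has mass one, so it fixes functions of position and the limit of `φ_ε`
    -- is `Ψ₀` itself.
    · rw [hk0.kernelOp_fst Ψ₀]
      ring
  · have hr1 : IsProbabilityMeasure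
        (pathLaw fun s => (betaZero Sigt)⁻¹ * survival Sigt s) := by
      refine isProbabilityMeasure_pathLaw (fun s _ =>
        mul_nonneg (inv_nonneg.2 hβ.le) (survival_pos s).le) ?_
      rw [integral_const_mul]
      exact inv_mul_cancel₀ hβ.ne'
    refine ((hweak.pathAvg (P := pathLaw fun s => (betaZero Sigt)⁻¹ * survival Sigt s)
        hC).velAvg.const_mul (betaZero Sigt)).congr ?_ (ae_of_all _ fun x => ?_)
    · filter_upwards [hg, hΨ] with ε h1 h2
      exact (totalFlux_eq hS hβ h2.1 h1.2.1).symm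
    · simp [velAvg]
  · obtain ⟨rfl, hcoeff⟩ := hgt h
    rw [hcoeff e]
    exact ⟨hD, hsol.solvesDiffusion, hsolβ.solvesDiffusion⟩
  · obtain ⟨rfl, hcoeff⟩ := hlt h.2
    rw [hcoeff e]
    exact ⟨hD, hsol, hsolβ⟩
  · obtain ⟨rfl, hcoeff⟩ := heq h
    refine ⟨by rwa [hcoeff e], ?_, ?_⟩
    · rw [coeffBorderline, integral_cosine_sq]
      field_simp
    · rw [hcoeff e]
      exact ⟨hsol.solvesDiffusion, hsolβ.solvesDiffusion⟩
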